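/- **Theorem (Guaranteed a posteriori error estimate distinguishing the error components for multiphase compositional Darcy flow).** *Model.* Let $\Omega\subset\mathbb R^d$, $d\ge1$, be a bounded polytopal domain (open, connected, without slits), $\mathcal P$, $\mathcal C$ finite sets of phases and components, $\mathcal C_p\subset\mathcal C$ the components of the phase $p$, and $\mathcal P_c=\{p: c\in\mathcal C_p\}$. The unknowns are $\boldsymbol X=(P,(S_p)_p,(C_{p,c})_{p,\,c\in\mathcal C_p})$. With capillary pressure functions $P_{{\rm c}_p}$ and relative permeabilities $k_{{\rm r},p}$, put $P_p=P+P_{{\rm c}_p}(S_p)$, $\nu_p=\varsigma_pk_{{\rm r},p}(S_p)/\mu_p$, $l_c=\phi\sum_{p\in\mathcal P_c}\varsigma_pS_pC_{p,c}$, $\theta_c=-\sum_{p\in\mathcal P_c}\nu_pC_{p,c}\mathbf K(\nabla P_p+\rho_pg\nabla z)$. The porosity $\phi$ (constant in time), permeability $\mathbf K$ (symmetric positive definite), viscosity $\mu_p>0$, molar and mass densities $\varsigma_p,\rho_p$, and source terms $q_c$ are constant on each element and time step of the space-time mesh below. Assume that there is a weak solution $\boldsymbol X$ on $(0,t_{\rm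 F})$: $l_c\in H^1(0,t_{\rm F};L^2(\Omega))$, $P_p\in L^2(0,t_{\rm F};H^1(\Omega))$, $\theta_c\in L^2(0,t_{\rm F};L^2(\Omega)^d)$, $\int_0^{t_{\rm F}}\{(\partial_tl_c,\varphi)-(\theta_c,\nabla\varphi)\}\,dt=\int_0^{t_{\rm F}}(q_c,\varphi)\,dt$ for all $\varphi\in L^2(0,t_{\rm F};H^1(\Omega))$ and all $c$, $l_c(0)=l_c^0$, $\sum_pS_p=1$, $\sum_{c\in\mathcal C_p}C_{p,c}=1$ for all $p$, and the fugacities of each component $c$ (given functions of $\boldsymbol X$) are equal in all phases of $\mathcal P_c$. *Meshes.* Let $0=t^0<\dots<t^N=t_{\rm F}$, $\tau^n=t^n-t^{n-1}$, $I^n=[t^{n-1},t^n]$. For each $n$, $\mathcal T_H^n$ is a polytopal mesh of $\Omega$: each element $K$ is the union of the simplices of a face-connected submesh $\mathcal T_K$, and all these simplices form a conforming simplicial mesh of $\Omega$. Denote by $h_K$ the diameter and by $|K|$ the measure of $K$, and by $\mathcal F_K^{\rm ext}$, $\mathcal F_K^{\rm int}$, $\mathcal V_K$ the simplicial faces of $\mathcal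 T_K$ on $\partial K$, those inside $K$, and the vertices of $\mathcal T_K$. The simplicial faces on element boundaries are grouped into planar polytopal faces $\sigma$; let $\mathcal F_K$ be the faces of $K$ and $\mathcal F^{\rm int}_H$ the faces shared by two elements. Fix $1\le n\le N$ and assume that $\mathcal T_H^n$ refines $\mathcal T_H^{n-1}$ (no coarsening); elementwise values at $t^{n-1}$ are regarded as elementwise values on $\mathcal T_H^n$. *Scheme.* Let $\mathcal X=(\boldsymbol X_K)_K$ collect the discrete unknowns, with $l_{c,K},\nu_{p,K},P_{p,K}$ obtained by evaluating the above formulas on $K$. Fix transmissibilities $\tau^\sigma_{K'}$ (of opposite sign seen from the two sides of $\sigma$), face mass densities $\rho_{p,\sigma}$, and cell values $z_{K'}$, and set, for $\sigma\in\mathcal F_K\cap\mathcal F_H^{\rm int}$, $$v_{p,K,\sigma}(\mathcal X)=\sum_{K'}\tau^\sigma_{K'}(P_{p,K'}+\rho_{p,\sigma}gz_{K'}),\quad F_{c,K,\sigma}(\mathcal X)=\sum_{p\in\mathcal P_c}\nu_{p,K}C_{p,c,K}v_{p,K,\sigma}(\mathcal X),\quad F_{c,K,\sigma,\uparrow}(\mathcal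 X)=\sum_{p\in\mathcal P_c}\nu_{p,K_p^\uparrow}C_{p,c,K_p^\uparrow}v_{p,K,\sigma}(\mathcal X),$$ where $K_p^\uparrow$ is the upstream element: the one of the two elements sharing $\sigma$ out of which $v_p$ is directed (if $v_p=0$, one of the two, chosen once for each face). The backward Euler scheme is $$\tfrac{|K|}{\tau^n}\bigl(l_{c,K}(\boldsymbol X^n_K)-l_{c,K}(\boldsymbol X^{n-1}_K)\bigr)+\sum_{\sigma\in\mathcal F_K\cap\mathcal F_H^{\rm int}}F_{c,K,\sigma,\uparrow}(\mathcal X^n)=|K|q^n_{c,K}\qquad\forall c,K.$$ For $k,i,j\ge1$ let $\mathcal X^{n,k-1}$ be the previous linearization iterate and $\mathcal X^{n,k,i}$, $\mathcal X^{n,k,i+j}$ arbitrary iterates of the algebraic solver. For $m\in\{i,i+j\}$ let $l_{c,K}^{n,k,m}=l_{c,K}(\boldsymbol X_K^{n,k-1})+l_{c,K}'(\boldsymbol X_K^{n,k-1})\cdot(\boldsymbol X^{n,k,m}_K-\boldsymbol X_K^{n,k-1})$, let $F^{n,k,m}_{c,K,\sigma,\uparrow}$ be a linearized flux at $\mathcal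 X^{n,k,m}$ (Newton: first-order expansion of $F_{c,K,\sigma,\uparrow}$ at $\mathcal X^{n,k-1}$; blended Newton and fixed point: $\nu_{p,K_p^\uparrow}C_{p,c,K_p^\uparrow}$ and the upstream element taken at $\mathcal X^{n,k-1}$ and $v_{p,K,\sigma}$ expanded at $\mathcal X^{n,k-1}$; or any other affine function of $\mathcal X^{n,k,m}$, opposite from the two sides of $\sigma$), and define the algebraic residual by $$R^{n,k,m}_{c,K}=\tfrac{|K|}{\tau^n}\bigl(l^{n,k,m}_{c,K}-l_{c,K}(\boldsymbol X_K^{n-1})\bigr)+\sum_{\sigma\in\mathcal F_K\cap\mathcal F_H^{\rm int}}F_{c,K,\sigma,\uparrow}^{n,k,m}-|K|q_{c,K}^n .$$ *Face fluxes and point values.* For $\sigma\in\mathcal F_K\cap\mathcal F_H^{\rm int}$ and $t\in I^n$ set $$U^t_{K,p,\sigma}=\tfrac{t-t^{n-1}}{\tau^n}\sum_{K'}\tau_{K'}^\sigma P^{n,k,i}_{p,K'}+\tfrac{t^n-t}{\tau^n}\sum_{K'}\tau_{K'}^\sigma P^{n-1}_{p,K'},\qquad \Theta^t_{{\rm tm},K,c,\sigma}=\tfrac{t^n-t}{\tau^n}\bigl(F_{c,K,\sigma}(\mathcal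 X^{n,k,i})-F_{c,K,\sigma}(\mathcal X^{n-1})\bigr),$$ $$\Theta_{{\rm upw},K,c,\sigma}=F_{c,K,\sigma,\uparrow}(\mathcal X^{n,k,i})-F_{c,K,\sigma}(\mathcal X^{n,k,i}),\quad \Theta_{{\rm lin},K,c,\sigma}=F^{n,k,i}_{c,K,\sigma,\uparrow}-F_{c,K,\sigma,\uparrow}(\mathcal X^{n,k,i}),\quad \Theta_{{\rm alg},K,c,\sigma}=F^{n,k,i+j}_{c,K,\sigma,\uparrow}-F^{n,k,i}_{c,K,\sigma,\uparrow}.$$ The values are distributed to the simplicial faces $\sigma'\subset\sigma$ proportionally to $|\sigma'|$. On $\partial\Omega$ all of them are zero, except $U^t_{K,p,\sigma'}=\langle\mathbf K\rho_pg\nabla z\cdot\mathbf n_\Omega,1\rangle_{\sigma'}$. Let $Z^t_{p,a}$ be potential point values at the vertices $a$ of the simplicial mesh: either zero on $\partial\Omega$, the cell value $\frac{t-t^{n-1}}{\tau^n}P_{p,K}^{n,k,i}+\frac{t^n-t}{\tau^n}P_{p,K}^{n-1}$ for $a$ inside $K$, and otherwise the average of these values over the elements sharing $a$, or the average of given affine-in-time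 face values (Lagrange multipliers) over the polytopal faces sharing $a$; or any other prescribed values, affine in time. Put $Z^{{\rm ext},t}_{p,\sigma}=\frac1d\sum_{a\in\sigma}Z^t_{p,a}$ for the simplicial faces $\sigma$. Let $U^t_{K,p}$, $\Theta_{\bullet,K,c}$, $Z^{{\rm ext},t}_{p,K}$ (indexed by $\mathcal F_K^{\rm ext}$) and $Z^t_{p,K}$ (indexed by $\mathcal V_K$) be the element vectors. *Element matrices.* Let $v_\sigma$ be the basis functions of $\mathbf{RT}_0(\mathcal T_K)\cap \mathbf H({\rm div},K)$ with unit flux through one face (outward on $\partial K$) and zero flux through the others, $q_j$ a basis of the piecewise constants on $\mathcal T_K$ with mean zero, and $\psi_a$ the hat functions. Set $$\widehat A_{{\rm MFE},K}=A_{ee}-\begin{pmatrix}A_{ie}\\B_e\end{pmatrix}^{\!t}\begin{pmatrix}A_{ii}&B_i^t\\B_i&0\end{pmatrix}^{\!-1}\begin{pmatrix}A_{ie}\\B_e\end{pmatrix},$$ where $A_{\bullet\bullet}$ are the blocks of $(\mathbf K^{-1}v_{\sigma'},v_\sigma)_K$ and $B_\bullet$ of $-(\nabla\cdot v_\sigma,q_j)_K$,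 with $e,i$ referring to $\mathcal F_K^{\rm ext},\mathcal F_K^{\rm int}$; $(\widehat S_{{\rm FE},K})_{a,a'}=(\mathbf K\nabla\psi_{a'},\nabla\psi_a)_K$; $(\widehat M_{{\rm FE},K})_{a,a'}=(\psi_{a'},\psi_a)_K$. *Approximate solution and error measure.* A vector of fluxes through the faces of $\mathcal F_K^{\rm ext}$ is lifted to the field of $\mathbf{RT}_0(\mathcal T_K)\cap \mathbf H({\rm div},K)$ with these normal fluxes and constant divergence that minimizes $\|\mathbf K^{-1/2}\cdot\|_K$. Let $u_{p,h\tau}$ and $\theta_{c,h\tau}$ be affine in time on $I^n$, given on each $K$ at $t^n$ and $t^{n-1}$ by the liftings of $U^{t}_{K,p}$ at $t=t^n,t^{n-1}$, respectively of $F_{c,K,\sigma}(\mathcal X^{n,k,i})$ and $F_{c,K,\sigma}(\mathcal X^{n-1})$ (zero on $\partial\Omega$), and let $l_{c,h\tau}|_K$ be affine in time between $l_{c,K}(\boldsymbol X_K^{n-1})$ and $l_{c,K}(\boldsymbol X_K^{n,k,i})$. With $X^n=L^2(I^n;H^1(\Omega))$ and $\|\varphi\|_{X^n}^2=\int_{I^n}\sum_K\{h_K^{-2}\|\varphi\|_K^2+\|\mathbf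 K^{1/2}\nabla\varphi\|_K^2\}\,dt$, let $$\mathcal N_c=\sup_{\varphi\in X^n,\ \|\varphi\|_{X^n}=1}\int_{I^n}\{(q_c,\varphi)-(\partial_tl_{c,h\tau},\varphi)+(\theta_{c,h\tau},\nabla\varphi)\}\,dt,$$ $$\mathcal N_p=\inf_{\zeta\in X^n}\Bigl\{\sum_{c\in\mathcal C_p}\int_{I^n}\sum_K(\nu^{n,k,i}_{p,K}C^{n,k,i}_{p,c,K})^2\|\mathbf K^{-1/2}(u_{p,h\tau}+\mathbf K\nabla\zeta)\|_K^2\,dt\Bigr\}^{1/2},\qquad \mathcal N=\Bigl\{\sum_c\mathcal N_c^2\Bigr\}^{1/2}+\Bigl\{\sum_p\mathcal N_p^2\Bigr\}^{1/2}.$$ *Claim.* Each $\mathcal N_c$ is finite and $$\mathcal N\le\Bigl\{\sum_{c\in\mathcal C}(\eta_{{\rm sp},c}+\eta_{{\rm tm},c}+\eta_{{\rm lin},c}+\eta_{{\rm alg},c}+\eta_{{\rm rem},c})^2\Bigr\}^{1/2},\qquad \eta_{\bullet,c}=\Bigl\{\delta_\bullet\int_{I^n}\sum_K\eta_{\bullet,K,c}^2\,dt\Bigr\}^{1/2},$$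 with $\delta_{\rm sp}=4$ and $\delta_\bullet=2$ otherwise, and $$\eta_{{\rm sp},K,c}=\eta_{{\rm upw},K,c}+\Bigl\{\sum_{p\in\mathcal P_c}\eta_{{\rm NC},K,c,p}^2\Bigr\}^{1/2},\quad \eta_{{\rm upw},K,c}^2=\Theta_{\rm upw}^t\widehat A_{{\rm MFE},K}\Theta_{\rm upw},\quad \eta_{{\rm tm},K,c}^2=\Theta_{\rm tm}^t\widehat A_{{\rm MFE},K}\Theta_{\rm tm},$$ $$\eta_{{\rm NC},K,c,p}^2=(\nu^{n,k,i}_{p,K}C^{n,k,i}_{p,c,K})^2\Bigl[U^t\widehat A_{{\rm MFE},K}U+Z^t\widehat S_{{\rm FE},K}Z+2U^tZ^{\rm ext}-2\sum_{\sigma\in\mathcal F_K^{\rm ext}}U_\sigma|K|^{-1}\mathbf 1^t\widehat M_{{\rm FE},K}Z\Bigr],$$ $$\eta_{{\rm lin},K,c}^2=\Theta_{\rm lin}^t\widehat A_{{\rm MFE},K}\Theta_{\rm lin}+\Bigl(\frac{h_K}{\tau^n}\|l^{n,k,i}_{c,K}-l_{c,K}(\boldsymbol X^{n,k,i}_K)\|_K\Bigr)^2,\quad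 \eta_{{\rm alg},K,c}^2=\Theta_{\rm alg}^t\widehat A_{{\rm MFE},K}\Theta_{\rm alg}+\Bigl(\frac{h_K}{\tau^n}\|l^{n,k,i+j}_{c,K}-l^{n,k,i}_{c,K}\|_K\Bigr)^2,$$ $$\eta_{{\rm rem},K,c}=h_K|K|^{-1/2}|R^{n,k,i+j}_{c,K}|,$$ where $\|\cdot\|_K$ is the $L^2(K)$ norm, $U=U^t_{K,p}$, $Z=Z^t_{p,K}$, $Z^{\rm ext}=Z^{{\rm ext},t}_{p,K}$, and $\Theta_\bullet=\Theta_{\bullet,K,c}$ (superscript $t$ after a vector denotes the transpose in products). -/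

import Mathlib

open MeasureTheory

namespace MultiphaseDarcy

open scoped ContDiff RealInnerProductSpace Classical Matrix

noncomputable section

/-- The physical space `ℝᵈ` with its Euclidean norm. -/
abbrev E (d : ℕ) := EuclideanSpace ℝ (Fin d)

/-! ### Sobolev and Bochner spaces -/

/-- Smooth functions with compact support in the set `U`. -/
def IsTest {F : Type*} [NormedAddCommGroup F] [NormedSpace ℝ F] (U : Set F) (ψ : F → ℝ) : Prop :=
  ContDiff ℝ ∞ ψ ∧ HasCompactSupport ψ ∧ tsupport ψ ⊆ U

/-- `v` belongs to `H¹(Ω)` and `w` is its weak gradient. -/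
def IsWeakGradient {d : ℕ} (Ω : Set (E d)) (v : E d → ℝ) (w : E d → E d) : Prop :=
  MemLp v 2 (volume.restrict Ω) ∧ MemLp w 2 (volume.restrict Ω) ∧
    ∀ ψ : E d → ℝ, IsTest Ω ψ → ∀ i : Fin d,
      ∫ x in Ω, v x * fderiv ℝ ψ x (EuclideanSpace.single i 1) = -∫ x in Ω, w x i * ψ x

/-- Lebesgue measure of the space-time cylinder `(a, b) × Ω`. -/
def spaceTime {d : ℕ} (a b : ℝ) (Ω : Set (E d)) : Measure (ℝ × E d) :=
  (volume.restrict (Set.Icc a b)).prod (volume.restrict Ω)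

/-- (Representatives of) elements of `L²((a, b); H¹(Ω))`, together with their weak gradient in
space. -/
structure L2H1 {d : ℕ} (a b : ℝ) (Ω : Set (E d)) where
  val : ℝ → E d → ℝ
  grad : ℝ → E d → E d
  memLp_val : MemLp (fun z : ℝ × E d => val z.1 z.2) 2 (spaceTime a b Ω)
  memLp_grad : MemLp (fun z : ℝ × E d => grad z.1 z.2) 2 (spaceTime a b Ω)
  weak : ∀ᵐ t ∂(volume.restrict (Set.Icc a b)), IsWeakGradient Ω (val t) (grad t)

/-- Matrix acting on a vector of `ℝᵈ`. -/
def act {d : ℕ} (A : Matrix (Fin d) (Fin d) ℝ) (v : E d) : E d :=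
  Matrix.toEuclideanCLM (n := Fin d) (𝕜 := ℝ) A v

/-- `|A^{1/2} v|²` for a symmetric positive definite `A`. -/
def normSq {d : ℕ} (A : Matrix (Fin d) (Fin d) ℝ) (v : E d) : ℝ := ⟪act A v, v⟫

/-- Divergence of a vector field. -/
def divergence {d : ℕ} (f : E d → E d) (x : E d) : ℝ :=
  LinearMap.trace ℝ (E d) (fderiv ℝ f x : E d →ₗ[ℝ] E d)

/-! ### Meshes -/

/-- The closed simplex with vertex set `κ`. -/
def body {d : ℕ} (κ : Finset (E d)) : Set (E d) := convexHull ℝ (κ : Set (E d))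

/-- Lebesgue measure of the simplex with vertex set `κ`. -/
def vol {d : ℕ} (κ : Finset (E d)) : ℝ := volume.real (body κ)

/-- `(d-1)`-dimensional measure of the simplex with vertex set `s`. -/
def area {d : ℕ} (s : Finset (E d)) : ℝ :=
  (Measure.euclideanHausdorffMeasure (d - 1) : Measure (E d)).real (body s)

/-- A (conforming) simplicial mesh of `Ω`; simplices are represented by their vertex sets. -/
structure SimplicialMesh (d : ℕ) (Ω : Set (E d)) where
  simplices : Finset (Finset (E d))
  card_eq : ∀ κ ∈ simplices, κ.card = d + 1
  affineIndependent : ∀ κ ∈ simplices, AffineIndependent ℝ (Subtype.val : κ → E d)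
  inter_eq : ∀ κ ∈ simplices, ∀ κ' ∈ simplices, body κ ∩ body κ' = body (κ ∩ κ')
  cover : ⋃ κ ∈ simplices, body κ = closure Ω

section Cell

/- A polytope is represented by its simplicial submesh `K`, a finite set of simplices. -/
variable {d : ℕ} (K : Finset (Finset (E d)))

/-- The polytope itself. -/
def cellSet : Set (E d) := ⋃ κ ∈ K, body κ

/-- `|K|`. -/
def cellVol : ℝ := volume.real (cellSet K)

/-- `h_K`. -/
def cellDiam : ℝ := Metric.diam (cellSet K)

/-- Vertices of the submesh. -/
def verts : Finset (E d) := K.biUnion id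

/-- The `(d-1)`-dimensional simplicial faces of the submesh. -/
def subfaces : Finset (Finset (E d)) := K.biUnion fun κ => κ.powersetCard d

/-- Simplices of the submesh that contain the face `s` (one or two of them). -/
def star (s : Finset (E d)) : Finset (Finset (E d)) := K.filter fun κ => s ⊆ κ

/-- Simplicial faces of the submesh on the boundary of the polytope. -/
def extFaces : Finset (Finset (E d)) := (subfaces K).filter fun s => (star K s).card = 1

/-- Simplicial faces of the submesh inside the polytope. -/
def intFaces : Finset (Finset (E d)) := (subfaces K).filter fun s => (star K s).card ≠ 1

end Cell

/-- A polytopal mesh with a virtual simplicial submesh. `elems` groups the simplices into polytopes,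
and `faces` groups the simplicial faces on the boundaries of the polytopes into polytopal faces.
Of the topological properties of the polytopes only the connectedness of the submesh through its
faces is kept; it holds for every polytope with connected interior. -/
structure PolytopalMesh (d : ℕ) (Ω : Set (E d)) extends SimplicialMesh d Ω where
  elems : Finpartition simplices
  connected : ∀ K ∈ elems.parts, ∀ κ ∈ K, ∀ κ' ∈ K,
    Relation.ReflTransGen (fun a b => a ∈ K ∧ b ∈ K ∧ (a ∩ b).card = d) κ κ'
  faces : Finpartition (elems.parts.biUnion extFaces)
  faces_adjacent : ∀ σ ∈ faces.parts, ∀ s ∈ σ, ∀ s' ∈ σ, ∀ K ∈ elems.parts,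
    s ∈ extFaces K → s' ∈ extFaces K
  faces_planar : ∀ σ ∈ faces.parts, ∃ v : E d, v ≠ 0 ∧ ∃ r : ℝ, ∀ s ∈ σ, ∀ a ∈ s, ⟪v, a⟫ = r

namespace PolytopalMesh

variable {d : ℕ} {Ω : Set (E d)} (M : PolytopalMesh d Ω)

/-- The polytopal elements. -/
abbrev Elem := {K : Finset (Finset (E d)) // K ∈ M.elems.parts}

/-- The polytopal faces. -/
abbrev Face := {σ : Finset (Finset (E d)) // σ ∈ M.faces.parts}

/-- The faces of the element `K`. -/
def facesOf (K : M.Elem) : Finset M.Face := Finset.univ.filter fun σ => σ.1 ⊆ extFaces K.1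

/-- Faces shared by two different elements; the other faces lie on the boundary of `Ω`. -/
def IsInterior (σ : M.Face) : Prop :=
  ∃ K L : M.Elem, K ≠ L ∧ σ ∈ M.facesOf K ∧ σ ∈ M.facesOf L

/-- `|σ|`, the sum of the measures of the simplicial faces that tile `σ`. -/
def faceArea (σ : M.Face) : ℝ := ∑ s ∈ σ.1, area s

/-- The element on the other side of `σ` (and `K` itself on the boundary). -/
def across (σ : M.Face) (K : M.Elem) : M.Elem :=
  if h : ∃ L : M.Elem, L ≠ K ∧ σ ∈ M.facesOf L then h.choose else K

/-- `M` is obtained from `M'` by refinement only (no coarsening). -/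
def Refines (M' : PolytopalMesh d Ω) : Prop :=
  ∀ K : M.Elem, ∃ K' : M'.Elem, cellSet K.1 ⊆ cellSet K'.1

/-- Elementwise values on `M'`, seen as elementwise values on a refinement `M`. -/
def prolong (M' : PolytopalMesh d Ω) {α : Type*} [Zero α] (X : M'.Elem → α) (K : M.Elem) : α :=
  if h : ∃ K' : M'.Elem, cellSet K.1 ⊆ cellSet K'.1 then X h.choose else 0

end PolytopalMesh

/-! ### Element matrices -/

section Matrices

variable {d : ℕ} (K : Finset (Finset (E d))) (A : Matrix (Fin d) (Fin d) ℝ)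

/-- Orientation of the face `s` seen from the simplex `κ`: an interior face is directed out of one
of its two simplices, a boundary face is directed out of the polytope. -/
def rtSign (s κ : Finset (E d)) : ℝ :=
  if h : (star K s).Nonempty then (if κ = h.choose then 1 else -1) else 0

/-- Restriction to the simplex `κ` of the Raviart--Thomas basis function associated with the face
`s`, i.e. `± (x - a) / (d |κ|)`, with `a` the vertex of `κ` opposite to `s`: its flux through `s`
is one and its flux through the other faces vanishes. -/
def rtBasis (s κ : Finset (E d)) (x : E d) : E d :=
  if s ⊆ κ then (rtSign K s κ * ((d : ℝ) * vol κ)⁻¹) • (x - ∑ a ∈ κ \ s, a) else 0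

/-- Restriction to `κ` of the field of `RT₀(T_K) ∩ H(div, K)` with face normal fluxes `w`. -/
def rtLocal (w : Finset (E d) → ℝ) (κ : Finset (E d)) (x : E d) : E d :=
  ∑ s ∈ subfaces K, w s • rtBasis K s κ x

/-- The field of `RT₀(T_K) ∩ H(div, K)` with face normal fluxes `w`. -/
def rtField (w : Finset (E d) → ℝ) (x : E d) : E d :=
  ∑ κ ∈ K, (interior (body κ)).indicator (rtLocal K w κ) x

/-- `(A⁻¹ v_{s'}, v_s)_K`. -/
def rtGram (s s' : Finset (E d)) : ℝ :=
  ∑ κ ∈ K, ∫ x in body κ, ⟪act A⁻¹ (rtBasis K s' κ x), rtBasis K s κ x⟫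

/-- Piecewise constants on the submesh with mean value zero. -/
def meanZero : Submodule ℝ (K → ℝ) :=
  LinearMap.ker (∑ κ : K, vol κ.1 • (LinearMap.proj κ : (K → ℝ) →ₗ[ℝ] ℝ))

/-- `-(div v_s, q)_K`. -/
def rtDiv (q : K → ℝ) (s : Finset (E d)) : ℝ :=
  -∑ κ : K, ∫ x in body κ.1, divergence (rtBasis K s κ.1) x * q κ

/-- The element matrix of the mixed finite element method. -/
def mfeMatrix : Matrix (extFaces K) (extFaces K) ℝ :=
  let b := Module.finBasis ℝ (meanZero K)
  let Aee : Matrix (extFaces K) (extFaces K) ℝ := Matrix.of fun s s' => rtGram K A s.1 s'.1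
  let Aie : Matrix (intFaces K) (extFaces K) ℝ := Matrix.of fun s s' => rtGram K A s.1 s'.1
  let Aii : Matrix (intFaces K) (intFaces K) ℝ := Matrix.of fun s s' => rtGram K A s.1 s'.1
  let Be : Matrix (Fin (Module.finrank ℝ (meanZero K))) (extFaces K) ℝ :=
    Matrix.of fun i s => rtDiv K (b i).1 s.1
  let Bi : Matrix (Fin (Module.finrank ℝ (meanZero K))) (intFaces K) ℝ :=
    Matrix.of fun i s => rtDiv K (b i).1 s.1
  Aee - (Matrix.fromRows Aie Be)ᵀ * (Matrix.fromBlocks Aii Biᵀ Bi 0)⁻¹ * Matrix.fromRows Aie Be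

/-- Restriction to the simplex `κ` of the hat function of the vertex `a`: the affine function with
the value one at `a` and zero at the other vertices. -/
def hat (κ : Finset (E d)) (a : E d) : E d → ℝ :=
  if h : ∃ f : E d →ᵃ[ℝ] ℝ, ∀ b ∈ κ, f b = if b = a then 1 else 0 then h.choose else 0

/-- The element stiffness matrix of piecewise affine finite elements. -/
def stiffMatrix : Matrix (verts K) (verts K) ℝ :=
  Matrix.of fun a a' => ∑ κ ∈ K, ∫ x in body κ,
    ⟪act A (gradient (hat κ a'.1) x), gradient (hat κ a.1) x⟫

/-- The element mass matrix of piecewise affine finite elements. -/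
def massMatrix : Matrix (verts K) (verts K) ℝ :=
  Matrix.of fun a a' => ∑ κ ∈ K, ∫ x in body κ, hat κ a'.1 x * hat κ a.1 x

/-- The field with face normal fluxes `w` has the boundary face fluxes `U` and a divergence that is
constant on the polytope. -/
def IsAdmissible (U w : Finset (E d) → ℝ) : Prop :=
  (∀ s ∈ extFaces K, w s = U s) ∧
    ∃ r : ℝ, ∀ κ ∈ K, ∀ x ∈ body κ, divergence (rtLocal K w κ) x = r

/-- `‖v‖²` in the norm with weight `A^{-1/2}` on `K`, for the field with face normal fluxes `w`. -/
def rtEnergy (w : Finset (E d) → ℝ) : ℝ := ∫ x in cellSet K, normSq A⁻¹ (rtField K w x)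

/-- Lifting of the boundary face fluxes `U` into the polytope: (the face normal fluxes of) the
minimizer of the energy among the admissible fields. -/
def lift (U : Finset (E d) → ℝ) : Finset (E d) → ℝ :=
  Classical.epsilon fun w =>
    IsAdmissible K U w ∧ ∀ w', IsAdmissible K U w' → rtEnergy K A w ≤ rtEnergy K A w'

/-- Outward unit normal of the simplex `κ` on its face `s`. -/
def outerNormal (κ s : Finset (E d)) : E d :=
  -(‖gradient (hat κ (∑ b ∈ κ \ s, b)) 0‖⁻¹ • gradient (hat κ (∑ b ∈ κ \ s, b)) 0)

end Matrices

/-! ### The multiphase compositional problem -/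

section Problem

variable {Ph Co : Type*} [Fintype Ph] [Fintype Co]

/-- The unknowns `(P, (S_p)_p, (C_{p,c})_{p, c ∈ C_p})`. -/
abbrev Unknowns (comp : Ph → Finset Co) : Type _ :=
  ℝ × (Ph → ℝ) × ({pc : Ph × Co // pc.2 ∈ comp pc.1} → ℝ)

/-- The phases that contain the component `c`. -/
abbrev PhasesOf (comp : Ph → Finset Co) (c : Co) : Type _ := {p : Ph // c ∈ comp p}

/-- The molar fraction of the component `c` in the phase `p`. -/
def molar {comp : Ph → Finset Co} {c : Co} (x : Unknowns comp) (p : PhasesOf comp c) : ℝ :=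
  x.2.2 ⟨(p.1, c), p.2⟩

/-- Data of the problem and the space-time mesh. The functions that are constant on each element
and each time step are given by their elementwise values on the mesh of the time step. -/
structure Problem (d : ℕ) (Ph Co : Type*) [Fintype Ph] [Fintype Co] where
  /-- The domain; it has no slits, as every Lipschitz domain. -/
  Ω : Set (E d)
  isOpen : IsOpen Ω
  isConnected : IsConnected Ω
  interior_closure : interior (closure Ω) = Ω
  /-- The components of each phase. -/
  comp : Ph → Finset Co
  /-- Capillary pressure functions. -/
  Pc : Ph → ℝ → ℝ
  /-- Relative permeability functions. -/
  kr : Ph → ℝ → ℝ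
  /-- Fugacity of a component in a phase. -/
  fug : Ph → Co → Unknowns comp → ℝ
  /-- Gravitation acceleration constant. -/
  g : ℝ
  /-- The vertical unit vector `∇z`. -/
  up : E d
  norm_up : ‖up‖ = 1
  N : ℕ
  /-- The discrete times. -/
  time : ℕ → ℝ
  time_zero : time 0 = 0
  time_lt : ∀ n < N, time n < time (n + 1)
  mesh : ℕ → PolytopalMesh d Ω
  /-- Porosity, constant in time. -/
  porosity : ∀ n, (mesh n).Elem → ℝ
  porosity_const : ∀ m n (K : (mesh m).Elem) (L : (mesh n).Elem),
    (interior (cellSet K.1) ∩ interior (cellSet L.1)).Nonempty → porosity m K = porosity n L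
  /-- Permeability tensor. -/
  perm : ∀ n, (mesh n).Elem → Matrix (Fin d) (Fin d) ℝ
  perm_posDef : ∀ n K, (perm n K).PosDef
  /-- Molar density. -/
  molarDensity : ∀ n, (mesh n).Elem → Ph → ℝ
  /-- Dynamic viscosity. -/
  viscosity : ∀ n, (mesh n).Elem → Ph → ℝ
  viscosity_pos : ∀ n K p, 0 < viscosity n K p
  /-- Mass density. -/
  massDensity : ∀ n, (mesh n).Elem → Ph → ℝ
  /-- Source or sink terms. -/
  source : ∀ n, (mesh n).Elem → Co → ℝ
  /-- Initial amounts. -/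
  initial : Co → E d → ℝ

namespace Problem

variable {d : ℕ} (P : Problem d Ph Co)

/-- The phase pressure `P_p = P + P_{c_p}(S_p)`. -/
def phasePressure (p : Ph) (x : Unknowns P.comp) : ℝ := x.1 + P.Pc p (x.2.1 p)

/-- The mobility, with the molar density `ς` and the viscosity `μ`. -/
def mobility (ς μ : Ph → ℝ) (p : Ph) (x : Unknowns P.comp) : ℝ :=
  ς p * (P.kr p (x.2.1 p) / μ p)

/-- The amount of a component, with the porosity `φ` and the molar density `ς`. -/
def amount (φ : ℝ) (ς : Ph → ℝ) (c : Co) (x : Unknowns P.comp) : ℝ :=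
  φ * ∑ p : PhasesOf P.comp c, ς p.1 * x.2.1 p.1 * molar x p

/-- The function given by `f n K` on the `n`-th time interval and the element `K`. -/
def glue {α : Type*} [AddCommMonoid α] (f : ∀ n, (P.mesh n).Elem → ℝ → E d → α)
    (t : ℝ) (x : E d) : α :=
  ∑ n ∈ Finset.Icc 1 P.N, ∑ K : (P.mesh n).Elem,
    if t ∈ Set.Ioc (P.time (n - 1)) (P.time n) ∧ x ∈ interior (cellSet K.1) then f n K t x else 0

/-- The amount of the component `c` for the space-time dependent unknowns `X`. -/
def exactAmount (X : ℝ → E d → Unknowns P.comp) (c : Co) : ℝ → E d → ℝ :=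
  P.glue fun n K t x => P.amount (P.porosity n K) (P.molarDensity n K) c (X t x)

/-- The flux of the component `c` for the space-time dependent unknowns `X`, with the phase
pressure gradients `G`. -/
def exactFlux (X : ℝ → E d → Unknowns P.comp) (G : Ph → ℝ → E d → E d) (c : Co) :
    ℝ → E d → E d :=
  P.glue fun n K t x => ∑ p : PhasesOf P.comp c,
    (P.mobility (P.molarDensity n K) (P.viscosity n K) p.1 (X t x) * molar (X t x) p) •
      (-act (P.perm n K) (G p.1 t x + (P.massDensity n K p.1 * P.g) • P.up))

/-- The source term as a function of time and space. -/
def exactSource (c : Co) : ℝ → E d → ℝ := P.glue fun n K _ _ => P.source n K c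

/-- `X` is a weak solution: the phase pressures `PP` are in `L²(0, T; H¹)`, the amounts are in
`H¹(0, T; L²)`, with time derivatives `dl` and with the prescribed initial values, the component
fluxes are square integrable, and the balance and closure equations hold. -/
def IsWeakSolution (X : ℝ → E d → Unknowns P.comp) : Prop :=
  ∃ (PP : Ph → L2H1 0 (P.time P.N) P.Ω) (dl : Co → ℝ → E d → ℝ),
    (∀ p, ∀ᵐ z ∂(spaceTime 0 (P.time P.N) P.Ω),
      (PP p).val z.1 z.2 = P.phasePressure p (X z.1 z.2)) ∧
    (∀ c, MemLp (fun z : ℝ × E d => P.exactAmount X c z.1 z.2) 2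
        (spaceTime 0 (P.time P.N) P.Ω) ∧
      MemLp (fun z : ℝ × E d => dl c z.1 z.2) 2 (spaceTime 0 (P.time P.N) P.Ω) ∧
      MemLp (P.initial c) 2 (volume.restrict P.Ω) ∧
      ∀ ψ : ℝ × E d → ℝ, IsTest (Set.Iio (P.time P.N) ×ˢ P.Ω) ψ →
        ∫ z, (P.exactAmount X c z.1 z.2 * fderiv ℝ ψ z (1, 0) + dl c z.1 z.2 * ψ z)
            ∂(spaceTime 0 (P.time P.N) P.Ω)
          = -∫ x in P.Ω, P.initial c x * ψ (0, x)) ∧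
    (∀ c, MemLp (fun z : ℝ × E d => P.exactFlux X (fun p => (PP p).grad) c z.1 z.2) 2
      (spaceTime 0 (P.time P.N) P.Ω)) ∧
    (∀ c, ∀ φ : L2H1 0 (P.time P.N) P.Ω,
      ∫ z, (dl c z.1 z.2 * φ.val z.1 z.2
          - ⟪P.exactFlux X (fun p => (PP p).grad) c z.1 z.2, φ.grad z.1 z.2⟫)
          ∂(spaceTime 0 (P.time P.N) P.Ω)
        = ∫ z, P.exactSource c z.1 z.2 * φ.val z.1 z.2 ∂(spaceTime 0 (P.time P.N) P.Ω)) ∧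
    (∀ᵐ z ∂(spaceTime 0 (P.time P.N) P.Ω),
      ∑ p, (X z.1 z.2).2.1 p = 1 ∧
      (∀ p, ∑ c : P.comp p, (X z.1 z.2).2.2 ⟨(p, c.1), c.2⟩ = 1) ∧
      ∀ c, ∀ p p' : PhasesOf P.comp c, P.fug p.1 c (X z.1 z.2) = P.fug p'.1 c (X z.1 z.2))

/-- The algebraic vectors of discrete unknowns on the mesh of the time step `n`. -/
abbrev State (n : ℕ) : Type _ := (P.mesh n).Elem → Unknowns P.comp

end Problem

/-! ### Discretization, linearization, and algebraic solver on one time step -/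

/-- Data of a locally conservative discretization on the time step `n`: an orientation of the faces
(each face is directed out of the element `plus`), the transmissibilities of the normal fluxes in
this direction, the cell values of the vertical coordinate, and the face values of the mass
densities at the current and previous times. -/
structure Discretization {d : ℕ} (P : Problem d Ph Co) (n : ℕ) where
  plus : (P.mesh n).Face → (P.mesh n).Elem
  plus_mem : ∀ σ, σ ∈ (P.mesh n).facesOf (plus σ)
  trans : (P.mesh n).Face → (P.mesh n).Elem → ℝ
  z : (P.mesh n).Elem → ℝ
  faceDensity : (P.mesh n).Face → Ph → ℝ
  faceDensityPrev : (P.mesh n).Face → Ph → ℝ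

/-- The linearization of the upwinded component fluxes: Newton, Newton blended with fixed point, or
any other choice of affine functions of the unknowns. -/
inductive Linearization {d : ℕ} (P : Problem d Ph Co) (n : ℕ)
  | newton
  | blended
  | affine (F : Co → (P.mesh n).Face → (P.State n →ᵃ[ℝ] ℝ))

/-- The construction of the potential point values: averages of the neighboring cell values,
averages of neighboring face values (Lagrange multipliers, at the current and previous times), or
any other point values (at the current and previous times). -/
inductive PointValues {d : ℕ} (P : Problem d Ph Co) (n : ℕ)
  | average
  | hybrid (cur prev : Ph → (P.mesh n).Face → ℝ)
  | prescribed (cur prev : Ph → E d → ℝ)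

/-- One step of the computation on the time step `n`: the discretization, the linearization, the
construction of point values, and the current iterates. -/
structure Step {d : ℕ} (P : Problem d Ph Co) (n : ℕ) where
  disc : Discretization P n
  linz : Linearization P n
  points : PointValues P n
  /-- The approximation on the previous time, `X^{n-1}`. -/
  prev : P.State (n - 1)
  /-- The previous linearization iterate `X^{n,k-1}`. -/
  lin : P.State n
  /-- The current iterate `X^{n,k,i}`. -/
  cur : P.State n
  /-- The iterate after additional algebraic solver steps, `X^{n,k,i+j}`. -/
  add : P.State n

namespace Step

variable {d n : ℕ} {P : Problem d Ph Co} (S : Step P n)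

/-- `X^{n-1}` on the elements of the current mesh. -/
def old : P.State n := (P.mesh n).prolong (P.mesh (n - 1)) S.prev

/-- The parameters on the previous time, on the elements of the current mesh. -/
def oldMolarDensity (_ : Step P n) : (P.mesh n).Elem → Ph → ℝ :=
  (P.mesh n).prolong (P.mesh (n - 1)) (P.molarDensity (n - 1))

def oldViscosity (_ : Step P n) : (P.mesh n).Elem → Ph → ℝ :=
  (P.mesh n).prolong (P.mesh (n - 1)) (P.viscosity (n - 1))

/-- The time step size. -/
def tau (_ : Step P n) : ℝ := P.time n - P.time (n - 1)

/-- The time interval. -/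
def I (_ : Step P n) : Set ℝ := Set.Icc (P.time (n - 1)) (P.time n)

/-- Affine-in-time interpolation between the previous value `b` and the current value `a`. -/
def interp (a b t : ℝ) : ℝ :=
  (t - P.time (n - 1)) / S.tau * a + (P.time n - t) / S.tau * b

/-- `n_K · n_σ`. -/
def sign (K : (P.mesh n).Elem) (σ : (P.mesh n).Face) : ℝ := if K = S.disc.plus σ then 1 else -1

/-- The finite volume phase normal velocity in the direction of the face, with the face
densities `ρ`. -/
def velocity (ρ : (P.mesh n).Face → Ph → ℝ) (p : Ph) (σ : (P.mesh n).Face) (X : P.State n) : ℝ :=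
  ∑ K, S.disc.trans σ K * (P.phasePressure p (X K) + ρ σ p * P.g * S.disc.z K)

/-- The upstream element. -/
def upstream (p : Ph) (σ : (P.mesh n).Face) (X : P.State n) : (P.mesh n).Elem :=
  if 0 ≤ S.velocity S.disc.faceDensity p σ X then S.disc.plus σ
  else (P.mesh n).across σ (S.disc.plus σ)

/-- Mobility times molar fraction on the element `K` at the current time. -/
def weight {c : Co} (p : PhasesOf P.comp c) (K : (P.mesh n).Elem) (x : Unknowns P.comp) : ℝ :=
  P.mobility (P.molarDensity n K) (P.viscosity n K) p.1 x * molar x p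

/-- The upwinded component flux in the direction of the face. -/
def upFlux (c : Co) (σ : (P.mesh n).Face) (X : P.State n) : ℝ :=
  ∑ p : PhasesOf P.comp c, weight p (S.upstream p.1 σ X) (X (S.upstream p.1 σ X)) *
    S.velocity S.disc.faceDensity p.1 σ X

/-- The component flux out of `K` without upwinding, at the current time. -/
def flux (c : Co) (K : (P.mesh n).Elem) (σ : (P.mesh n).Face) (X : P.State n) : ℝ :=
  ∑ p : PhasesOf P.comp c,
    weight p K (X K) * (S.sign K σ * S.velocity S.disc.faceDensity p.1 σ X)

/-- The component flux out of `K` without upwinding, at the previous time. -/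
def fluxPrev (c : Co) (K : (P.mesh n).Elem) (σ : (P.mesh n).Face) : ℝ :=
  ∑ p : PhasesOf P.comp c,
    P.mobility (S.oldMolarDensity K) (S.oldViscosity K) p.1 (S.old K) * molar (S.old K) p *
      (S.sign K σ * S.velocity S.disc.faceDensityPrev p.1 σ S.old)

/-- The linearized upwinded component flux in the direction of the face. -/
def linFlux (c : Co) (σ : (P.mesh n).Face) (X : P.State n) : ℝ :=
  match S.linz with
  | .newton => S.upFlux c σ S.lin + fderiv ℝ (S.upFlux c σ) S.lin (X - S.lin)
  | .blended => ∑ p : PhasesOf P.comp c,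
      weight p (S.upstream p.1 σ S.lin) (S.lin (S.upstream p.1 σ S.lin)) *
        (S.velocity S.disc.faceDensity p.1 σ S.lin +
          fderiv ℝ (S.velocity S.disc.faceDensity p.1 σ) S.lin (X - S.lin))
  | .affine F => F c σ X

/-- The amount of the component on the element `K`, at the current time. -/
def amountAt (_ : Step P n) (c : Co) (K : (P.mesh n).Elem) (x : Unknowns P.comp) : ℝ :=
  P.amount (P.porosity n K) (P.molarDensity n K) c x

/-- The amount of the component on the element `K`, at the previous time. -/
def amountPrev (c : Co) (K : (P.mesh n).Elem) : ℝ :=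
  P.amount (P.porosity n K) (S.oldMolarDensity K) c (S.old K)

/-- The linearized amount of the component. -/
def linAmount (c : Co) (K : (P.mesh n).Elem) (X : P.State n) : ℝ :=
  S.amountAt c K (S.lin K) + fderiv ℝ (S.amountAt c K) (S.lin K) (X K - S.lin K)

/-- The algebraic residual of the linearized scheme for the iterate `X`. -/
def residual (c : Co) (K : (P.mesh n).Elem) (X : P.State n) : ℝ :=
  cellVol K.1 / S.tau * (S.linAmount c K X - S.amountPrev c K)
    + ∑ σ ∈ ((P.mesh n).facesOf K).filter (P.mesh n).IsInterior, S.sign K σ * S.linFlux c σ X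
    - cellVol K.1 * P.source n K c

/-! ### Face normal fluxes and point values -/

/-- Distribution of the fluxes `F` of the polytopal faces to their simplicial subfaces, proportional
to the measure, with zero values on the boundary. -/
def spread (_ : Step P n) (F : (P.mesh n).Face → ℝ) (s : Finset (E d)) : ℝ :=
  ∑ σ : (P.mesh n).Face,
    if s ∈ σ.1 ∧ (P.mesh n).IsInterior σ then F σ / (P.mesh n).faceArea σ * area s else 0

/-- The boundary value `⟨K ρ_p g ∇z · n_Ω, 1⟩_s` (zero on the other faces). -/
def gravityFlux (_ : Step P n) (K : (P.mesh n).Elem) (p : Ph) (s : Finset (E d)) : ℝ :=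
  if ∃ σ : (P.mesh n).Face, s ∈ σ.1 ∧ ¬ (P.mesh n).IsInterior σ then
    ∑ κ ∈ star K.1 s,
      ⟪act (P.perm n K) ((P.massDensity n K p * P.g) • P.up), outerNormal κ s⟫ * area s
  else 0

/-- The phase pressures at time `t`, interpolated in time. -/
def pressureAt (p : Ph) (t : ℝ) (K : (P.mesh n).Elem) : ℝ :=
  S.interp (P.phasePressure p (S.cur K)) (P.phasePressure p (S.old K)) t

/-- The face normal fluxes `U` of the phase `p` at the time `t`. -/
def vecU (p : Ph) (K : (P.mesh n).Elem) (t : ℝ) (s : Finset (E d)) : ℝ :=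
  S.spread (fun σ => S.sign K σ *
    S.interp (∑ L, S.disc.trans σ L * P.phasePressure p (S.cur L))
      (∑ L, S.disc.trans σ L * P.phasePressure p (S.old L)) t) s + S.gravityFlux K p s

/-- The discrete component fluxes at the current time. -/
def vecFlux (c : Co) (K : (P.mesh n).Elem) : Finset (E d) → ℝ :=
  S.spread fun σ => S.flux c K σ S.cur

/-- The discrete component fluxes at the previous time. -/
def vecFluxPrev (c : Co) (K : (P.mesh n).Elem) : Finset (E d) → ℝ :=
  S.spread fun σ => S.fluxPrev c K σ

/-- Temporal error fluxes. -/
def vecTm (c : Co) (K : (P.mesh n).Elem) (t : ℝ) : Finset (E d) → ℝ :=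
  S.spread fun σ => (P.time n - t) / S.tau * (S.flux c K σ S.cur - S.fluxPrev c K σ)

/-- Upwinding error fluxes. -/
def vecUpw (c : Co) (K : (P.mesh n).Elem) : Finset (E d) → ℝ :=
  S.spread fun σ => S.sign K σ * S.upFlux c σ S.cur - S.flux c K σ S.cur

/-- Linearization error fluxes. -/
def vecLin (c : Co) (K : (P.mesh n).Elem) : Finset (E d) → ℝ :=
  S.spread fun σ => S.sign K σ * S.linFlux c σ S.cur - S.sign K σ * S.upFlux c σ S.cur

/-- Algebraic error fluxes. -/
def vecAlg (c : Co) (K : (P.mesh n).Elem) : Finset (E d) → ℝ :=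
  S.spread fun σ => S.sign K σ * S.linFlux c σ S.add - S.sign K σ * S.linFlux c σ S.cur

/-- The potential point value of the phase `p` at the vertex `a` and the time `t`. -/
def vecZ (p : Ph) (t : ℝ) (a : E d) : ℝ :=
  match S.points with
  | .average =>
      if a ∈ frontier P.Ω then 0
      else (∑ K : (P.mesh n).Elem with a ∈ cellSet K.1, S.pressureAt p t K) /
        ((Finset.univ.filter fun K : (P.mesh n).Elem => a ∈ cellSet K.1).card : ℝ)
  | .hybrid cur prev =>
      if a ∈ frontier P.Ω then 0
      else if h : ∃ K : (P.mesh n).Elem, a ∈ interior (cellSet K.1) then S.pressureAt p t h.choose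
      else (∑ σ : (P.mesh n).Face with ∃ s ∈ σ.1, a ∈ body s, S.interp (cur p σ) (prev p σ) t) /
        ((Finset.univ.filter fun σ : (P.mesh n).Face => ∃ s ∈ σ.1, a ∈ body s).card : ℝ)
  | .prescribed cur prev => S.interp (cur p a) (prev p a) t

/-- The potential face value. -/
def vecZext (p : Ph) (t : ℝ) (s : Finset (E d)) : ℝ := 1 / (d : ℝ) * ∑ a ∈ s, S.vecZ p t a

/-! ### Approximate solution and error measure -/

/-- The approximate Darcy phase flux on the element `K`, affine in time between the liftings at the
two ends of the time interval. -/
def uApprox (p : Ph) (K : (P.mesh n).Elem) (t : ℝ) (x : E d) : E d :=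
  ((t - P.time (n - 1)) / S.tau) •
      rtField K.1 (lift K.1 (P.perm n K) (S.vecU p K (P.time n))) x +
    ((P.time n - t) / S.tau) •
      rtField K.1 (lift K.1 (P.perm n K) (S.vecU p K (P.time (n - 1)))) x

/-- The approximate component flux on the element `K`, affine in time. -/
def thetaApprox (c : Co) (K : (P.mesh n).Elem) (t : ℝ) (x : E d) : E d :=
  ((t - P.time (n - 1)) / S.tau) • rtField K.1 (lift K.1 (P.perm n K) (S.vecFlux c K)) x +
    ((P.time n - t) / S.tau) • rtField K.1 (lift K.1 (P.perm n K) (S.vecFluxPrev c K)) x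

/-- The approximate amount on the element `K`, affine in time. -/
def amountApprox (c : Co) (K : (P.mesh n).Elem) (t : ℝ) : ℝ :=
  S.interp (S.amountAt c K (S.cur K)) (S.amountPrev c K) t

/-- The space `Xⁿ = L²(Iⁿ; H¹(Ω))`. -/
abbrev TestSpace (_ : Step P n) := L2H1 (P.time (n - 1)) (P.time n) P.Ω

/-- The norm of `Xⁿ`. -/
def normX (φ : S.TestSpace) : ℝ :=
  Real.sqrt (∫ t in S.I, ∑ K : (P.mesh n).Elem,
    ((cellDiam K.1)⁻¹ ^ 2 * ∫ x in cellSet K.1, φ.val t x ^ 2) +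
      ∑ K : (P.mesh n).Elem, ∫ x in cellSet K.1, normSq (P.perm n K) (φ.grad t x))

/-- The values of the residual on the functions of unit norm. -/
def residualValues (c : Co) : Set ℝ :=
  {r | ∃ φ : S.TestSpace, S.normX φ = 1 ∧ r = ∫ t in S.I, ∑ K : (P.mesh n).Elem,
    ((∫ x in cellSet K.1, P.source n K c * φ.val t x)
      - (∫ x in cellSet K.1, deriv (S.amountApprox c K) t * φ.val t x)
      + ∫ x in cellSet K.1, ⟪S.thetaApprox c K t x, φ.grad t x⟫)}

/-- The dual norm of the residual of the component `c`. -/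
def dualNorm (c : Co) : ℝ := sSup (S.residualValues c)

/-- The nonconformity of the Darcy flux of the phase `p`. -/
def nonconformity (p : Ph) : ℝ :=
  sInf {r | ∃ φ : S.TestSpace, r = Real.sqrt (∑ c : P.comp p, ∫ t in S.I,
    ∑ K : (P.mesh n).Elem, weight (⟨p, c.2⟩ : PhasesOf P.comp c.1) K (S.cur K) ^ 2 *
      ∫ x in cellSet K.1,
        normSq (P.perm n K)⁻¹ (S.uApprox p K t x + act (P.perm n K) (φ.grad t x)))}

/-- The intrinsic error measure. -/
def errorMeasure : ℝ :=
  Real.sqrt (∑ c, S.dualNorm c ^ 2) + Real.sqrt (∑ p, S.nonconformity p ^ 2)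

/-! ### Estimators -/

/-- `Uᵗ A_MFE U` on the element `K`. -/
def mfeForm (_ : Step P n) (K : (P.mesh n).Elem) (U : Finset (E d) → ℝ) : ℝ :=
  (fun s : extFaces K.1 => U s.1) ⬝ᵥ
    mfeMatrix K.1 (P.perm n K) *ᵥ fun s : extFaces K.1 => U s.1

/-- Square of the nonconformity estimator. -/
def estNCSq {c : Co} (p : PhasesOf P.comp c) (K : (P.mesh n).Elem) (t : ℝ) : ℝ :=
  weight p K (S.cur K) ^ 2 *
    (S.mfeForm K (S.vecU p.1 K t)
      + (fun a : verts K.1 => S.vecZ p.1 t a.1) ⬝ᵥ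
          stiffMatrix K.1 (P.perm n K) *ᵥ (fun a : verts K.1 => S.vecZ p.1 t a.1)
      + 2 * ∑ s ∈ extFaces K.1, S.vecU p.1 K t s * S.vecZext p.1 t s
      - 2 * (∑ s ∈ extFaces K.1, S.vecU p.1 K t s) * (cellVol K.1)⁻¹ *
          ((fun _ : verts K.1 => (1 : ℝ)) ⬝ᵥ
            massMatrix K.1 *ᵥ fun a : verts K.1 => S.vecZ p.1 t a.1))

/-- Elementwise upwinding estimator. -/
def estUpw (c : Co) (K : (P.mesh n).Elem) : ℝ := Real.sqrt (S.mfeForm K (S.vecUpw c K))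

/-- Elementwise spatial estimator. -/
def estSp (c : Co) (K : (P.mesh n).Elem) (t : ℝ) : ℝ :=
  S.estUpw c K + Real.sqrt (∑ p : PhasesOf P.comp c, S.estNCSq p K t)

/-- Elementwise temporal estimator. -/
def estTm (c : Co) (K : (P.mesh n).Elem) (t : ℝ) : ℝ :=
  Real.sqrt (S.mfeForm K (S.vecTm c K t))

/-- `h_K τ⁻¹ ‖r‖_K` for a constant `r`. -/
def scaledNorm (K : (P.mesh n).Elem) (r : ℝ) : ℝ :=
  cellDiam K.1 * S.tau⁻¹ * (|r| * Real.sqrt (cellVol K.1))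

/-- Elementwise linearization estimator. -/
def estLin (c : Co) (K : (P.mesh n).Elem) : ℝ :=
  Real.sqrt (S.mfeForm K (S.vecLin c K) +
    S.scaledNorm K (S.linAmount c K S.cur - S.amountAt c K (S.cur K)) ^ 2)

/-- Elementwise algebraic estimator. -/
def estAlg (c : Co) (K : (P.mesh n).Elem) : ℝ :=
  Real.sqrt (S.mfeForm K (S.vecAlg c K) +
    S.scaledNorm K (S.linAmount c K S.add - S.linAmount c K S.cur) ^ 2)

/-- Elementwise algebraic remainder estimator. -/
def estRem (c : Co) (K : (P.mesh n).Elem) : ℝ :=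
  cellDiam K.1 * (Real.sqrt (cellVol K.1))⁻¹ * |S.residual c K S.add|

/-- The estimator with the factor `δ` and the elementwise contributions `η`. -/
def total (δ : ℝ) (η : (P.mesh n).Elem → ℝ → ℝ) : ℝ :=
  Real.sqrt (δ * ∫ t in S.I, ∑ K, η K t ^ 2)

/-- The sum of the error component estimators of the component `c`. -/
def estimator (c : Co) : ℝ :=
  S.total 4 (S.estSp c) + S.total 2 (S.estTm c) + S.total 2 (fun K _ => S.estLin c K) +
    S.total 2 (fun K _ => S.estAlg c K) + S.total 2 (fun K _ => S.estRem c K)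

end Step

end Problem

end

end MultiphaseDarcy

open MultiphaseDarcy

namespace MultiphaseDarcy

open scoped ContDiff RealInnerProductSpace Classical Matrix

noncomputable section

/-! ### Geometry of a nondegenerate simplex -/

/-! The error measure is a sum of dual norms of residuals and of distances of the Darcy fluxes from
gradients. Both parts are bounded by computable quantities, and the factors `δ` merge the two square
roots into one sum over the components.

Residual. Lifting of face fluxes is linear (`lift_eq`, `liftSol_combination`), so `thetaApprox` is
the lifting of the linearized flux at the last algebraic iterate minus the liftings of the
upwinding, temporal, linearization and algebraic fluxes. The linearized fluxes are opposite from the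
two sides of a face and zero on the boundary of the domain. Green's theorem
(`PolytopalMesh.sum_setIntegral_inner_liftSol`) therefore turns their contribution into elementwise
constants tested against the function itself. The definition of the algebraic residual then leaves
only the increments of the amounts and the remainder (`Step.residual_eq`). Each of the five pieces
is bounded by the Cauchy-Schwarz inequality on each element (`IsCell.abs_flux_add_source_le`). The
energy of a lifting is exactly the quadratic form of the condensed mixed finite element matrix
(`rtEnergy_liftSol`), since this matrix is the Schur complement of the saddle-point problem solved
by the lifting.

Nonconformity. The infimum is tested with the piecewise affine function having the prescribed vertex
values, which belongs to `H¹` by `IsComplex.isWeakGradient_interp`. Expanding the square gives the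
energy of the lifting, the stiffness form and a cross term. By Green's formula on the element and
the constant divergence, the cross term depends only on boundary fluxes, vertex values and the
integral of the function. The estimator is thus equal to the distance to this gradient
(`IsCell.setIntegral_normSq_liftSol_add`).

Green's theorem without traces. The mean of a function over a face is represented by the volume
functional `faceMean` on one adjacent simplex, and what has to be shown is that the two sides give
the same value. For `C¹` functions this is `IsSimplex.faceMean_congr`, proved by dilating a simplex
about a vertex. For Sobolev functions it is `Adjacent.faceMean_eq`: the weak gradient is tested with
the Raviart-Thomas field of the face, which is first contracted into the domain and mollified.

Conclusion. The inequality `(x + y)² ≤ 2 (x² + y²)` for the two square roots accounts for the factor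
2, and once more for upwinding against nonconformity, which makes it 4 in the spatial estimator
(`sqrt_add_sqrt_le`, `Step.sqrt_two_mul_le_total_estSp`). -/

/-- `κ` is the vertex set of a nondegenerate `d`-dimensional simplex. -/
structure IsSimplex {d : ℕ} (κ : Finset (E d)) : Prop where
  card : κ.card = d + 1
  indep : AffineIndependent ℝ (Subtype.val : κ → E d)

namespace IsSimplex

variable {d : ℕ} {κ : Finset (E d)}

theorem affineSpan_eq_top (h : IsSimplex κ) : affineSpan ℝ (κ : Set (E d)) = ⊤ := by
  have := h.indep.affineSpan_eq_top_iff_card_eq_finrank_add_one.2 (by simp [h.card])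
  simpa using this

/-- The vertices as an affine basis of the space. -/
def basis (h : IsSimplex κ) : AffineBasis κ ℝ (E d) :=
  ⟨Subtype.val, h.indep, by simpa using h.affineSpan_eq_top⟩

@[simp] theorem basis_apply (h : IsSimplex κ) (a : κ) : h.basis a = a.1 := rfl

theorem range_basis (h : IsSimplex κ) : Set.range h.basis = (κ : Set (E d)) := by
  ext x
  simp

theorem affineMap_ext (h : IsSimplex κ) {F : Type*} [AddCommGroup F] [Module ℝ F]
    {f g : E d →ᵃ[ℝ] F} (hfg : ∀ a ∈ κ, f a = g a) : f = g :=
  AffineMap.ext_on h.affineSpan_eq_top fun a ha => hfg a ha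

end IsSimplex

/-! ### Barycentric coordinates. -/

theorem sum_affineMap_apply {d : ℕ} {ι : Type*} (s : Finset ι) (f : ι → E d →ᵃ[ℝ] ℝ) (x : E d) :
    (∑ i ∈ s, f i) x = ∑ i ∈ s, f i x := by
  induction s using Finset.induction_on with
  | empty => rfl
  | insert a s ha ih => rw [Finset.sum_insert ha, Finset.sum_insert ha, ← ih]; rfl

/-- The barycentric coordinate of the simplex `κ` at the vertex `a`, as an affine function. -/
def bary {d : ℕ} (κ : Finset (E d)) (a : E d) : E d →ᵃ[ℝ] ℝ :=
  if h : ∃ f : E d →ᵃ[ℝ] ℝ, ∀ b ∈ κ, f b = if b = a then 1 else 0 then h.choose else 0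

/-- The same witness is chosen in both definitions; `bary` keeps its affine structure, which `hat`
forgets. -/
theorem hat_eq_bary {d : ℕ} (κ : Finset (E d)) (a : E d) : hat κ a = bary κ a := by
  unfold hat bary
  split_ifs <;> rfl

namespace IsSimplex

variable {d : ℕ} {κ : Finset (E d)}

theorem bary_apply (h : IsSimplex κ) (a : E d) {b : E d} (hb : b ∈ κ) :
    bary κ a b = if b = a then 1 else 0 := by
  have hex : ∃ f : E d →ᵃ[ℝ] ℝ, ∀ b ∈ κ, f b = if b = a then 1 else 0 := by
    by_cases ha : a ∈ κ
    · refine ⟨h.basis.coord ⟨a, ha⟩, fun b hb => ?_⟩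
      have := h.basis.coord_apply ⟨a, ha⟩ ⟨b, hb⟩
      simp only [basis_apply, Subtype.mk.injEq] at this
      rw [this]
      simp only [eq_comm]
    · exact ⟨0, fun b hb => by rw [if_neg (by rintro rfl; exact ha hb)]; rfl⟩
  have hspec := hex.choose_spec b hb
  unfold bary
  rwa [dif_pos hex]

theorem bary_self (h : IsSimplex κ) {a : E d} (ha : a ∈ κ) : bary κ a a = 1 := by
  rw [h.bary_apply a ha, if_pos rfl]

theorem bary_of_ne (h : IsSimplex κ) {a b : E d} (hb : b ∈ κ) (hab : b ≠ a) : bary κ a b = 0 := by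
  rw [h.bary_apply a hb, if_neg hab]

theorem bary_eq_zero (h : IsSimplex κ) {a : E d} (ha : a ∉ κ) : bary κ a = 0 :=
  h.affineMap_ext fun b hb => by
    rw [h.bary_of_ne hb (by rintro rfl; exact ha hb)]; rfl

theorem bary_eq_coord (h : IsSimplex κ) (a : κ) : bary κ a = h.basis.coord a :=
  h.affineMap_ext fun b hb => by
    have := h.basis.coord_apply a ⟨b, hb⟩
    simp only [basis_apply] at this
    rw [this, h.bary_apply _ hb]
    simp only [Subtype.ext_iff, eq_comm]

theorem sum_bary (h : IsSimplex κ) (x : E d) : ∑ a ∈ κ, bary κ a x = 1 := by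
  rw [← h.basis.sum_coord_apply_eq_one x, ← Finset.sum_coe_sort]
  simp only [h.bary_eq_coord]

theorem sum_bary_smul (h : IsSimplex κ) (x : E d) : ∑ a ∈ κ, bary κ a x • a = x := by
  conv_rhs => rw [← h.basis.linear_combination_coord_eq_self x]
  rw [← Finset.sum_coe_sort]
  simp only [h.bary_eq_coord, h.basis_apply]

theorem eq_sum_bary (h : IsSimplex κ) (f : E d →ᵃ[ℝ] ℝ) : f = ∑ a ∈ κ, f a • bary κ a :=
  h.affineMap_ext fun b hb => by
    rw [sum_affineMap_apply, Finset.sum_eq_single b]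
    · simp [h.bary_self hb]
    · intro a _ hab
      simp [h.bary_of_ne hb hab.symm]
    · exact fun hb' => absurd hb hb'

theorem body_eq (h : IsSimplex κ) : body κ = {x | ∀ a ∈ κ, 0 ≤ bary κ a x} := by
  rw [body, ← h.range_basis, h.basis.convexHull_eq_nonneg_coord]
  ext x
  simp [← h.bary_eq_coord]

theorem interior_body_eq (h : IsSimplex κ) :
    interior (body κ) = {x | ∀ a ∈ κ, 0 < bary κ a x} := by
  rw [body, ← h.range_basis, h.basis.interior_convexHull]
  ext x
  simp [← h.bary_eq_coord]

theorem interior_nonempty (h : IsSimplex κ) : (interior (body κ)).Nonempty := by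
  rw [body, interior_convexHull_nonempty_iff_affineSpan_eq_top, h.affineSpan_eq_top]

end IsSimplex

/-! ### Topology and measure of closed simplices. -/

section body

variable {d : ℕ} (κ : Finset (E d))

theorem convex_body : Convex ℝ (body κ) := convex_convexHull _ _

theorem isCompact_body : IsCompact (body κ) := κ.finite_toSet.isCompact_convexHull _

theorem isClosed_body : IsClosed (body κ) := (isCompact_body κ).isClosed

theorem measurableSet_body : MeasurableSet (body κ) := (isClosed_body κ).measurableSet

theorem volume_frontier_body : volume (frontier (body κ)) = 0 :=
  (convex_body κ).addHaar_frontier volume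

theorem interior_body_ae_eq : interior (body κ) =ᵐ[volume] body κ :=
  interior_ae_eq_of_null_frontier (volume_frontier_body κ)

theorem volume_body_ne_top : volume (body κ) ≠ ⊤ := (isCompact_body κ).measure_lt_top.ne

theorem subset_body : (κ : Set (E d)) ⊆ body κ := subset_convexHull _ _

theorem body_mono {s t : Finset (E d)} (h : s ⊆ t) : body s ⊆ body t :=
  convexHull_mono (by exact_mod_cast h)

theorem IsSimplex.vol_pos {κ : Finset (E d)} (h : IsSimplex κ) : 0 < vol κ := by
  refine ENNReal.toReal_pos (fun h0 => ?_) (volume_body_ne_top κ)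
  exact (isOpen_interior.measure_pos volume h.interior_nonempty).ne'
    (measure_mono_null interior_subset h0)

theorem setIntegral_interior_body {F : Type*} [NormedAddCommGroup F] [NormedSpace ℝ F]
    (f : E d → F) : ∫ x in interior (body κ), f x = ∫ x in body κ, f x :=
  setIntegral_congr_set (interior_body_ae_eq κ)

end body

/-! ### Affine functions and their gradients. -/

section affine

variable {d : ℕ}

theorem continuous_affineMap {F : Type*} [NormedAddCommGroup F] [NormedSpace ℝ F]
    (f : E d →ᵃ[ℝ] F) : Continuous f :=
  f.continuous_of_finiteDimensional

theorem hasFDerivAt_affineMap {F : Type*} [NormedAddCommGroup F] [NormedSpace ℝ F]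
    (f : E d →ᵃ[ℝ] F) (x : E d) :
    HasFDerivAt f (LinearMap.toContinuousLinearMap f.linear) x := by
  have : (f : E d → F) = fun y => LinearMap.toContinuousLinearMap f.linear y + f 0 := by
    ext y
    exact congrFun (AffineMap.decomp f) y
  rw [this]
  exact (ContinuousLinearMap.hasFDerivAt _).add_const _

/-- The (constant) gradient of an affine function. -/
def affGrad (f : E d →ᵃ[ℝ] ℝ) : E d :=
  (InnerProductSpace.toDual ℝ (E d)).symm (LinearMap.toContinuousLinearMap f.linear)

theorem inner_affGrad (f : E d →ᵃ[ℝ] ℝ) (v : E d) : ⟪affGrad f, v⟫ = f.linear v := by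
  rw [affGrad, InnerProductSpace.toDual_symm_apply]
  rfl

theorem gradient_affineMap (f : E d →ᵃ[ℝ] ℝ) (x : E d) : gradient f x = affGrad f := by
  rw [gradient, (hasFDerivAt_affineMap f x).fderiv]
  rfl

theorem affineMap_sub_eq {F : Type*} [AddCommGroup F] [Module ℝ F] (f : E d →ᵃ[ℝ] F) (x y : E d) : f x - f y = f.linear (x - y) := by
  have := f.linearMap_vsub x y
  simpa using this.symm

theorem affGrad_add (f g : E d →ᵃ[ℝ] ℝ) : affGrad (f + g) = affGrad f + affGrad g := by
  refine ext_inner_right ℝ fun v => ?_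
  simp [inner_affGrad, inner_add_left]

theorem affGrad_smul (c : ℝ) (f : E d →ᵃ[ℝ] ℝ) : affGrad (c • f) = c • affGrad f := by
  refine ext_inner_right ℝ fun v => ?_
  simp [inner_affGrad, inner_smul_left]

theorem affGrad_sum {ι : Type*} (s : Finset ι) (f : ι → E d →ᵃ[ℝ] ℝ) :
    affGrad (∑ i ∈ s, f i) = ∑ i ∈ s, affGrad (f i) := by
  induction s using Finset.induction_on with
  | empty =>
    refine ext_inner_right ℝ fun v => ?_
    simp [inner_affGrad]
  | insert a s ha ih => rw [Finset.sum_insert ha, Finset.sum_insert ha, affGrad_add, ih]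

end affine

/-! ### Integration on a simplex -/

section affineImage

variable {d : ℕ}

theorem injective_of_det_ne_zero (T : E d →ᵃ[ℝ] E d) (hT : LinearMap.det T.linear ≠ 0) :
    Function.Injective T := by
  rw [← AffineMap.linear_injective_iff]
  exact (LinearMap.equivOfDetNeZero T.linear hT).injective

theorem setIntegral_image_affineMap (T : E d →ᵃ[ℝ] E d) (hT : LinearMap.det T.linear ≠ 0)
    {s : Set (E d)} (hs : MeasurableSet s) (g : E d → ℝ) :
    ∫ x in T '' s, g x = |LinearMap.det T.linear| * ∫ x in s, g (T x) := by
  rw [integral_image_eq_integral_abs_det_fderiv_smul volume hs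
    (fun x _ => (hasFDerivAt_affineMap T x).hasFDerivWithinAt)
    (injective_of_det_ne_zero T hT).injOn g, ← integral_const_mul]
  rfl

theorem image_body (T : E d →ᵃ[ℝ] E d) (κ : Finset (E d)) : T '' body κ = body (κ.image T) := by
  rw [body, AffineMap.image_convexHull, body, Finset.coe_image]

theorem setIntegral_const_body (κ : Finset (E d)) (c : ℝ) : ∫ _ in body κ, c = vol κ * c := by
  rw [setIntegral_const]; rfl

theorem integrableOn_body {F : Type*} [NormedAddCommGroup F] {κ : Finset (E d)} {f : E d → F}
    (hf : Continuous f) : IntegrableOn f (body κ) :=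
  hf.continuousOn.integrableOn_compact (isCompact_body κ)

/-- The affine map that moves points along `v` proportionally to the affine function `f`. -/
def shear (f : E d →ᵃ[ℝ] ℝ) (v : E d) : E d →ᵃ[ℝ] E d where
  toFun x := x + f x • v
  linear := LinearMap.transvection f.linear v
  map_vadd' x w := by
    have : f (w + x) = f.linear w + f x := f.map_vadd x w
    simp only [vadd_eq_add, LinearMap.transvection.apply, this, add_smul]
    abel

theorem shear_apply (f : E d →ᵃ[ℝ] ℝ) (v x : E d) : shear f v x = x + f x • v := rfl

theorem det_shear (f : E d →ᵃ[ℝ] ℝ) (v : E d) :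
    LinearMap.det (shear f v).linear = 1 + f.linear v :=
  LinearMap.transvection.det f.linear v

end affineImage

namespace IsSimplex

variable {d : ℕ} {κ : Finset (E d)}

/-- The affine map that exchanges `a` and `b` and fixes the other vertices is a shear along `b - a`.
It has determinant `-1`, maps the simplex onto itself and carries one coordinate into the other. -/
theorem setIntegral_bary_eq (h : IsSimplex κ) {a b : E d} (ha : a ∈ κ) (hb : b ∈ κ) :
    ∫ x in body κ, bary κ a x = ∫ x in body κ, bary κ b x := by
  rcases eq_or_ne a b with rfl | hab
  · rfl
  set f := bary κ a - bary κ b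
  set T := shear f (b - a)
  have hfa : f a = 1 := by simp [f, h.bary_self ha, h.bary_of_ne ha hab]
  have hfb : f b = -1 := by simp [f, h.bary_self hb, h.bary_of_ne hb hab.symm]
  have hTa : T a = b := by simp [T, shear_apply, hfa]
  have hTb : T b = a := by simp [T, shear_apply, hfb]
  have hTc : ∀ c ∈ κ, c ≠ a → c ≠ b → T c = c := fun c hc hca hcb => by
    simp [T, f, shear_apply, h.bary_of_ne hc hca, h.bary_of_ne hc hcb]
  have hdet : LinearMap.det T.linear = -1 := by
    rw [det_shear, ← affineMap_sub_eq, hfa, hfb]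
    norm_num
  have himg : κ.image T = κ := by
    refine Finset.eq_of_subset_of_card_le (fun x hx => ?_) ?_
    · obtain ⟨c, hc, rfl⟩ := Finset.mem_image.1 hx
      by_cases hca : c = a
      · rw [hca, hTa]; exact hb
      by_cases hcb : c = b
      · rw [hcb, hTb]; exact ha
      rwa [hTc c hc hca hcb]
    · rw [Finset.card_image_of_injective _ (injective_of_det_ne_zero T (by rw [hdet]; norm_num))]
  have hcomp : ∀ x, bary κ b (T x) = bary κ a x := by
    have : (bary κ b).comp T = bary κ a := h.affineMap_ext fun c hc => by
      by_cases hca : c = a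
      · simp [hca, hTa, h.bary_self ha, h.bary_self hb]
      by_cases hcb : c = b
      · simp [hcb, hTb, h.bary_of_ne ha hab, h.bary_of_ne hb hab.symm]
      · simp [hTc c hc hca hcb, h.bary_of_ne hc hca, h.bary_of_ne hc hcb]
    intro x
    rw [← this]; rfl
  have := setIntegral_image_affineMap T (by rw [hdet]; norm_num) (measurableSet_body κ) (bary κ b)
  rw [image_body, himg, hdet] at this
  simp only [hcomp] at this
  rw [this]; norm_num

/-- The `d + 1` coordinates have equal integrals and add up to one. -/
theorem setIntegral_bary (h : IsSimplex κ) {a : E d} (ha : a ∈ κ) :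
    ∫ x in body κ, bary κ a x = vol κ / (d + 1) := by
  have h1 : ∑ b ∈ κ, ∫ x in body κ, bary κ b x = vol κ := by
    rw [← integral_finsetSum _ fun b _ => integrableOn_body (continuous_affineMap _)]
    simp only [h.sum_bary]
    rw [setIntegral_const_body, mul_one]
  rw [Finset.sum_congr rfl fun b hb => h.setIntegral_bary_eq hb ha, Finset.sum_const, h.card,
    nsmul_eq_mul] at h1
  push_cast at h1
  field_simp
  linarith

theorem setIntegral_affineMap (h : IsSimplex κ) (f : E d →ᵃ[ℝ] ℝ) :
    ∫ x in body κ, f x = vol κ / (d + 1) * ∑ a ∈ κ, f a := by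
  conv_lhs => rw [h.eq_sum_bary f]
  simp only [sum_affineMap_apply]
  rw [integral_finsetSum _ fun b _ => integrableOn_body (continuous_affineMap _), Finset.mul_sum]
  refine Finset.sum_congr rfl fun a ha => ?_
  have : ∀ x, (f a • bary κ a) x = f a * bary κ a x := fun x => rfl
  simp only [this]
  rw [integral_const_mul, h.setIntegral_bary ha, mul_comm]

end IsSimplex

/-- The functional `∫_κ (w · (x - a) + d φ) / (d |κ|)`; for a smooth `φ` with the gradient `w`, it is
the mean value of `φ` over the face of the simplex `κ` opposite to the vertex `a`. -/
def faceMean {d : ℕ} (κ : Finset (E d)) (a : E d) (φ : E d → ℝ) (w : E d → E d) : ℝ :=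
  ((d : ℝ) * vol κ)⁻¹ * ∫ x in body κ, (⟪w x, x - a⟫ + d * φ x)

namespace IsSimplex

variable {d : ℕ} {κ : Finset (E d)}

/-- For an affine `f` the integrand is `(d + 1) f x - f a`, and vertex quadrature cancels the value
at `a`. Only the vertices of the opposite face remain. -/
theorem faceMean_affineMap (h : IsSimplex κ) (hd : 1 ≤ d) {a : E d} (ha : a ∈ κ)
    (f : E d →ᵃ[ℝ] ℝ) :
    faceMean κ a f (fun _ => affGrad f) = (d : ℝ)⁻¹ * ∑ b ∈ κ.erase a, f b := by
  have h1 : ∀ x, ⟪affGrad f, x - a⟫ + d * f x = (d + 1) * f x - f a := fun x => by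
    rw [inner_affGrad, ← affineMap_sub_eq]; ring
  unfold faceMean
  simp only [h1]
  have hf := continuous_affineMap f
  rw [integral_sub ((integrableOn_body hf).const_mul _) (integrableOn_body continuous_const),
    integral_const_mul, h.setIntegral_affineMap, setIntegral_const_body,
    ← Finset.add_sum_erase _ _ ha]
  have := h.vol_pos.ne'
  have hd' : (d : ℝ) ≠ 0 := by positivity
  field_simp
  ring

theorem erase_card (h : IsSimplex κ) {a : E d} (ha : a ∈ κ) : (κ.erase a).card = d := by
  rw [Finset.card_erase_of_mem ha, h.card]; rfl

/-- A point of a simplex lies on a segment from the vertex `a` to the opposite face. -/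
theorem exists_ray (h : IsSimplex κ) {a x : E d} (ha : a ∈ κ) (hx : x ∈ body κ)
    (hxa : bary κ a x < 1) :
    ∃ y ∈ body (κ.erase a), x = y + bary κ a x • (a - y) := by
  rw [h.body_eq] at hx
  set t := bary κ a x
  have hsum : ∑ b ∈ κ.erase a, bary κ b x = 1 - t := by
    have := h.sum_bary x
    rw [← Finset.add_sum_erase _ _ ha] at this
    linarith
  have hsm : t • a + ∑ b ∈ κ.erase a, bary κ b x • b = x := by
    have := h.sum_bary_smul x
    rwa [← Finset.add_sum_erase _ _ ha] at this
  have ht : 0 < 1 - t := by linarith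
  refine ⟨∑ b ∈ κ.erase a, (bary κ b x / (1 - t)) • b, ?_, ?_⟩
  · refine (convex_body _).sum_mem (fun b hb => ?_) ?_ fun b hb => subset_body _ hb
    · exact div_nonneg (hx b (Finset.mem_of_mem_erase hb)) ht.le
    · rw [← Finset.sum_div, hsum, div_self ht.ne']
  · have : ∑ b ∈ κ.erase a, (bary κ b x / (1 - t)) • b =
        (1 - t)⁻¹ • ∑ b ∈ κ.erase a, bary κ b x • b := by
      rw [Finset.smul_sum]
      refine Finset.sum_congr rfl fun b _ => ?_
      rw [smul_smul, div_eq_inv_mul]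
    rw [this]
    set v := ∑ b ∈ κ.erase a, bary κ b x • b
    rw [← hsm, smul_sub, smul_smul]
    have h2 : v = (1 - t) • ((1 - t)⁻¹ • v) := by rw [smul_smul, mul_inv_cancel₀ ht.ne', one_smul]
    conv_lhs => rw [h2]
    rw [sub_smul, one_smul, smul_smul]
    abel

end IsSimplex

theorem bary_eq_zero_of_mem_face {d : ℕ} {κ : Finset (E d)} (h : IsSimplex κ) {a y : E d}
    (hy : y ∈ body (κ.erase a)) : bary κ a y = 0 := by
  have hsub : body (κ.erase a) ⊆ {z | bary κ a z = 0} := by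
    refine convexHull_min (fun b hb => ?_) ?_
    · exact h.bary_of_ne (Finset.mem_of_mem_erase hb) (Finset.ne_of_mem_erase hb)
    · exact (convex_singleton (0 : ℝ)).affine_preimage (bary κ a)
  exact hsub hy

/-! ### Face means of `C¹` functions, by dilation about the opposite vertex. -/

namespace IsSimplex

open Filter Topology

variable {d : ℕ} {κ : Finset (E d)}

theorem integral_homothety (a : E d) (κ : Finset (E d)) (g : E d → ℝ) {r : ℝ} (hr : 0 < r) :
    r ^ d * ∫ x in body κ, g (a + r • (x - a)) =
      ∫ x in AffineMap.homothety a r '' body κ, g x := by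
  have hdet : LinearMap.det (AffineMap.homothety a r : E d →ᵃ[ℝ] E d).linear = r ^ d := by
    simp [AffineMap.homothety_linear]
  rw [setIntegral_image_affineMap _ (by rw [hdet]; positivity) (measurableSet_body κ), hdet,
    abs_of_pos (by positivity)]
  congr 2
  ext x
  rw [AffineMap.homothety_apply, vsub_eq_sub, vadd_eq_add, add_comm]

/-- The derivative of the integral over the dilated simplex. -/
theorem hasDerivAt_integral_dilation (κ : Finset (E d)) (a : E d) {ψ : E d → ℝ}
    (hψ : ContDiff ℝ 1 ψ) :
    HasDerivAt (fun r : ℝ => r ^ d * ∫ x in body κ, ψ (a + r • (x - a)))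
      (∫ x in body κ, (fderiv ℝ ψ x (x - a) + d * ψ x)) 1 := by
  have hc' : Continuous fun z : ℝ × E d => fderiv ℝ ψ (a + z.1 • (z.2 - a)) (z.2 - a) :=
    ((hψ.continuous_fderiv one_ne_zero).comp (by fun_prop)).clm_apply (by fun_prop)
  -- The unit ball about `r = 1` is contained in `[0, 2]`, so this constant dominates the derivative
  -- for all dilation factors that matter.
  obtain ⟨C, hC⟩ := (isCompact_Icc.prod (isCompact_body κ) :
    IsCompact (Set.Icc (0 : ℝ) 2 ×ˢ body κ)).exists_bound_of_continuousOn hc'.continuousOn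
  have hder : ∀ x : E d, ∀ r : ℝ, HasDerivAt (fun r : ℝ => ψ (a + r • (x - a)))
      (fderiv ℝ ψ (a + r • (x - a)) (x - a)) r := fun x r => by
    have h1 : HasDerivAt (fun r : ℝ => a + r • (x - a)) (x - a) r := by
      simpa using ((hasDerivAt_id r).smul_const (x - a)).const_add a
    exact ((hψ.differentiable (by norm_num)) _).hasFDerivAt.comp_hasDerivAt r h1
  have hI : HasDerivAt (fun r : ℝ => ∫ x in body κ, ψ (a + r • (x - a)))
      (∫ x in body κ, fderiv ℝ ψ (a + (1 : ℝ) • (x - a)) (x - a)) 1 := by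
    refine (hasDerivAt_integral_of_dominated_loc_of_deriv_le
      (F := fun r x => ψ (a + r • (x - a)))
      (F' := fun r x => fderiv ℝ ψ (a + r • (x - a)) (x - a)) (bound := fun _ => C)
      (Metric.ball_mem_nhds (1 : ℝ) one_pos) (Eventually.of_forall fun r => ?_) ?_ ?_ ?_ ?_ ?_).2
    · exact (hψ.continuous.comp (by fun_prop)).aestronglyMeasurable
    · exact integrableOn_body (hψ.continuous.comp (by fun_prop))
    · exact (hc'.comp (continuous_const.prodMk continuous_id)).aestronglyMeasurable
    · refine (ae_restrict_mem (measurableSet_body κ)).mono fun x hx r hr => hC (r, x) ⟨?_, hx⟩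
      rw [Metric.mem_ball, Real.dist_eq, abs_lt] at hr
      constructor <;> simp only <;> linarith
    · exact integrableOn_body continuous_const
    · exact Eventually.of_forall fun x r _ => hder x r
  have := (hasDerivAt_pow d (1 : ℝ)).mul hI
  refine this.congr_deriv ?_
  have h2 : Continuous fun x => fderiv ℝ ψ x (x - a) :=
    (hψ.continuous_fderiv one_ne_zero).clm_apply (by fun_prop)
  simp only [one_smul, add_sub_cancel, one_pow, one_mul, mul_one]
  rw [integral_add (integrableOn_body h2) ((integrableOn_body hψ.continuous).const_mul _),
    integral_const_mul, add_comm]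

/-- This is the divergence theorem for `ψ(x) (x - a)`, a field tangential to the faces through `a`
and zero on the remaining face. The integral is the derivative at `r = 1` of the integral of `ψ`
over the simplex dilated about `a`. Between `r < 1` and `1` only a layer along the opposite face is
added. Its volume is of order `1 - r` and so is `ψ` on it, hence the left derivative is zero. -/
theorem integral_eq_zero_of_face (h : IsSimplex κ) {a : E d} (ha : a ∈ κ)
    {ψ : E d → ℝ} (hψ : ContDiff ℝ 1 ψ) (h0 : ∀ y ∈ body (κ.erase a), ψ y = 0) :
    ∫ x in body κ, (fderiv ℝ ψ x (x - a) + d * ψ x) = 0 := by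
  have hF := hasDerivAt_integral_dilation κ a hψ
  set F := fun r : ℝ => r ^ d * ∫ x in body κ, ψ (a + r • (x - a)) with hFdef
  -- a Lipschitz bound for `ψ` along the rays
  obtain ⟨C, hC⟩ : ∃ C, ∀ x ∈ body κ, bary κ a x < 1 → |ψ x| ≤ C * bary κ a x := by
    obtain ⟨C, hC⟩ := (isCompact_body κ).exists_bound_of_continuousOn
      (hψ.continuous_fderiv one_ne_zero).continuousOn
    refine ⟨C * Metric.diam (body κ), fun x hx hxa => ?_⟩
    obtain ⟨y, hy, hxy⟩ := h.exists_ray ha hx hxa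
    have hyκ : y ∈ body κ := body_mono (Finset.erase_subset _ _) hy
    have haκ : a ∈ body κ := subset_body κ ha
    have hb : 0 ≤ bary κ a x := by rw [h.body_eq] at hx; exact hx a ha
    have hC0 : 0 ≤ C := (norm_nonneg _).trans (hC x hx)
    have := (convex_body κ).norm_image_sub_le_of_norm_fderiv_le (𝕜 := ℝ)
      (fun z _ => (hψ.differentiable (by norm_num)) z) hC hyκ hx
    rw [h0 y hy, sub_zero, Real.norm_eq_abs] at this
    refine this.trans ?_
    rw [mul_assoc]
    refine mul_le_mul_of_nonneg_left ?_ hC0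
    have hxy' : x - y = bary κ a x • (a - y) := by
      conv_lhs => rw [hxy]
      abel
    rw [hxy', norm_smul, Real.norm_eq_abs, abs_of_nonneg hb, mul_comm, ← dist_eq_norm]
    exact mul_le_mul_of_nonneg_right
      (Metric.dist_le_diam_of_mem (isCompact_body κ).isBounded haκ hyκ) hb
  set T := fun r : ℝ => (AffineMap.homothety a r : E d →ᵃ[ℝ] E d)
  have hbound : ∀ r : ℝ, 0 < r → r < 1 →
      |F 1 - F r| ≤ |C| * (1 - r) * ((1 - r ^ d) * vol κ) := by
    intro r hr hr1
    have hsub : T r '' body κ ⊆ body κ := by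
      rintro _ ⟨x, hx, rfl⟩
      simp only [T, AffineMap.homothety_eq_lineMap]
      exact (convex_body κ).lineMap_mem (subset_body κ ha) hx ⟨hr.le, hr1.le⟩
    have hTm : MeasurableSet (T r '' body κ) :=
      ((isCompact_body κ).image (continuous_affineMap _)).measurableSet
    have h1 : F 1 - F r = ∫ x in body κ \ T r '' body κ, ψ x := by
      rw [setIntegral_sdiff hTm (integrableOn_body hψ.continuous) hsub, hFdef]
      simp only [integral_homothety a κ ψ hr]
      simp [T]
    have hv : volume.real (body κ \ T r '' body κ) = (1 - r ^ d) * vol κ := by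
      have h2 := integral_homothety a κ (fun _ => (1 : ℝ)) hr
      rw [setIntegral_const_body, setIntegral_const] at h2
      rw [measureReal_sdiff hsub hTm (volume_body_ne_top κ)]
      simp only [smul_eq_mul, mul_one] at h2
      rw [← h2, vol]
      ring
    rw [h1, ← hv, ← Real.norm_eq_abs]
    refine norm_setIntegral_le_of_norm_le_const
      ((measure_mono Set.sdiff_subset).trans_lt (isCompact_body κ).measure_lt_top) fun x hx => ?_
    -- If the coordinate at `a` were at least `1 - r`, the point stretched back by `r⁻¹` would still
    -- lie in the simplex, and `x` would belong to the dilated simplex.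
    have hxb : bary κ a x < 1 - r := by
      by_contra! hcon
      refine hx.2 ⟨a + r⁻¹ • (x - a), ?_, ?_⟩
      · rw [h.body_eq]
        intro b hb
        have e1 : bary κ b (a + r⁻¹ • (x - a)) =
            bary κ b a + r⁻¹ * (bary κ b x - bary κ b a) := by
          have e2 := affineMap_sub_eq (bary κ b) (a + r⁻¹ • (x - a)) a
          rw [add_sub_cancel_left, map_smul, ← affineMap_sub_eq, smul_eq_mul] at e2
          linarith
        have hxb : 0 ≤ bary κ b x := by
          have := hx.1; rw [h.body_eq] at this; exact this b hb
        rw [e1]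
        by_cases hba : b = a
        · rw [hba, h.bary_self ha]
          have : r⁻¹ * (bary κ a x - 1) ≥ r⁻¹ * (-r) :=
            mul_le_mul_of_nonneg_left (by linarith) (by positivity)
          rw [mul_neg, inv_mul_cancel₀ hr.ne'] at this
          linarith
        · rw [h.bary_of_ne ha (Ne.symm hba)]
          simp only [sub_zero, zero_add]
          positivity
      · simp [T, AffineMap.homothety_apply, smul_smul, mul_inv_cancel₀ hr.ne']
    have hb : 0 ≤ bary κ a x := by
      have := hx.1; rw [h.body_eq] at this; exact this a ha
    rw [Real.norm_eq_abs]
    calc |ψ x| ≤ C * bary κ a x := hC x hx.1 (by linarith)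
      _ ≤ |C| * bary κ a x := mul_le_mul_of_nonneg_right (le_abs_self C) hb
      _ ≤ |C| * (1 - r) := mul_le_mul_of_nonneg_left hxb.le (abs_nonneg C)
  -- The layer estimate covers `r < 1` only, so the derivative is read off from the slopes on the
  -- left.
  have hlim := (hasDerivAt_iff_tendsto_slope.1 hF).mono_left
    (nhdsWithin_mono (1 : ℝ) (fun r (hr : r ∈ Set.Iio (1 : ℝ)) => ne_of_lt hr))
  refine tendsto_nhds_unique hlim (squeeze_zero_norm'
    (a := fun r : ℝ => |C| * ((1 - r ^ d) * vol κ)) ?_ ?_)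
  · filter_upwards [Ioo_mem_nhdsLT (zero_lt_one' ℝ)] with r hr
    have := hbound r hr.1 hr.2
    rw [slope_def_field, Real.norm_eq_abs, abs_div, abs_sub_comm, abs_sub_comm r 1,
      abs_of_pos (sub_pos.2 hr.2), div_le_iff₀ (sub_pos.2 hr.2)]
    linarith
  · refine Tendsto.mono_left (Continuous.tendsto' (by fun_prop) _ _ ?_) nhdsWithin_le_nhds
    simp

/-- The affine map between two simplices with a common face that fixes this face. -/
theorem exists_faceShear (h : IsSimplex κ) {κ' : Finset (E d)} (h' : IsSimplex κ')
    {a a' : E d} (ha : a ∈ κ) (ha' : a' ∈ κ') (hs : κ.erase a = κ'.erase a') :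
    ∃ T : E d →ᵃ[ℝ] E d, T a = a' ∧ (∀ y ∈ body (κ.erase a), T y = y) ∧ κ.image T = κ' ∧
      LinearMap.det T.linear = bary κ a a' ∧ LinearMap.det T.linear ≠ 0 ∧
      vol κ' = |bary κ a a'| * vol κ := by
  set T := shear (bary κ a) (a' - a)
  have hTa : T a = a' := by simp [T, shear_apply, h.bary_self ha]
  have hTb : ∀ b ∈ κ.erase a, T b = b := fun b hb => by
    simp [T, shear_apply, h.bary_of_ne (Finset.mem_of_mem_erase hb) (Finset.ne_of_mem_erase hb)]
  have himg : κ.image T = κ' := by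
    rw [← Finset.insert_erase ha, Finset.image_insert, hTa, ← Finset.insert_erase ha', ← hs]
    congr 1
    ext x
    simp only [Finset.mem_image]
    constructor
    · rintro ⟨b, hb, rfl⟩; rwa [hTb b hb]
    · exact fun hx => ⟨x, hx, hTb x hx⟩
  have hTs : ∀ y ∈ body (κ.erase a), T y = y := by
    intro y hy
    simp [T, shear_apply, bary_eq_zero_of_mem_face h hy]
  have hdet : LinearMap.det T.linear = bary κ a a' := by
    rw [det_shear, ← affineMap_sub_eq, h.bary_self ha]; ring
  -- Otherwise the coordinate of `κ` at `a` would vanish at all vertices of `κ'` and hence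
  -- identically.
  have hdet0 : LinearMap.det T.linear ≠ 0 := by
    rw [hdet]
    intro h0
    have : bary κ a = 0 := h'.affineMap_ext fun b hb => by
      by_cases hb' : b = a'
      · rw [hb', h0]; rfl
      · have : b ∈ κ.erase a := by rw [hs]; exact Finset.mem_erase.2 ⟨hb', hb⟩
        rw [h.bary_of_ne (Finset.mem_of_mem_erase this) (Finset.ne_of_mem_erase this)]; rfl
    have h1 := h.bary_self ha
    rw [this] at h1
    exact zero_ne_one h1
  have hvol : vol κ' = |LinearMap.det T.linear| * vol κ := by
    have := setIntegral_image_affineMap T hdet0 (measurableSet_body κ) fun _ => 1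
    rw [image_body, himg, setIntegral_const_body, setIntegral_const_body] at this
    simpa using this
  exact ⟨T, hTa, hTs, himg, hdet, hdet0, hdet ▸ hvol⟩

/-- The mean values of functions with equal traces coincide. -/
theorem faceMean_congr (h : IsSimplex κ) {κ' : Finset (E d)} (h' : IsSimplex κ')
    {a a' : E d} (ha : a ∈ κ) (ha' : a' ∈ κ') (hs : κ.erase a = κ'.erase a') {ψ ψ' : E d → ℝ}
    (hψ : ContDiff ℝ 1 ψ) (hψ' : ContDiff ℝ 1 ψ') (heq : ∀ y ∈ body (κ.erase a), ψ y = ψ' y) :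
    faceMean κ a ψ (gradient ψ) = faceMean κ' a' ψ' (gradient ψ') := by
  -- The shear `T` carries `κ` onto `κ'` and `a` to `a'`, and it fixes the common face. Both
  -- functionals can therefore be compared on `κ`, where `ψ - ψ' ∘ T` vanishes on the face. The
  -- Jacobian of the pullback cancels with the ratio of the volumes in the normalization.
  obtain ⟨T, hTa, hTs, himg, hdet, hdet0, hvol⟩ := h.exists_faceShear h' ha ha' hs
  rw [← hdet] at hvol
  have hT : ContDiff ℝ 1 T := by
    have : (T : E d → E d) = fun x => LinearMap.toContinuousLinearMap T.linear x + T 0 := by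
      ext1 y
      exact congrFun (AffineMap.decomp T) y
    rw [this]
    exact (ContinuousLinearMap.contDiff _).add contDiff_const
  have hcomp : ContDiff ℝ 1 (ψ' ∘ T) := hψ'.comp hT
  have hint : ∫ x in body κ', (⟪gradient ψ' x, x - a'⟫ + d * ψ' x) =
      |LinearMap.det T.linear| *
        ∫ x in body κ, (fderiv ℝ (ψ' ∘ T) x (x - a) + d * (ψ' ∘ T) x) := by
    rw [← himg, ← image_body, setIntegral_image_affineMap T hdet0 (measurableSet_body κ)]
    congr 2
    ext x
    rw [fderiv_comp x ((hψ'.differentiable (by norm_num)) _) ((hT.differentiable (by norm_num)) _),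
      (hasFDerivAt_affineMap T x).fderiv, gradient, InnerProductSpace.toDual_symm_apply]
    simp only [ContinuousLinearMap.comp_apply, LinearMap.coe_toContinuousLinearMap',
      Function.comp_apply]
    rw [← hTa, affineMap_sub_eq T]
  have hzero := h.integral_eq_zero_of_face ha (hψ.sub hcomp) fun y hy => by
    simp [hTs y hy, heq y hy]
  have hi : ∀ {g : E d → ℝ}, ContDiff ℝ 1 g →
      IntegrableOn (fun x => fderiv ℝ g x (x - a) + d * g x) (body κ) := fun hg =>
    integrableOn_body (((hg.continuous_fderiv one_ne_zero).clm_apply (by fun_prop)).add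
      (hg.continuous.const_mul _))
  have hkey : ∫ x in body κ, (fderiv ℝ ψ x (x - a) + d * ψ x) =
      ∫ x in body κ, (fderiv ℝ (ψ' ∘ T) x (x - a) + d * (ψ' ∘ T) x) := by
    rw [← sub_eq_zero, ← integral_sub (hi hψ) (hi hcomp), ← hzero]
    congr 1
    ext x
    rw [fderiv_fun_sub ((hψ.differentiable (by norm_num)) _) ((hcomp.differentiable (by norm_num)) _)]
    simp only [_root_.sub_apply]
    ring
  unfold faceMean
  rw [hint, ← hkey, hvol]
  have : |LinearMap.det T.linear| ≠ 0 := abs_ne_zero.2 hdet0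
  have h2 : ∀ x, ⟪gradient ψ x, x - a⟫ = fderiv ℝ ψ x (x - a) := fun x => by
    rw [gradient, InnerProductSpace.toDual_symm_apply]
  simp only [h2]
  field_simp

end IsSimplex

/-! ### Mollification of bounded vector fields -/

section mollify

open Filter Topology Convolution ContinuousLinearMap

variable {d : ℕ}

theorem locallyIntegrable_of_bounded {F : Type*} [NormedAddCommGroup F] {V : E d → F} {C : ℝ}
    (hVm : AEStronglyMeasurable V) (hV : ∀ x, ‖V x‖ ≤ C) : LocallyIntegrable V :=
  (locallyIntegrable_const C).mono hVm
    (Eventually.of_forall fun x => (hV x).trans (le_abs_self C))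

/-- The normalized kernel is nonnegative with integral one, so averaging preserves a uniform bound.
-/
theorem norm_convolution_normed_le {F : Type*} [NormedAddCommGroup F] [NormedSpace ℝ F]
    (η : ContDiffBump (0 : E d)) {V : E d → F} {C : ℝ} (hV : ∀ x, ‖V x‖ ≤ C) (x : E d) :
    ‖(η.normed volume ⋆[lsmul ℝ ℝ] V) x‖ ≤ C := by
  rw [convolution_def]
  refine (norm_integral_le_of_norm_le (η.integrable_normed.mul_const C)
    (Eventually.of_forall fun t => ?_)).trans ?_
  · rw [lsmul_apply, norm_smul, Real.norm_of_nonneg (η.nonneg_normed t)]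
    exact mul_le_mul_of_nonneg_left (hV _) (η.nonneg_normed t)
  · rw [integral_mul_const, η.integral_normed, one_mul]

/-- The divergence of a mollified vector field is the mollified divergence. -/
theorem sum_fderiv_convolution {V : E d → E d} {D : E d → ℝ} {C : ℝ}
    (hVm : AEStronglyMeasurable V) (hV : ∀ x, ‖V x‖ ≤ C)
    (hdiv : ∀ ψ : E d → ℝ, ContDiff ℝ 1 ψ → HasCompactSupport ψ →
      ∫ y, fderiv ℝ ψ y (V y) = -∫ y, ψ y * D y)
    {f : E d → ℝ} (hfc : HasCompactSupport f) (hf1 : ContDiff ℝ 1 f) (x : E d) :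
    ∑ i, (fderiv ℝ (f ⋆[lsmul ℝ ℝ] V) x (EuclideanSpace.single i 1)) i =
      (f ⋆[lsmul ℝ ℝ] D) x := by
  have hli := locallyIntegrable_of_bounded hVm hV
  let M : ℝ →L[ℝ] E d →L[ℝ] E d := lsmul ℝ ℝ
  have hex : Integrable (fun t => precompL (E d) M (fderiv ℝ f t) (V (x - t))) :=
    HasCompactSupport.convolutionExists_left (precompL (E d) M) (hfc.fderiv (𝕜 := ℝ))
      (hf1.continuous_fderiv one_ne_zero) hli x
  have hD := (hfc.hasFDerivAt_convolution_left M hf1 hli x).fderiv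
  rw [hD, convolution_def]
  have hi : ∀ i, Integrable (fun t => fderiv ℝ f t (EuclideanSpace.single i 1) • V (x - t)) :=
    fun i => hex.apply_continuousLinearMap (EuclideanSpace.single i (1 : ℝ))
  have hi' : ∀ i ∈ Finset.univ,
      Integrable (fun t => fderiv ℝ f t (EuclideanSpace.single i 1) * V (x - t) i) :=
    fun i _ => (EuclideanSpace.proj i : E d →L[ℝ] ℝ).integrable_comp (hi i)
  have hc : ∀ i, ((∫ t, precompL (E d) M (fderiv ℝ f t) (V (x - t)))
      (EuclideanSpace.single i 1)) i =
      ∫ t, fderiv ℝ f t (EuclideanSpace.single i 1) * V (x - t) i := fun i => by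
    rw [ContinuousLinearMap.integral_apply hex]
    simp only [precompL_apply, M, lsmul_apply]
    exact ((EuclideanSpace.proj i : E d →L[ℝ] ℝ).integral_comp_comm (hi i)).symm
  simp only [hc]
  rw [← integral_finsetSum _ hi']
  have hs : ∀ t v, ∑ i, fderiv ℝ f t (EuclideanSpace.single i 1) * v i = fderiv ℝ f t v := by
    intro t v
    conv_rhs => rw [← (EuclideanSpace.basisFun (Fin d) ℝ).sum_repr v, map_sum]
    refine Finset.sum_congr rfl fun i _ => ?_
    simp [mul_comm]
  simp only [hs]
  -- The derivative of the convolution falls on the kernel; the weak divergence is then tested with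
  -- the reflected kernel, whose derivative has the opposite sign.
  have hψ := hdiv (fun y => f (x - y)) (hf1.comp (contDiff_const.sub contDiff_id))
    (hfc.comp_homeomorph (Homeomorph.subLeft x))
  have hfd : ∀ y v, fderiv ℝ (fun y => f (x - y)) y v = -fderiv ℝ f (x - y) v := fun y v => by
    have h1 : HasFDerivAt (fun y => x - y) (-ContinuousLinearMap.id ℝ (E d)) y :=
      (hasFDerivAt_id y).const_sub x
    have h2 := ((hf1.differentiable one_ne_zero (x - y)).hasFDerivAt.comp y h1).fderiv
    change fderiv ℝ (f ∘ fun y => x - y) y v = _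
    rw [h2]
    simp
  simp only [hfd, integral_neg, neg_inj] at hψ
  have h1 := integral_sub_left_eq_self (fun y => fderiv ℝ f (x - y) (V y)) volume x
  have h2 := integral_sub_left_eq_self (fun y => f (x - y) * D y) volume x
  simp only [sub_sub_cancel] at h1 h2
  rw [h1, hψ, ← h2, convolution_def]
  rfl

/-- Testing the weak gradient by a mollified vector field with compact support. -/
theorem IsWeakGradient.integral_mollified {Ω : Set (E d)} (hfin : volume Ω ≠ ⊤) {φ : E d → ℝ}
    {w : E d → E d} (hφ : IsWeakGradient Ω φ w) {V : E d → E d} {D : E d → ℝ} {C : ℝ}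
    (hVm : AEStronglyMeasurable V) (hV : ∀ x, ‖V x‖ ≤ C)
    {K : Set (E d)} (hK : IsCompact K) (hVK : ∀ x, x ∉ K → V x = 0)
    (hdiv : ∀ ψ : E d → ℝ, ContDiff ℝ 1 ψ → HasCompactSupport ψ →
      ∫ y, fderiv ℝ ψ y (V y) = -∫ y, ψ y * D y)
    (η : ContDiffBump (0 : E d)) (hη : Metric.cthickening η.rOut K ⊆ Ω) :
    ∫ x in Ω, (⟪w x, (η.normed volume ⋆[lsmul ℝ ℝ] V) x⟫ +
      φ x * (η.normed volume ⋆[lsmul ℝ ℝ] D) x) = 0 := by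
  have : IsFiniteMeasure (volume.restrict Ω) := ⟨by simpa using hfin.lt_top⟩
  set W := η.normed volume ⋆[lsmul ℝ ℝ] V
  have hli := locallyIntegrable_of_bounded hVm hV
  have hfc : HasCompactSupport (η.normed (volume : Measure (E d))) := η.hasCompactSupport_normed
  have hW : ContDiff ℝ ∞ W :=
    hfc.contDiff_convolution_left (n := ⊤) (lsmul ℝ ℝ) η.contDiff_normed hli
  have hsupp : Function.support W ⊆ Metric.cthickening η.rOut K := by
    refine (support_convolution_subset_swap (lsmul ℝ ℝ)).trans ?_
    rw [η.support_normed_eq]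
    rintro _ ⟨y, hy, z, hz, rfl⟩
    have hyK : y ∈ K := by
      by_contra hyK
      exact hy (hVK y hyK)
    refine Metric.mem_cthickening_of_dist_le _ y _ _ hyK ?_
    simpa [dist_eq_norm] using (mem_ball_zero_iff.1 hz).le
  have hts : tsupport W ⊆ Metric.cthickening η.rOut K :=
    closure_minimal hsupp Metric.isClosed_cthickening
  have hWc : HasCompactSupport W :=
    HasCompactSupport.of_support_subset_isCompact hK.cthickening hsupp
  -- The mollified field is supported in `K` thickened by the radius of the kernel, which stays
  -- inside `Ω`. Each component is therefore an admissible test function.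
  have htest : ∀ i, IsTest Ω fun x => W x i := fun i => by
    refine ⟨(EuclideanSpace.proj i : E d →L[ℝ] ℝ).contDiff.comp hW, ?_, ?_⟩
    · exact hWc.comp_left (g := fun v : E d => v i) rfl
    · have hsub : (Function.support fun x => W x i) ⊆ Function.support W := fun x hx hx0 =>
        hx (by simp [hx0])
      exact (closure_mono hsub).trans (hts.trans hη)
  have hwk := fun i => hφ.2.2 _ (htest i) i
  have hfd : ∀ i x v, fderiv ℝ (fun x => W x i) x v = (fderiv ℝ W x v) i := fun i x v => by
    have h1 : HasFDerivAt W (fderiv ℝ W x) x :=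
      (hW.differentiable (by simp) x).hasFDerivAt
    have := ((EuclideanSpace.proj i : E d →L[ℝ] ℝ).hasFDerivAt.comp x h1).fderiv
    change fderiv ℝ ((EuclideanSpace.proj i : E d →L[ℝ] ℝ) ∘ W) x v = _
    rw [this]; rfl
  simp only [hfd] at hwk
  have hbd : ∀ i, ∃ B, ∀ x, ‖fderiv ℝ W x (EuclideanSpace.single i 1) i‖ ≤ B := fun i => by
    have hcf : Continuous fun x => fderiv ℝ W x (EuclideanSpace.single i 1) i :=
      (EuclideanSpace.proj i : E d →L[ℝ] ℝ).continuous.comp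
        ((hW.continuous_fderiv (by simp)).clm_apply continuous_const)
    refine hcf.bounded_above_of_compact_support ?_
    refine (hWc.fderiv (𝕜 := ℝ)).comp_left
      (g := fun L : E d →L[ℝ] E d => (L (EuclideanSpace.single i 1)) i) (by simp)
  have hφi : Integrable φ (volume.restrict Ω) := hφ.1.integrable one_le_two
  have hwi : Integrable w (volume.restrict Ω) := hφ.2.1.integrable one_le_two
  have hI1 : ∀ i ∈ Finset.univ, Integrable
      (fun x => φ x * fderiv ℝ W x (EuclideanSpace.single i 1) i) (volume.restrict Ω) := fun i _ => by
    obtain ⟨B, hB⟩ := hbd i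
    refine hφi.mul_bdd (c := B) ?_ (Eventually.of_forall hB)
    exact ((EuclideanSpace.proj i : E d →L[ℝ] ℝ).continuous.comp
      ((hW.continuous_fderiv (by simp)).clm_apply continuous_const)).aestronglyMeasurable
  have hWm : AEStronglyMeasurable W (volume.restrict Ω) := hW.continuous.aestronglyMeasurable
  have hI2 : ∀ i ∈ Finset.univ, Integrable (fun x => w x i * W x i) (volume.restrict Ω) :=
    fun i _ => by
    refine ((EuclideanSpace.proj i : E d →L[ℝ] ℝ).integrable_comp hwi).mul_bdd (c := C)
      ((EuclideanSpace.proj i : E d →L[ℝ] ℝ).continuous.comp_aestronglyMeasurable hWm)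
      (Eventually.of_forall fun x => ?_)
    exact (PiLp.norm_apply_le (W x) i).trans (norm_convolution_normed_le η hV x)
  have hsum := Finset.sum_congr (rfl : (Finset.univ : Finset (Fin d)) = _) fun i _ => hwk i
  rw [← integral_finsetSum _ hI1, Finset.sum_neg_distrib, ← integral_finsetSum _ hI2] at hsum
  have hsd : ∀ x, ∑ i, (fderiv ℝ W x (EuclideanSpace.single i 1)) i =
      (η.normed volume ⋆[lsmul ℝ ℝ] D) x := sum_fderiv_convolution hVm hV hdiv
        η.hasCompactSupport_normed η.contDiff_normed
  simp only [← Finset.mul_sum, hsd] at hsum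
  have hin : ∀ x, ∑ i, w x i * W x i = ⟪w x, W x⟫ := fun x => by
    simp [PiLp.inner_apply, mul_comm]
  simp only [hin] at hsum
  have hJ1 : Integrable (fun x => ⟪w x, W x⟫) (volume.restrict Ω) := by
    simp only [← hin]; exact integrable_finsetSum _ hI2
  have hJ2 : Integrable (fun x => φ x * (η.normed volume ⋆[lsmul ℝ ℝ] D) x)
      (volume.restrict Ω) := by
    simp only [← hsd, Finset.mul_sum]
    exact integrable_finsetSum _ hI1
  rw [integral_add hJ1 hJ2, hsum, add_neg_cancel]

/-- Testing the weak gradient by the almost everywhere limit of bounded vector fields with compact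
supports and bounded weak divergences. -/
theorem IsWeakGradient.integral_limit {Ω : Set (E d)} (hΩ : IsOpen Ω) (hfin : volume Ω ≠ ⊤)
    {φ : E d → ℝ} {w : E d → E d} (hφ : IsWeakGradient Ω φ w)
    {V : ℕ → E d → E d} {D : ℕ → E d → ℝ} {V₀ : E d → E d} {D₀ : E d → ℝ} {C : ℝ}
    (hVm : ∀ k, AEStronglyMeasurable (V k)) (hV : ∀ k x, ‖V k x‖ ≤ C)
    (hDm : ∀ k, AEStronglyMeasurable (D k)) (hD : ∀ k x, ‖D k x‖ ≤ C)
    (hK : ∀ k, ∃ K, IsCompact K ∧ K ⊆ Ω ∧ ∀ x, x ∉ K → V k x = 0)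
    (hdiv : ∀ k, ∀ ψ : E d → ℝ, ContDiff ℝ 1 ψ → HasCompactSupport ψ →
      ∫ y, fderiv ℝ ψ y (V k y) = -∫ y, ψ y * D k y)
    (hlimV : ∀ᵐ x, Tendsto (Function.uncurry V) (atTop ×ˢ 𝓝 x) (𝓝 (V₀ x)))
    (hlimD : ∀ᵐ x, Tendsto (Function.uncurry D) (atTop ×ˢ 𝓝 x) (𝓝 (D₀ x))) :
    ∫ x in Ω, (⟪w x, V₀ x⟫ + φ x * D₀ x) = 0 := by
  have : IsFiniteMeasure (volume.restrict Ω) := ⟨by simpa using hfin.lt_top⟩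
  -- The radius has to fit into the gap between the support of `V k` and the complement of `Ω`,
  -- which may shrink with `k`, and it also has to tend to zero.
  have hη : ∀ k : ℕ, ∃ η : ContDiffBump (0 : E d), η.rOut ≤ 1 / ((k : ℝ) + 1) ∧
      ∫ x in Ω, (⟪w x, (η.normed volume ⋆[lsmul ℝ ℝ] V k) x⟫ +
        φ x * (η.normed volume ⋆[lsmul ℝ ℝ] D k) x) = 0 := fun k => by
    obtain ⟨K, hKc, hKΩ, hVK⟩ := hK k
    obtain ⟨δ, hδ, hδΩ⟩ := hKc.exists_cthickening_subset_open hΩ hKΩ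
    have hr : 0 < min δ (1 / ((k : ℝ) + 1)) := lt_min hδ (by positivity)
    refine ⟨⟨min δ (1 / ((k : ℝ) + 1)) / 2, min δ (1 / ((k : ℝ) + 1)), half_pos hr, half_lt_self hr⟩,
      min_le_right _ _, ?_⟩
    exact hφ.integral_mollified hfin (hVm k) (hV k) hKc hVK (hdiv k) _
      ((Metric.cthickening_mono (min_le_left _ _) _).trans hδΩ)
  choose η hη1 hη2 using hη
  have hr : Tendsto (fun k => (η k).rOut) atTop (𝓝 0) :=
    squeeze_zero (fun k => (η k).rOut_pos.le) hη1 tendsto_one_div_add_atTop_nhds_zero_nat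
  have hφi : Integrable φ (volume.restrict Ω) := hφ.1.integrable one_le_two
  have hwi : Integrable w (volume.restrict Ω) := hφ.2.1.integrable one_le_two
  have hlim := tendsto_integral_of_dominated_convergence (μ := volume.restrict Ω)
    (F := fun k x => ⟪w x, ((η k).normed volume ⋆[lsmul ℝ ℝ] V k) x⟫ +
        φ x * ((η k).normed volume ⋆[lsmul ℝ ℝ] D k) x)
    (f := fun x => ⟪w x, V₀ x⟫ + φ x * D₀ x) (fun x => ‖w x‖ * C + ‖φ x‖ * C) ?_ ?_ ?_ ?_
  · simp only [hη2] at hlim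
    exact (tendsto_nhds_unique hlim tendsto_const_nhds)
  · intro k
    have hcont : ∀ {F : Type _} [NormedAddCommGroup F] [NormedSpace ℝ F] (g : E d → F),
        AEStronglyMeasurable g → (∀ x, ‖g x‖ ≤ C) →
        Continuous ((η k).normed volume ⋆[lsmul ℝ ℝ] g) := fun g hg hgC =>
      (η k).hasCompactSupport_normed.continuous_convolution_left (lsmul ℝ ℝ)
        (η k).continuous_normed (locallyIntegrable_of_bounded hg hgC)
    exact (hwi.1.inner (hcont _ (hVm k) (hV k)).aestronglyMeasurable).add
      (hφi.1.mul (hcont _ (hDm k) (hD k)).aestronglyMeasurable)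
  · exact (hwi.norm.mul_const C).add (hφi.norm.mul_const C)
  · refine fun k => Eventually.of_forall fun x => (norm_add_le _ _).trans (add_le_add ?_ ?_)
    · exact (norm_inner_le_norm _ _).trans (mul_le_mul_of_nonneg_left
        (norm_convolution_normed_le _ (hV k) x) (norm_nonneg _))
    · rw [norm_mul]
      exact mul_le_mul_of_nonneg_left (norm_convolution_normed_le _ (hD k) x) (norm_nonneg _)
  -- Both the field and the kernel vary with `k`. Convergence of the convolutions therefore needs
  -- the limits jointly in `k` and in the point, which is why the hypotheses use a product filter.
  · filter_upwards [ae_restrict_of_ae hlimV, ae_restrict_of_ae hlimD] with x h1 h2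
    have t1 := ContDiffBump.convolution_tendsto_right hr (Eventually.of_forall hVm) h1
      (tendsto_const_nhds (x := x))
    have t2 := ContDiffBump.convolution_tendsto_right hr (Eventually.of_forall hDm) h2
      (tendsto_const_nhds (x := x))
    exact (tendsto_const_nhds.inner t1).add (t2.const_mul _)

end mollify

/-! ### Adjacent simplices -/

open Filter Topology

theorem affineMap_centroid {d : ℕ} (hd : 1 ≤ d) {s : Finset (E d)} (hc : s.card = d)
    (f : E d →ᵃ[ℝ] ℝ) : f ((d : ℝ)⁻¹ • ∑ b ∈ s, b) = (d : ℝ)⁻¹ * ∑ b ∈ s, f b := by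
  have hdec : ∀ x, f x = f.linear x + f 0 := fun x => congrFun (AffineMap.decomp f) x
  rw [hdec, map_smul, map_sum, Finset.sum_congr rfl fun b _ => hdec b,
    Finset.sum_add_distrib, Finset.sum_const, hc]
  have : (d : ℝ) ≠ 0 := by positivity
  simp only [smul_eq_mul, nsmul_eq_mul]
  field_simp

/-- Two different simplices of a conforming mesh that share the face opposite to `a` in `κ` and
opposite to `a'` in `κ'`. -/
structure Adjacent {d : ℕ} (κ κ' : Finset (E d)) (a a' : E d) : Prop where
  left : IsSimplex κ
  right : IsSimplex κ'
  mem_left : a ∈ κ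
  mem_right : a' ∈ κ'
  erase_eq : κ.erase a = κ'.erase a'
  ne : κ ≠ κ'
  inter_subset : body κ ∩ body κ' ⊆ body (κ ∩ κ')

namespace Adjacent

variable {d : ℕ} {κ κ' : Finset (E d)} {a a' : E d}

theorem symm (h : Adjacent κ κ' a a') : Adjacent κ' κ a' a :=
  ⟨h.right, h.left, h.mem_right, h.mem_left, h.erase_eq.symm, h.ne.symm, by
    rw [Set.inter_comm, Finset.inter_comm]; exact h.inter_subset⟩

theorem mem_left_of_mem (_ : Adjacent κ κ' a a') {b : E d} (hb : b ∈ κ.erase a) : b ∈ κ :=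
  Finset.mem_of_mem_erase hb

theorem mem_right_of_mem (h : Adjacent κ κ' a a') {b : E d} (hb : b ∈ κ.erase a) : b ∈ κ' :=
  Finset.mem_of_mem_erase (h.erase_eq ▸ hb)

theorem inter_eq (h : Adjacent κ κ' a a') : κ ∩ κ' = κ.erase a := by
  refine (Finset.eq_of_subset_of_card_le (fun b hb =>
    Finset.mem_inter.2 ⟨h.mem_left_of_mem hb, h.mem_right_of_mem hb⟩) ?_).symm
  rw [h.left.erase_card h.mem_left, ← Nat.lt_succ_iff, Nat.succ_eq_add_one, ← h.left.card]
  refine Finset.card_lt_card ⟨Finset.inter_subset_left, fun hsub => h.ne ?_⟩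
  exact Finset.eq_of_subset_of_card_le (fun b hb => (Finset.mem_inter.1 (hsub hb)).2)
    (by rw [h.left.card, h.right.card])

/-- Both coordinates vanish on the common face, so they are proportional; the value at `a'` is the
factor. -/
theorem bary_eq (h : Adjacent κ κ' a a') : bary κ a = bary κ a a' • bary κ' a' :=
  h.right.affineMap_ext fun b hb => by
    by_cases hba : b = a'
    · simp [hba, h.right.bary_self h.mem_right]
    · have : b ∈ κ.erase a := h.erase_eq ▸ Finset.mem_erase.2 ⟨hba, hb⟩
      rw [h.left.bary_of_ne (h.mem_left_of_mem this) (Finset.ne_of_mem_erase this)]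
      simp [h.right.bary_of_ne hb hba]

theorem bary_ne_zero (h : Adjacent κ κ' a a') : bary κ a a' ≠ 0 := fun h0 => by
  have h1 := h.left.bary_self h.mem_left
  rw [h.bary_eq, h0] at h1
  simp at h1

/-- The barycenter of the common face. -/
def center (_ : Adjacent κ κ' a a') : E d := (d : ℝ)⁻¹ • ∑ b ∈ κ.erase a, b

theorem center_symm (h : Adjacent κ κ' a a') : h.symm.center = h.center := by
  rw [center, center, h.erase_eq]

theorem affineMap_center (h : Adjacent κ κ' a a') (hd : 1 ≤ d) (f : E d →ᵃ[ℝ] ℝ) :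
    f h.center = (d : ℝ)⁻¹ * ∑ b ∈ κ.erase a, f b :=
  affineMap_centroid hd (h.left.erase_card h.mem_left) f

theorem bary_center (h : Adjacent κ κ' a a') (hd : 1 ≤ d) {b : E d} (hb : b ∈ κ.erase a) :
    bary κ b h.center = (d : ℝ)⁻¹ := by
  rw [h.affineMap_center hd, Finset.sum_eq_single b, h.left.bary_self (h.mem_left_of_mem hb), mul_one]
  · exact fun c hc hcb => h.left.bary_of_ne (h.mem_left_of_mem hc) hcb
  · exact fun hb' => absurd hb hb'

theorem bary_center_opposite (h : Adjacent κ κ' a a') (hd : 1 ≤ d) :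
    bary κ a h.center = 0 := by
  rw [h.affineMap_center hd, Finset.sum_eq_zero, mul_zero]
  exact fun c hc => h.left.bary_of_ne (h.mem_left_of_mem hc) (Finset.ne_of_mem_erase hc)

/-- The opposite vertices lie on different sides of the common face. -/
theorem bary_neg (h : Adjacent κ κ' a a') (hd : 1 ≤ d) : bary κ a a' < 0 := by
  -- If the opposite vertices were on the same side, a point slightly off the face barycenter
  -- towards `a` would lie in both simplices but not on the common face, against conformity.
  by_contra! hnn
  have hpos : 0 < bary κ a a' := lt_of_le_of_ne hnn h.bary_ne_zero.symm
  have hdpos : (0 : ℝ) < (d : ℝ)⁻¹ := by positivity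
  set γ : ℝ → E d := fun ε => h.center + ε • (a - h.center) with hγ
  have hγc : Continuous γ := by fun_prop
  have hγ0 : γ 0 = h.center := by simp [hγ]
  have hev : ∀ f : E d →ᵃ[ℝ] ℝ, 0 < f h.center → ∀ᶠ ε in 𝓝[>] (0 : ℝ), 0 < f (γ ε) :=
    fun f hf => by
      refine nhdsWithin_le_nhds ?_
      refine (((continuous_affineMap f).comp hγc).tendsto 0).eventually_const_lt ?_
      simpa [hγ0] using hf
  have h1 : ∀ᶠ ε in 𝓝[>] (0 : ℝ), ∀ b ∈ κ.erase a, 0 < bary κ b (γ ε) :=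
    (Finset.eventually_all _).2 fun b hb => hev _ (by rw [h.bary_center hd hb]; exact hdpos)
  have h2 : ∀ᶠ ε in 𝓝[>] (0 : ℝ), ∀ b ∈ κ'.erase a', 0 < bary κ' b (γ ε) :=
    (Finset.eventually_all _).2 fun b hb => hev _ (by
      rw [← h.center_symm, h.symm.bary_center hd hb]; exact hdpos)
  obtain ⟨ε, ⟨h1, h2⟩, hε⟩ := ((h1.and h2).and self_mem_nhdsWithin).exists
  have hε : 0 < ε := hε
  have ha : bary κ a (γ ε) = ε := by
    have e2 := affineMap_sub_eq (bary κ a) (γ ε) h.center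
    rw [hγ, add_sub_cancel_left, map_smul, ← affineMap_sub_eq, smul_eq_mul,
      h.bary_center_opposite hd, h.left.bary_self h.mem_left] at e2
    simpa using e2
  have ha' : 0 < bary κ' a' (γ ε) := by
    have : bary κ a (γ ε) = bary κ a a' * bary κ' a' (γ ε) := by
      conv_lhs => rw [h.bary_eq]
      rfl
    rw [ha] at this
    exact (mul_pos_iff_of_pos_left hpos).1 (this ▸ hε)
  have hmem : γ ε ∈ body κ ∩ body κ' := by
    rw [h.left.body_eq, h.right.body_eq]
    refine ⟨fun b hb => ?_, fun b hb => ?_⟩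
    · by_cases hba : b = a
      · rw [hba, ha]; exact hε.le
      · exact (h1 b (Finset.mem_erase.2 ⟨hba, hb⟩)).le
    · by_cases hba : b = a'
      · rw [hba]; exact ha'.le
      · exact (h2 b (Finset.mem_erase.2 ⟨hba, hb⟩)).le
  have := h.inter_subset hmem
  rw [h.inter_eq] at this
  have := bary_eq_zero_of_mem_face h.left this
  rw [ha] at this
  exact hε.ne' this

theorem vol_eq (h : Adjacent κ κ' a a') (hd : 1 ≤ d) : vol κ' = -bary κ a a' * vol κ := by
  obtain ⟨T, -, -, -, -, -, hvol⟩ :=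
    h.left.exists_faceShear h.right h.mem_left h.mem_right h.erase_eq
  rw [hvol, abs_of_neg (h.bary_neg hd)]

/-- The gradients of the barycentric coordinates on the two sides of a face, multiplied by the
volumes, are opposite. -/
theorem smul_affGrad (h : Adjacent κ κ' a a') (hd : 1 ≤ d) :
    vol κ • affGrad (bary κ a) = -(vol κ' • affGrad (bary κ' a')) := by
  conv_lhs => rw [h.bary_eq, affGrad_smul]
  rw [h.vol_eq hd, smul_smul, ← neg_smul]
  congr 1
  ring

/-- At most two simplices share a face. -/
theorem not_adjacent (h : Adjacent κ κ' a a') (hd : 1 ≤ d) {κ'' : Finset (E d)} {a'' : E d}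
    (h2 : Adjacent κ κ'' a a'') (h3 : Adjacent κ' κ'' a' a'') : False := by
  have e : bary κ a a'' = bary κ a a' * bary κ' a' a'' := by
    conv_lhs => rw [h.bary_eq]
    rfl
  -- Of three vertices pairwise separated by one hyperplane two would be on the same side; here the
  -- product of two negative factors is positive.
  have := mul_pos_of_neg_of_neg (h.bary_neg hd) (h3.bary_neg hd)
  linarith [h2.bary_neg hd]

/-- Strict dilations of two adjacent simplices about the barycenter of the common face lie in the
interior of their union. -/
theorem dilation_mem_interior (h : Adjacent κ κ' a a') (hd : 1 ≤ d) {lam : ℝ} (h0 : 0 ≤ lam)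
    (h1 : lam < 1) {x : E d} (hx : x ∈ body κ) :
    h.center + lam • (x - h.center) ∈ interior (body κ ∪ body κ') := by
  set z := h.center + lam • (x - h.center)
  have hdpos : (0 : ℝ) < (d : ℝ)⁻¹ := by positivity
  have hz : ∀ f : E d →ᵃ[ℝ] ℝ, f z = (1 - lam) * f h.center + lam * f x := fun f => by
    have e2 := affineMap_sub_eq f z h.center
    rw [add_sub_cancel_left, map_smul, ← affineMap_sub_eq, smul_eq_mul] at e2
    linarith
  rw [h.left.body_eq] at hx
  have hb : ∀ b ∈ κ.erase a, 0 < bary κ b z := fun b hb => by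
    rw [hz, h.bary_center hd hb]
    have := mul_nonneg h0 (hx b (h.mem_left_of_mem hb))
    have := mul_pos (sub_pos.2 h1) hdpos
    linarith
  have ha : 0 ≤ bary κ a z := by
    rw [hz, h.bary_center_opposite hd, mul_zero, zero_add]
    exact mul_nonneg h0 (hx a h.mem_left)
  -- Off the common face the contracted point is interior to `κ`. On the face the coordinates of the
  -- two simplices agree and are positive at all face vertices. A nearby point then lies in `κ` or
  -- in `κ'` according to the sign of its coordinate at `a`.
  rcases ha.lt_or_eq with ha | ha
  · refine interior_mono Set.subset_union_left ?_
    rw [h.left.interior_body_eq]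
    intro b hbκ
    by_cases hba : b = a
    · rw [hba]; exact ha
    · exact hb b (Finset.mem_erase.2 ⟨hba, hbκ⟩)
  · have hb' : ∀ b ∈ κ'.erase a', 0 < bary κ' b z := fun b hbκ => by
      have e : bary κ' b z = bary κ b z := by
        conv_lhs => rw [← h.left.sum_bary_smul z, ← Finset.add_sum_erase _ _ h.mem_left, ← ha,
          zero_smul, zero_add]
        have hs : ∑ c ∈ κ.erase a, bary κ c z = 1 := by
          have := h.left.sum_bary z
          rwa [← Finset.add_sum_erase _ _ h.mem_left, ← ha, zero_add] at this
        have hdec : ∀ x, bary κ' b x = (bary κ' b).linear x + bary κ' b 0 :=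
          fun x => congrFun (AffineMap.decomp (bary κ' b)) x
        rw [hdec, map_sum, ← one_mul (bary κ' b 0), ← hs, Finset.sum_mul,
          ← Finset.sum_add_distrib, Finset.sum_eq_single b]
        · rw [map_smul, smul_eq_mul, ← mul_add, ← hdec,
            h.right.bary_self (Finset.mem_of_mem_erase hbκ), mul_one]
        · intro c hc hcb
          rw [map_smul, smul_eq_mul, ← mul_add, ← hdec,
            h.right.bary_of_ne (h.mem_right_of_mem hc) hcb, mul_zero]
        · exact fun hn => absurd (h.erase_eq ▸ hbκ) hn
      rw [e]
      exact hb b (h.erase_eq ▸ hbκ)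
    have hopen : ∀ f : E d →ᵃ[ℝ] ℝ, 0 < f z → ∀ᶠ y in 𝓝 z, 0 < f y := fun f hf =>
      ((continuous_affineMap f).tendsto z).eventually_const_lt hf
    rw [mem_interior_iff_mem_nhds]
    filter_upwards [(Finset.eventually_all _).2 fun b hbκ => hopen _ (hb b hbκ),
      (Finset.eventually_all _).2 fun b hbκ => hopen _ (hb' b hbκ)] with y hy hy'
    rcases le_or_gt 0 (bary κ a y) with hya | hya
    · left
      rw [h.left.body_eq]
      intro b hbκ
      by_cases hba : b = a
      · rw [hba]; exact hya
      · exact (hy b (Finset.mem_erase.2 ⟨hba, hbκ⟩)).le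
    · right
      rw [h.right.body_eq]
      intro b hbκ
      by_cases hba : b = a'
      · rw [hba]
        have e : bary κ a y = bary κ a a' * bary κ' a' y := by
          conv_lhs => rw [h.bary_eq]
          rfl
        rw [e] at hya
        exact (pos_of_mul_neg_right hya (h.bary_neg hd).le).le
      · exact (hy' b (Finset.mem_erase.2 ⟨hba, hbκ⟩)).le

end Adjacent

/-! ### Mean values over a face seen from its two sides -/

open Filter Topology

section body

variable {d : ℕ} {Ω : Set (E d)} {κ : Finset (E d)}

theorem interior_body_subset (hreg : interior (closure Ω) = Ω) (hκ : body κ ⊆ closure Ω) :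
    interior (body κ) ⊆ Ω :=
  hreg ▸ interior_mono hκ

/-- A domain that equals the interior of its closure contains the interior of every mesh simplex,
and the boundary of a simplex is a null set. This is where the absence of slits enters. -/
theorem inter_body_ae_eq (hreg : interior (closure Ω) = Ω) (hκ : body κ ⊆ closure Ω) :
    (Ω ∩ body κ : Set (E d)) =ᵐ[volume] body κ := by
  refine (LE.le.eventuallyLE Set.inter_subset_right).antisymm ?_
  refine (interior_body_ae_eq κ).symm.le.trans (LE.le.eventuallyLE ?_)
  exact Set.subset_inter (interior_body_subset hreg hκ) interior_subset

theorem setIntegral_indicator_body (hreg : interior (closure Ω) = Ω) (hκ : body κ ⊆ closure Ω)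
    (f : E d → ℝ) : ∫ x in Ω, (body κ).indicator f x = ∫ x in body κ, f x := by
  rw [setIntegral_indicator (measurableSet_body κ),
    setIntegral_congr_set (inter_body_ae_eq hreg hκ)]

theorem restrict_body_le (hreg : interior (closure Ω) = Ω) (hκ : body κ ⊆ closure Ω) :
    volume.restrict (body κ) ≤ volume.restrict Ω := by
  rw [← Measure.restrict_congr_set (inter_body_ae_eq hreg hκ)]
  exact Measure.restrict_mono Set.inter_subset_left le_rfl

theorem IsWeakGradient.memLp_val_body (hreg : interior (closure Ω) = Ω) (hκ : body κ ⊆ closure Ω)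
    {φ : E d → ℝ} {w : E d → E d} (hφ : IsWeakGradient Ω φ w) :
    MemLp φ 2 (volume.restrict (body κ)) :=
  hφ.1.mono_measure (restrict_body_le hreg hκ)

theorem IsWeakGradient.memLp_grad_body (hreg : interior (closure Ω) = Ω) (hκ : body κ ⊆ closure Ω)
    {φ : E d → ℝ} {w : E d → E d} (hφ : IsWeakGradient Ω φ w) :
    MemLp w 2 (volume.restrict (body κ)) :=
  hφ.2.1.mono_measure (restrict_body_le hreg hκ)

instance (κ : Finset (E d)) : IsFiniteMeasure (volume.restrict (body κ)) :=
  ⟨by simpa using (isCompact_body κ).measure_lt_top⟩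

theorem memLp_body {F : Type*} [NormedAddCommGroup F] (κ : Finset (E d)) {f : E d → F}
    (hf : Continuous f) : MemLp f 2 (volume.restrict (body κ)) := by
  obtain ⟨C, hC⟩ := (isCompact_body κ).exists_bound_of_continuousOn hf.continuousOn
  exact MemLp.of_bound hf.aestronglyMeasurable C
    ((ae_restrict_mem (measurableSet_body κ)).mono hC)

theorem integrableOn_inner_body {f g : E d → E d} (hf : MemLp f 2 (volume.restrict (body κ)))
    (hg : MemLp g 2 (volume.restrict (body κ))) :
    IntegrableOn (fun x => ⟪f x, g x⟫) (body κ) := by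
  have h := (hf.norm.integrable_mul hg.norm)
  exact h.mono (hf.1.inner hg.1) (Eventually.of_forall fun x => by
    simpa using (norm_inner_le_norm (𝕜 := ℝ) (f x) (g x)))

theorem continuousAt_indicator_of_notMem_frontier {F : Type*} [TopologicalSpace F] [Zero F]
    {S : Set (E d)} {f : E d → F} {x : E d} (hf : ContinuousAt f x) (hx : x ∉ frontier S) :
    ContinuousAt (S.indicator f) x := by
  by_cases hxS : x ∈ interior S
  · refine hf.congr ?_
    filter_upwards [isOpen_interior.mem_nhds hxS] with y hy
    rw [Set.indicator_of_mem (interior_subset hy)]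
  · have hxc : x ∈ (closure S)ᶜ := fun hc => hx ⟨hc, hxS⟩
    refine (continuousAt_const (y := (0 : F))).congr ?_
    filter_upwards [isClosed_closure.isOpen_compl.mem_nhds hxc] with y hy
    rw [Set.indicator_of_notMem fun hyS => hy (subset_closure hyS)]

theorem integral_comp_dilation (G : E d → ℝ) (m : E d) (μ : ℝ) :
    ∫ y, G (m + μ • (y - m)) = |(μ ^ d)⁻¹| * ∫ y, G y := by
  rw [integral_sub_right_eq_self (fun y => G (m + μ • y)) m,
    Measure.integral_comp_smul volume (fun y => G (m + y)) μ, integral_add_left_eq_self]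
  simp

end body

/-! ### The unit-flux field of a face, and face means of Sobolev functions. -/

/-- The vector field on two adjacent simplices with unit flux through the common face. -/
def pairField {d : ℕ} (κ κ' : Finset (E d)) (a a' : E d) (x : E d) : E d :=
  (body κ).indicator (fun x => ((d : ℝ) * vol κ)⁻¹ • (x - a)) x -
    (body κ').indicator (fun x => ((d : ℝ) * vol κ')⁻¹ • (x - a')) x

/-- The divergence of `pairField`. -/
def pairDiv {d : ℕ} (κ κ' : Finset (E d)) (x : E d) : ℝ :=
  (body κ).indicator (fun _ => ((d : ℝ) * vol κ)⁻¹ * d) x -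
    (body κ').indicator (fun _ => ((d : ℝ) * vol κ')⁻¹ * d) x

section pairField

variable {d : ℕ} {κ κ' : Finset (E d)} {a a' : E d}

theorem measurable_pairField : Measurable (pairField κ κ' a a') := by
  refine Measurable.sub ?_ ?_ <;>
  exact Measurable.indicator (by fun_prop) (measurableSet_body _)

theorem measurable_pairDiv : Measurable (pairDiv κ κ') := by
  refine Measurable.sub ?_ ?_ <;>
  exact Measurable.indicator (by fun_prop) (measurableSet_body _)

theorem exists_bound_indicator_body {F : Type*} [NormedAddCommGroup F] (κ : Finset (E d))
    {f : E d → F} (hf : Continuous f) : ∃ C, 0 ≤ C ∧ ∀ x, ‖(body κ).indicator f x‖ ≤ C := by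
  obtain ⟨C, hC⟩ := (isCompact_body κ).exists_bound_of_continuousOn hf.continuousOn
  refine ⟨max C 0, le_max_right _ _, fun x => ?_⟩
  by_cases hx : x ∈ body κ
  · rw [Set.indicator_of_mem hx]; exact (hC x hx).trans (le_max_left _ _)
  · rw [Set.indicator_of_notMem hx, norm_zero]; exact le_max_right _ _

theorem exists_bound_pairField (κ κ' : Finset (E d)) (a a' : E d) :
    ∃ C, ∀ x, ‖pairField κ κ' a a' x‖ ≤ C := by
  obtain ⟨C, -, hC⟩ := exists_bound_indicator_body κ
    (f := fun x => ((d : ℝ) * vol κ)⁻¹ • (x - a)) (by fun_prop)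
  obtain ⟨C', -, hC'⟩ := exists_bound_indicator_body κ'
    (f := fun x => ((d : ℝ) * vol κ')⁻¹ • (x - a')) (by fun_prop)
  exact ⟨C + C', fun x => (norm_sub_le _ _).trans (add_le_add (hC x) (hC' x))⟩

theorem exists_bound_pairDiv (κ κ' : Finset (E d)) : ∃ C, ∀ x, ‖pairDiv κ κ' x‖ ≤ C := by
  obtain ⟨C, -, hC⟩ := exists_bound_indicator_body κ
    (f := fun _ => ((d : ℝ) * vol κ)⁻¹ * d) continuous_const
  obtain ⟨C', -, hC'⟩ := exists_bound_indicator_body κ'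
    (f := fun _ => ((d : ℝ) * vol κ')⁻¹ * d) continuous_const
  exact ⟨C + C', fun x => (norm_sub_le _ _).trans (add_le_add (hC x) (hC' x))⟩

theorem pairField_eq_zero {x : E d} (hx : x ∉ body κ ∪ body κ') : pairField κ κ' a a' x = 0 := by
  rw [Set.mem_union, not_or] at hx
  simp [pairField, hx.1, hx.2]

/-- The field is tangential to the faces through the opposite vertices, and the two fluxes through
the common face cancel by `faceMean_congr`. No boundary term is left, although `ψ` need not vanish
on the boundary of the pair. -/
theorem Adjacent.integral_fderiv_pairField (h : Adjacent κ κ' a a') {ψ : E d → ℝ}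
    (hψ : ContDiff ℝ 1 ψ) :
    ∫ y, fderiv ℝ ψ y (pairField κ κ' a a' y) = -∫ y, ψ y * pairDiv κ κ' y := by
  have hcf : ∀ b : E d, Continuous fun y => fderiv ℝ ψ y (y - b) := fun b =>
    (hψ.continuous_fderiv one_ne_zero).clm_apply (by fun_prop)
  have e1 : ∀ y, fderiv ℝ ψ y (pairField κ κ' a a' y) =
      (body κ).indicator (fun y => ((d : ℝ) * vol κ)⁻¹ * fderiv ℝ ψ y (y - a)) y -
      (body κ').indicator (fun y => ((d : ℝ) * vol κ')⁻¹ * fderiv ℝ ψ y (y - a')) y := fun y => by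
    rw [pairField, map_sub]
    congr 1 <;> (simp only [Set.indicator_apply]; split_ifs <;> simp)
  have e2 : ∀ y, ψ y * pairDiv κ κ' y =
      (body κ).indicator (fun y => ((d : ℝ) * vol κ)⁻¹ * (d * ψ y)) y -
      (body κ').indicator (fun y => ((d : ℝ) * vol κ')⁻¹ * (d * ψ y)) y := fun y => by
    rw [pairDiv, mul_sub]
    congr 1 <;> (simp only [Set.indicator_apply]; split_ifs <;> ring)
  have hi : ∀ (κ : Finset (E d)) (c : ℝ) (g : E d → ℝ), Continuous g →
      Integrable ((body κ).indicator fun y => c * g y) := fun κ c g hg =>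
    (integrable_indicator_iff (measurableSet_body κ)).2 (integrableOn_body (hg.const_mul c))
  have hdψ : Continuous fun y => (d : ℝ) * ψ y := hψ.continuous.const_mul _
  simp only [e1, e2]
  rw [integral_sub (hi _ _ _ (hcf a)) (hi _ _ _ (hcf a')),
    integral_sub (hi _ _ _ hdψ) (hi _ _ _ hdψ)]
  simp only [integral_indicator (measurableSet_body _), integral_const_mul]
  have := h.left.faceMean_congr h.right h.mem_left h.mem_right h.erase_eq hψ hψ fun _ _ => rfl
  unfold faceMean at this
  have h2 : ∀ x v, ⟪gradient ψ x, v⟫ = fderiv ℝ ψ x v := fun x v => by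
    rw [gradient, InnerProductSpace.toDual_symm_apply]
  simp only [h2] at this
  rw [integral_add (integrableOn_body (hcf a)) (integrableOn_body hdψ),
    integral_add (integrableOn_body (hcf a')) (integrableOn_body hdψ), integral_const_mul,
    integral_const_mul] at this
  linarith

/-- A change of variables: stretching the argument of a field by `μ` multiplies its divergence by
`μ`. -/
theorem Adjacent.integral_fderiv_dilated (h : Adjacent κ κ' a a') {ψ : E d → ℝ}
    (hψ : ContDiff ℝ 1 ψ) (m : E d) {μ : ℝ} (hμ : 0 < μ) :
    ∫ y, fderiv ℝ ψ y (pairField κ κ' a a' (m + μ • (y - m))) =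
      -∫ y, ψ y * (μ * pairDiv κ κ' (m + μ • (y - m))) := by
  set B : E d → E d := fun z => m + μ⁻¹ • (z - m)
  have hBA : ∀ y, B (m + μ • (y - m)) = y := fun y => by
    simp [B, smul_smul, inv_mul_cancel₀ hμ.ne']
  have hB : ∀ z, HasFDerivAt B (μ⁻¹ • ContinuousLinearMap.id ℝ (E d)) z := fun z =>
    (((hasFDerivAt_id z).sub_const m).const_smul μ⁻¹).const_add m
  have hψB : ContDiff ℝ 1 (ψ ∘ B) := hψ.comp (by fun_prop)
  have hfd : ∀ z v, fderiv ℝ (ψ ∘ B) z v = μ⁻¹ * fderiv ℝ ψ (B z) v := fun z v => by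
    rw [((hψ.differentiable one_ne_zero (B z)).hasFDerivAt.comp z (hB z)).fderiv]
    simp
  have h1 := integral_comp_dilation (fun z => fderiv ℝ ψ (B z) (pairField κ κ' a a' z)) m μ
  have h2 := integral_comp_dilation (fun z => ψ (B z) * (μ * pairDiv κ κ' z)) m μ
  simp only [hBA] at h1 h2
  have h3 := h.integral_fderiv_pairField hψB
  simp only [hfd, Function.comp_apply, integral_const_mul] at h3
  have h4 : ∀ z, ψ (B z) * (μ * pairDiv κ κ' z) = μ * (ψ (B z) * pairDiv κ κ' z) := fun z => by
    ring
  simp only [h4, integral_const_mul] at h2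
  rw [h1, h2, ← neg_eq_iff_eq_neg.2 h3]
  field_simp

/-- The mean values over a common face of two simplices coincide for Sobolev functions. -/
theorem Adjacent.faceMean_eq (h : Adjacent κ κ' a a') (hd : 1 ≤ d) {Ω : Set (E d)}
    (hΩ : IsOpen Ω) (hreg : interior (closure Ω) = Ω) (hfin : volume Ω ≠ ⊤)
    (hκ : body κ ⊆ closure Ω) (hκ' : body κ' ⊆ closure Ω) {φ : E d → ℝ} {w : E d → E d}
    (hφ : IsWeakGradient Ω φ w) : faceMean κ a φ w = faceMean κ' a' φ w := by
  obtain ⟨C₁, hC₁⟩ := exists_bound_pairField κ κ' a a'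
  obtain ⟨C₂, hC₂⟩ := exists_bound_pairDiv κ κ'
  set m := h.center
  -- Stretching the argument by `μ k > 1` about the face barycenter contracts the support into the
  -- interior of the union of the two simplices, hence into a compact subset of `Ω`. Letting `μ k`
  -- tend to one recovers the original field.
  set μ : ℕ → ℝ := fun k => 1 + 1 / ((k : ℝ) + 1)
  have hμ1 : ∀ k, 1 < μ k := fun k => by
    have : 0 < 1 / ((k : ℝ) + 1) := by positivity
    simp only [μ]; linarith
  have hμ2 : ∀ k, μ k ≤ 2 := fun k => by
    have : 1 / ((k : ℝ) + 1) ≤ 1 := by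
      rw [div_le_one (by positivity)]
      have : (0 : ℝ) ≤ k := by positivity
      linarith
    simp only [μ]; linarith
  have hμlim : Tendsto μ atTop (𝓝 1) := by
    have := (tendsto_one_div_add_atTop_nhds_zero_nat (𝕜 := ℝ)).const_add 1
    rwa [add_zero] at this
  have hlimA : ∀ x : E d, Tendsto (fun p : ℕ × E d => m + μ p.1 • (p.2 - m)) (atTop ×ˢ 𝓝 x)
      (𝓝 x) := fun x => by
    have := ((hμlim.comp tendsto_fst).smul
      ((tendsto_snd (f := (atTop : Filter ℕ)) (g := 𝓝 x)).sub_const m)).const_add m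
    simpa using this
  have hC₂0 : 0 ≤ C₂ := (norm_nonneg _).trans (hC₂ 0)
  -- Away from this null set the field and its divergence are continuous, which gives the joint
  -- convergence required by `integral_limit`.
  have hfr : ∀ᵐ x : E d, x ∉ frontier (body κ) ∧ x ∉ frontier (body κ') := by
    have : volume (frontier (body κ) ∪ frontier (body κ')) = 0 :=
      measure_union_null (volume_frontier_body κ) (volume_frontier_body κ')
    filter_upwards [measure_eq_zero_iff_ae_notMem.1 this] with x hx
    simpa only [Set.mem_union, not_or] using hx
  have key := hφ.integral_limit hΩ hfin
    (V := fun k x => pairField κ κ' a a' (m + μ k • (x - m)))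
    (D := fun k x => μ k * pairDiv κ κ' (m + μ k • (x - m)))
    (V₀ := pairField κ κ' a a') (D₀ := pairDiv κ κ') (C := max C₁ (2 * C₂))
    (fun k => (measurable_pairField.comp (by fun_prop)).aestronglyMeasurable)
    (fun k x => (hC₁ _).trans (le_max_left _ _))
    (fun k => ((measurable_pairDiv.comp (by fun_prop)).const_mul _).aestronglyMeasurable)
    (fun k x => by
      rw [norm_mul, Real.norm_of_nonneg (zero_lt_one.trans (hμ1 k)).le]
      exact (mul_le_mul (hμ2 k) (hC₂ _) (norm_nonneg _) zero_le_two).trans (le_max_right _ _))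
    (fun k => ?_) (fun k ψ hψ _ => h.integral_fderiv_dilated hψ m (zero_lt_one.trans (hμ1 k)))
    ?_ ?_
  · have hin : ∀ (κ : Finset (E d)) (b : E d), Continuous fun x => ((d : ℝ) * vol κ)⁻¹ • (x - b) :=
      fun _ _ => by fun_prop
    have e1 : ∀ x, ⟪w x, pairField κ κ' a a' x⟫ + φ x * pairDiv κ κ' x =
        (body κ).indicator (fun x => ((d : ℝ) * vol κ)⁻¹ * (⟪w x, x - a⟫ + d * φ x)) x -
        (body κ').indicator (fun x => ((d : ℝ) * vol κ')⁻¹ * (⟪w x, x - a'⟫ + d * φ x)) x :=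
      fun x => by
        rw [pairField, pairDiv, inner_sub_right, mul_sub, sub_add_sub_comm]
        congr 1 <;> (simp only [Set.indicator_apply]; split_ifs) <;>
          simp [inner_smul_right, mul_add] <;> ring
    have hi : ∀ {κ : Finset (E d)}, body κ ⊆ closure Ω → ∀ b : E d, Integrable
        ((body κ).indicator (fun x => ((d : ℝ) * vol κ)⁻¹ * (⟪w x, x - b⟫ + d * φ x)))
        (volume.restrict Ω) := fun {κ} hκ b => by
      refine Integrable.mono_measure ?_ Measure.restrict_le_self
      rw [integrable_indicator_iff (measurableSet_body κ)]
      refine Integrable.const_mul (Integrable.add ?_ (Integrable.const_mul ?_ _)) _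
      · exact integrableOn_inner_body (hφ.memLp_grad_body hreg hκ) (memLp_body κ (by fun_prop))
      · exact (hφ.memLp_val_body hreg hκ).integrable one_le_two
    simp only [e1] at key
    rw [integral_sub (hi hκ a) (hi hκ' a'), setIntegral_indicator_body hreg hκ,
      setIntegral_indicator_body hreg hκ', integral_const_mul, integral_const_mul] at key
    exact sub_eq_zero.1 key
  · refine ⟨(fun z => m + (μ k)⁻¹ • (z - m)) '' (body κ ∪ body κ'),
      ((isCompact_body κ).union (isCompact_body κ')).image (by fun_prop), ?_, fun x hx => ?_⟩
    · have h0 : 0 ≤ (μ k)⁻¹ := inv_nonneg.2 (zero_lt_one.trans (hμ1 k)).le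
      have h1 : (μ k)⁻¹ < 1 := inv_lt_one_of_one_lt₀ (hμ1 k)
      have hsub : interior (body κ ∪ body κ') ⊆ Ω := by
        conv_rhs => rw [← hreg]
        exact interior_mono (Set.union_subset hκ hκ')
      rintro _ ⟨z, hz | hz, rfl⟩
      · exact hsub (h.dilation_mem_interior hd h0 h1 hz)
      · have := h.symm.dilation_mem_interior hd h0 h1 hz
        rw [h.center_symm, Set.union_comm] at this
        exact hsub this
    · refine pairField_eq_zero fun hmem => hx ⟨_, hmem, ?_⟩
      simp [smul_smul, inv_mul_cancel₀ (zero_lt_one.trans (hμ1 k)).ne']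
  · filter_upwards [hfr] with x hx
    have hc : ContinuousAt (pairField κ κ' a a') x :=
      (continuousAt_indicator_of_notMem_frontier (by fun_prop) hx.1).sub
        (continuousAt_indicator_of_notMem_frontier (by fun_prop) hx.2)
    exact hc.tendsto.comp (hlimA x)
  · filter_upwards [hfr] with x hx
    have hc : ContinuousAt (pairDiv κ κ') x :=
      (continuousAt_indicator_of_notMem_frontier continuousAt_const hx.1).sub
        (continuousAt_indicator_of_notMem_frontier continuousAt_const hx.2)
    have := (hμlim.comp tendsto_fst).mul (hc.tendsto.comp (hlimA x))
    rwa [one_mul] at this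

end pairField

/-! ### Simplicial complexes and Raviart--Thomas fields -/

/-- A conforming set of nondegenerate simplices. -/
structure IsComplex {d : ℕ} (T : Finset (Finset (E d))) : Prop where
  simplex : ∀ κ ∈ T, IsSimplex κ
  inter : ∀ κ ∈ T, ∀ κ' ∈ T, body κ ∩ body κ' ⊆ body (κ ∩ κ')

/-- The vertex of the simplex `κ` opposite to its face `s`. -/
def opp {d : ℕ} (κ s : Finset (E d)) : E d := ∑ a ∈ κ \ s, a

section opp

variable {d : ℕ} {κ s : Finset (E d)}

theorem opp_erase {a : E d} (ha : a ∈ κ) : opp κ (κ.erase a) = a := by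
  rw [opp, Finset.sdiff_erase_self ha, Finset.sum_singleton]

theorem IsSimplex.exists_erase (h : IsSimplex κ) (hs : s ⊆ κ) (hcard : s.card = d) :
    ∃ a ∈ κ, s = κ.erase a := by
  have h1 : (κ \ s).card = 1 := by
    rw [Finset.card_sdiff_of_subset hs, h.card, hcard]; omega
  obtain ⟨a, ha⟩ := Finset.card_eq_one.1 h1
  have haκ : a ∈ κ := (Finset.mem_sdiff.1 (ha ▸ Finset.mem_singleton_self a)).1
  refine ⟨a, haκ, ?_⟩
  rw [← Finset.sdiff_singleton_eq_erase, ← ha, Finset.sdiff_sdiff_eq_self hs]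

theorem IsSimplex.opp_mem (h : IsSimplex κ) (hs : s ⊆ κ) (hcard : s.card = d) : opp κ s ∈ κ := by
  obtain ⟨a, ha, rfl⟩ := h.exists_erase hs hcard
  rwa [opp_erase ha]

theorem IsSimplex.erase_opp (h : IsSimplex κ) (hs : s ⊆ κ) (hcard : s.card = d) :
    κ.erase (opp κ s) = s := by
  obtain ⟨a, ha, rfl⟩ := h.exists_erase hs hcard
  rw [opp_erase ha]

end opp

namespace IsComplex

variable {d : ℕ} {T : Finset (Finset (E d))}

theorem mono (h : IsComplex T) {K : Finset (Finset (E d))} (hK : K ⊆ T) : IsComplex K :=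
  ⟨fun κ hκ => h.simplex κ (hK hκ), fun κ hκ κ' hκ' => h.inter κ (hK hκ) κ' (hK hκ')⟩

theorem adjacent (h : IsComplex T) {s κ κ' : Finset (E d)} (hcard : s.card = d) (hκ : κ ∈ star T s)
    (hκ' : κ' ∈ star T s) (hne : κ ≠ κ') : Adjacent κ κ' (opp κ s) (opp κ' s) := by
  rw [star, Finset.mem_filter] at hκ hκ'
  have h1 := h.simplex κ hκ.1
  have h2 := h.simplex κ' hκ'.1
  exact ⟨h1, h2, h1.opp_mem hκ.2 hcard, h2.opp_mem hκ'.2 hcard, by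
    rw [h1.erase_opp hκ.2 hcard, h2.erase_opp hκ'.2 hcard], hne, h.inter κ hκ.1 κ' hκ'.1⟩

/-- A face is shared by at most two simplices. -/
theorem eq_of_mem_star (h : IsComplex T) (hd : 1 ≤ d) {s κ κ' κ'' : Finset (E d)}
    (hcard : s.card = d) (hκ : κ ∈ star T s) (hκ' : κ' ∈ star T s) (hκ'' : κ'' ∈ star T s)
    (hne : κ ≠ κ') (hne' : κ ≠ κ'') : κ' = κ'' := by
  by_contra hne''
  exact (h.adjacent hcard hκ hκ' hne).not_adjacent hd (h.adjacent hcard hκ hκ'' hne')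
    (h.adjacent hcard hκ' hκ'' hne'')

theorem star_eq_pair (h : IsComplex T) (hd : 1 ≤ d) {s κ κ' : Finset (E d)}
    (hcard : s.card = d) (hκ : κ ∈ star T s) (hκ' : κ' ∈ star T s) (hne : κ ≠ κ') :
    star T s = {κ, κ'} := by
  ext κ''
  simp only [Finset.mem_insert, Finset.mem_singleton]
  constructor
  · intro h''
    by_contra! hcon
    exact hcon.2 (h.eq_of_mem_star hd hcard hκ hκ' h'' hne hcon.1.symm).symm
  · rintro (rfl | rfl) <;> assumption

/-- By conformity a common point lies on a proper face of `κ`, where some barycentric coordinate of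
`κ` vanishes; in the interior all of them are positive. -/
theorem aedisjoint (h : IsComplex T) {κ κ' : Finset (E d)} (hκ : κ ∈ T) (hκ' : κ' ∈ T)
    (hne : κ ≠ κ') : Disjoint (interior (body κ)) (body κ') := by
  rw [Set.disjoint_left]
  intro x hx hx'
  have h1 := h.simplex κ hκ
  obtain ⟨a, ha, ha'⟩ : ∃ a ∈ κ, a ∉ κ' := by
    by_contra! hcon
    refine hne (Finset.eq_of_subset_of_card_le hcon ?_)
    rw [h1.card, (h.simplex κ' hκ').card]
  have hmem := h.inter κ hκ κ' hκ' ⟨interior_subset hx, hx'⟩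
  have hsub : κ ∩ κ' ⊆ κ.erase a := fun b hb => by
    rw [Finset.mem_inter] at hb
    exact Finset.mem_erase.2 ⟨by rintro rfl; exact ha' hb.2, hb.1⟩
  have := bary_eq_zero_of_mem_face h1 (body_mono hsub hmem)
  rw [h1.interior_body_eq] at hx
  exact (hx a ha).ne' this

theorem cellSet_ae_eq (T : Finset (Finset (E d))) :
    (⋃ κ ∈ T, interior (body κ)) =ᵐ[volume] cellSet T := by
  exact Filter.EventuallyEq.countable_bUnion (S := (T : Set (Finset (E d)))) T.countable_toSet
    fun κ _ => interior_body_ae_eq κ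

theorem setIntegral_cellSet (h : IsComplex T) {f : E d → ℝ}
    (hf : ∀ κ ∈ T, IntegrableOn f (body κ)) :
    ∫ x in cellSet T, f x = ∑ κ ∈ T, ∫ x in body κ, f x := by
  rw [← setIntegral_congr_set (cellSet_ae_eq T), integral_biUnion_finset T
    (fun κ _ => isOpen_interior.measurableSet) (fun κ hκ κ' hκ' hne => ?_)
    (fun κ hκ => (hf κ hκ).mono_set interior_subset)]
  · exact Finset.sum_congr rfl fun κ _ => setIntegral_interior_body κ f
  · exact (h.aedisjoint hκ hκ' hne).mono_right interior_subset

theorem cellVol_eq (h : IsComplex T) : cellVol T = ∑ κ ∈ T, vol κ := by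
  have := h.setIntegral_cellSet (f := fun _ => 1) fun κ _ => integrableOn_body continuous_const
  simpa [setIntegral_const_body, cellVol, vol] using this

theorem isCompact_cellSet (T : Finset (Finset (E d))) : IsCompact (cellSet T) :=
  T.isCompact_biUnion fun κ _ => isCompact_body κ

theorem cellVol_pos (h : IsComplex T) (hne : T.Nonempty) : 0 < cellVol T := by
  rw [h.cellVol_eq]
  exact Finset.sum_pos (fun κ hκ => (h.simplex κ hκ).vol_pos) hne

theorem cellDiam_pos (h : IsComplex T) (hd : 1 ≤ d) (hne : T.Nonempty) : 0 < cellDiam T := by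
  obtain ⟨κ, hκ⟩ := hne
  have h1 := h.simplex κ hκ
  obtain ⟨a, ha, b, hb, hab⟩ := Finset.one_lt_card.1 (by rw [h1.card]; omega : 1 < κ.card)
  have hmem : ∀ c ∈ κ, c ∈ cellSet T := fun c hc =>
    Set.mem_biUnion hκ (subset_body κ hc)
  exact (dist_pos.2 hab).trans_le (Metric.dist_le_diam_of_mem (isCompact_cellSet T).isBounded
    (hmem a ha) (hmem b hb))

theorem card_of_mem_subfaces {s : Finset (E d)} (hs : s ∈ subfaces T) : s.card = d := by
  rw [subfaces, Finset.mem_biUnion] at hs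
  obtain ⟨κ, -, hκ⟩ := hs
  exact (Finset.mem_powersetCard.1 hκ).2

theorem star_nonempty_of_mem_subfaces {s : Finset (E d)} (hs : s ∈ subfaces T) :
    (star T s).Nonempty := by
  rw [subfaces, Finset.mem_biUnion] at hs
  obtain ⟨κ, hκ, hs⟩ := hs
  exact ⟨κ, Finset.mem_filter.2 ⟨hκ, (Finset.mem_powersetCard.1 hs).1⟩⟩

theorem erase_mem_subfaces (h : IsComplex T) {κ : Finset (E d)} (hκ : κ ∈ T) {a : E d}
    (ha : a ∈ κ) : κ.erase a ∈ subfaces T := by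
  rw [subfaces, Finset.mem_biUnion]
  exact ⟨κ, hκ, Finset.mem_powersetCard.2
    ⟨Finset.erase_subset _ _, (h.simplex κ hκ).erase_card ha⟩⟩

/-- The faces contained in a simplex are opposite to its vertices. -/
theorem sum_subfaces (h : IsComplex T) {κ : Finset (E d)} (hκ : κ ∈ T) {F : Type*}
    [AddCommMonoid F] (f : Finset (E d) → F) :
    ∑ s ∈ (subfaces T).filter (· ⊆ κ), f s = ∑ a ∈ κ, f (κ.erase a) := by
  symm
  refine Finset.sum_bij (fun a _ => κ.erase a) (fun a ha => ?_) (fun a ha b hb hab => ?_)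
    (fun s hs => ?_) fun _ _ => rfl
  · exact Finset.mem_filter.2 ⟨h.erase_mem_subfaces hκ ha, Finset.erase_subset _ _⟩
  · rw [← opp_erase ha, hab, opp_erase hb]
  · rw [Finset.mem_filter] at hs
    obtain ⟨a, ha, rfl⟩ := (h.simplex κ hκ).exists_erase hs.2 (card_of_mem_subfaces hs.1)
    exact ⟨a, ha, rfl⟩

/-- Double counting of pairs of a simplex and one of its faces; sums of fluxes cancel when they are
arranged by faces. -/
theorem sum_sum_subfaces (h : IsComplex T) {F : Type*}
    [AddCommMonoid F] (f : Finset (E d) → Finset (E d) → F) :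
    ∑ κ ∈ T, ∑ a ∈ κ, f (κ.erase a) κ = ∑ s ∈ subfaces T, ∑ κ ∈ star T s, f s κ := by
  rw [Finset.sum_congr rfl fun κ hκ => (h.sum_subfaces hκ fun s => f s κ).symm]
  simp only [Finset.sum_filter, star]
  exact Finset.sum_comm

theorem mem_extFaces_iff {s : Finset (E d)} :
    s ∈ extFaces T ↔ s ∈ subfaces T ∧ (star T s).card = 1 := Finset.mem_filter

theorem mem_intFaces_iff {s : Finset (E d)} :
    s ∈ intFaces T ↔ s ∈ subfaces T ∧ (star T s).card ≠ 1 := Finset.mem_filter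

theorem rtSign_of_mem_extFaces {s κ : Finset (E d)} (hs : s ∈ extFaces T) (hκ : κ ∈ star T s) :
    rtSign T s κ = 1 := by
  have hne : (star T s).Nonempty := ⟨κ, hκ⟩
  rw [rtSign, dif_pos hne, if_pos]
  exact Finset.card_le_one.1 (mem_extFaces_iff.1 hs).2.le _ hκ _ hne.choose_spec

theorem rtSign_mul_self {s κ : Finset (E d)} (hκ : κ ∈ star T s) :
    rtSign T s κ * rtSign T s κ = 1 := by
  have hne : (star T s).Nonempty := ⟨κ, hκ⟩
  rw [rtSign, dif_pos hne]
  split_ifs <;> norm_num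

/-- Exactly one of the two simplices is the chosen one that orients the face. -/
theorem rtSign_add (h : IsComplex T) (hd : 1 ≤ d) {s κ κ' : Finset (E d)}
    (hcard : s.card = d) (hκ : κ ∈ star T s) (hκ' : κ' ∈ star T s) (hne : κ ≠ κ') :
    rtSign T s κ + rtSign T s κ' = 0 := by
  have hn : (star T s).Nonempty := ⟨κ, hκ⟩
  have hc := hn.choose_spec
  rw [rtSign, rtSign, dif_pos hn, dif_pos hn]
  by_cases h1 : κ = hn.choose
  · rw [if_pos h1, if_neg fun h2 => hne (h1.trans h2.symm)]; norm_num
  · rw [if_neg h1, if_pos (h.eq_of_mem_star hd hcard hκ hκ' hc hne h1)]; norm_num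

end IsComplex

theorem continuous_act {d : ℕ} (A : Matrix (Fin d) (Fin d) ℝ) : Continuous (act A) :=
  (Matrix.toEuclideanCLM (n := Fin d) (𝕜 := ℝ) A).continuous

/-- `A` acting on vectors, as a linear map. -/
def actLin {d : ℕ} (A : Matrix (Fin d) (Fin d) ℝ) : E d →ₗ[ℝ] E d :=
  (Matrix.toEuclideanCLM (n := Fin d) (𝕜 := ℝ) A : E d →ₗ[ℝ] E d)

theorem actLin_apply {d : ℕ} (A : Matrix (Fin d) (Fin d) ℝ) (v : E d) : actLin A v = act A v := rfl

/-! ### Fluxes of Raviart-Thomas fields on one simplex. -/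

section rt

variable {d : ℕ} (K : Finset (Finset (E d)))

/-- The outward flux of the field with the face normal fluxes `w` through the face of the simplex
`κ` opposite to the vertex `a`. -/
def rtCoef (w : Finset (E d) → ℝ) (κ : Finset (E d)) (a : E d) : ℝ :=
  rtSign K (κ.erase a) κ * w (κ.erase a)

/-- The field on the simplex `κ` with the outward fluxes `c a`, as an affine map. -/
def fluxField (κ : Finset (E d)) (c : E d → ℝ) (x : E d) : E d :=
  ∑ a ∈ κ, (c a * ((d : ℝ) * vol κ)⁻¹) • (x - a)

theorem continuous_fluxField (κ : Finset (E d)) (c : E d → ℝ) : Continuous (fluxField κ c) := by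
  unfold fluxField
  fun_prop

variable {K}

/-- Only the faces of `κ` contribute. Indexing them by opposite vertices and absorbing the
orientation into the coefficient gives outward fluxes. -/
theorem rtLocal_eq (h : IsComplex K) {κ : Finset (E d)} (hκ : κ ∈ K) (w : Finset (E d) → ℝ)
    (x : E d) : rtLocal K w κ x = fluxField κ (rtCoef K w κ) x := by
  have h1 : rtLocal K w κ x = ∑ s ∈ (subfaces K).filter (· ⊆ κ),
      (w s * (rtSign K s κ * ((d : ℝ) * vol κ)⁻¹)) • (x - opp κ s) := by
    rw [rtLocal, Finset.sum_filter]
    refine Finset.sum_congr rfl fun s _ => ?_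
    rw [rtBasis]
    split_ifs
    · rw [smul_smul]; rfl
    · rw [smul_zero]
  rw [h1, h.sum_subfaces hκ, fluxField]
  refine Finset.sum_congr rfl fun a ha => ?_
  rw [opp_erase ha, rtCoef]
  congr 1
  ring

theorem divergence_smul_sub (c : ℝ) (a x : E d) :
    divergence (fun x : E d => c • (x - a)) x = c * d := by
  have h1 : HasFDerivAt (fun x : E d => c • (x - a)) (c • ContinuousLinearMap.id ℝ (E d)) x :=
    ((hasFDerivAt_id x).sub_const a).const_smul c
  rw [divergence, h1.fderiv]
  simp

theorem divergence_sum {ι : Type*} (s : Finset ι) (f : ι → E d → E d)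
    (hf : ∀ i ∈ s, Differentiable ℝ (f i)) (x : E d) :
    divergence (fun x => ∑ i ∈ s, f i x) x = ∑ i ∈ s, divergence (f i) x := by
  simp only [divergence]
  rw [fderiv_fun_sum fun i hi => hf i hi x]
  simp [map_sum]

theorem divergence_fluxField (hd : 1 ≤ d) (κ : Finset (E d)) (c : E d → ℝ) (x : E d) :
    divergence (fluxField κ c) x = (vol κ)⁻¹ * ∑ a ∈ κ, c a := by
  have : fluxField κ c = fun x => ∑ a ∈ κ, (c a * ((d : ℝ) * vol κ)⁻¹) • (x - a) := rfl
  rw [this, divergence_sum _ _ fun a _ => by fun_prop]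
  simp only [divergence_smul_sub]
  rw [Finset.mul_sum]
  refine Finset.sum_congr rfl fun a _ => ?_
  have : (d : ℝ) ≠ 0 := by positivity
  rw [mul_inv]
  field_simp

theorem divergence_rtLocal (h : IsComplex K) (hd : 1 ≤ d) {κ : Finset (E d)} (hκ : κ ∈ K)
    (w : Finset (E d) → ℝ) (x : E d) :
    divergence (rtLocal K w κ) x = (vol κ)⁻¹ * ∑ a ∈ κ, rtCoef K w κ a := by
  rw [← divergence_fluxField hd κ _ x]
  congr 1
  ext1 y
  exact rtLocal_eq h hκ w y

theorem rtField_eq (h : IsComplex K) {κ : Finset (E d)} (hκ : κ ∈ K) (w : Finset (E d) → ℝ)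
    {x : E d} (hx : x ∈ interior (body κ)) : rtField K w x = fluxField κ (rtCoef K w κ) x := by
  rw [rtField, Finset.sum_eq_single κ, Set.indicator_of_mem hx, rtLocal_eq h hκ]
  · intro κ' hκ' hne
    exact Set.indicator_of_notMem (fun hx' => Set.disjoint_left.1
      (h.aedisjoint hκ hκ' hne.symm) hx (interior_subset hx')) _
  · exact fun hn => absurd hκ hn

theorem rtField_ae_eq (h : IsComplex K) {κ : Finset (E d)} (hκ : κ ∈ K) (w : Finset (E d) → ℝ) :
    rtField K w =ᵐ[volume.restrict (body κ)] fluxField κ (rtCoef K w κ) := by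
  rw [← Measure.restrict_congr_set (interior_body_ae_eq κ)]
  exact (ae_restrict_mem isOpen_interior.measurableSet).mono fun x hx => rtField_eq h hκ w hx

/-- Green's formula on a simplex. -/
theorem setIntegral_inner_fluxField {κ : Finset (E d)} (hd : 1 ≤ d) (c : E d → ℝ)
    {φ : E d → ℝ} {g : E d → E d} (hφ : IntegrableOn φ (body κ))
    (hg : MemLp g 2 (volume.restrict (body κ))) :
    ∫ x in body κ, ⟪g x, fluxField κ c x⟫ =
      ∑ a ∈ κ, c a * faceMean κ a φ g - (vol κ)⁻¹ * (∑ a ∈ κ, c a) * ∫ x in body κ, φ x := by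
  have hi : ∀ a, IntegrableOn (fun x => ⟪g x, x - a⟫) (body κ) := fun a =>
    integrableOn_inner_body hg (memLp_body κ (by fun_prop))
  have h1 : ∀ x, ⟪g x, fluxField κ c x⟫ =
      ∑ a ∈ κ, (c a * ((d : ℝ) * vol κ)⁻¹) * ⟪g x, x - a⟫ := fun x => by
    rw [fluxField, inner_sum]
    simp only [inner_smul_right]
  simp only [h1]
  rw [integral_finsetSum _ fun a _ => (hi a).const_mul _, Finset.mul_sum, Finset.sum_mul,
    ← Finset.sum_sub_distrib]
  refine Finset.sum_congr rfl fun a _ => ?_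
  rw [faceMean, integral_add (hi a) (hφ.const_mul _), integral_const_mul, integral_const_mul]
  have : (d : ℝ) ≠ 0 := by positivity
  rw [mul_inv]
  field_simp
  ring

/-- A field with vanishing values has vanishing fluxes. -/
theorem IsSimplex.eq_zero_of_fluxField {κ : Finset (E d)} (h : IsSimplex κ) (hd : 1 ≤ d)
    {c : E d → ℝ} (h0 : ∀ x ∈ interior (body κ), fluxField κ c x = 0) {b : E d} (hb : b ∈ κ) :
    c b = 0 := by
  have hcl : ∀ x ∈ body κ, fluxField κ c x = 0 := by
    have h1 := (convex_body κ).closure_interior_eq_closure_of_nonempty_interior h.interior_nonempty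
    have h2 : closure (interior (body κ)) ⊆ {x | fluxField κ c x = 0} :=
      closure_minimal h0 (isClosed_eq (continuous_fluxField κ c) continuous_const)
    rw [h1, (isClosed_body κ).closure_eq] at h2
    exact h2
  set c' : E d → ℝ := fun a => c a * ((d : ℝ) * vol κ)⁻¹
  -- By continuity the field also vanishes at the vertices. Comparing two of them kills the
  -- coefficient of `x`, and the barycentric coordinate at `b` then isolates the flux at `b`.
  have hF : ∀ x ∈ κ, (∑ a ∈ κ, c' a) • x = ∑ a ∈ κ, c' a • a := fun x hx => by
    have := hcl x (subset_body κ hx)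
    simp only [fluxField, smul_sub, Finset.sum_sub_distrib] at this
    rw [← Finset.sum_smul] at this
    exact sub_eq_zero.1 this
  obtain ⟨p, hp, q, hq, hpq⟩ := Finset.one_lt_card.1 (by rw [h.card]; omega : 1 < κ.card)
  have hs : ∑ a ∈ κ, c' a = 0 := by
    have : (∑ a ∈ κ, c' a) • (p - q) = 0 := by
      rw [smul_sub, hF p hp, hF q hq, sub_self]
    exact (smul_eq_zero.1 this).resolve_right (sub_ne_zero.2 hpq)
  have hv : ∑ a ∈ κ, c' a • a = 0 := by rw [← hF p hp, hs, zero_smul]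
  have hdec : ∀ x, bary κ b x = (bary κ b).linear x + bary κ b 0 :=
    fun x => congrFun (AffineMap.decomp (bary κ b)) x
  have hcb : ∑ a ∈ κ, c' a * bary κ b a = 0 := by
    rw [Finset.sum_congr rfl fun a _ => by rw [hdec a, mul_add], Finset.sum_add_distrib,
      ← Finset.sum_mul, hs, zero_mul, add_zero]
    have := congrArg (bary κ b).linear hv
    simpa [map_sum] using this
  rw [Finset.sum_eq_single b, h.bary_self hb, mul_one] at hcb
  · have hne : ((d : ℝ) * vol κ)⁻¹ ≠ 0 := inv_ne_zero (mul_ne_zero (by positivity) h.vol_pos.ne')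
    exact (mul_eq_zero.1 hcb).resolve_right hne
  · exact fun a ha hab => by rw [h.bary_of_ne ha hab, mul_zero]
  · exact fun hn => absurd hb hn

end rt

/-! ### The element matrix of the mixed finite element method -/

/-! ### Saddle-point systems and their Schur complement. -/

section saddle

open Matrix

variable {e i m : Type*} [Fintype e] [Fintype i] [Fintype m] [DecidableEq i] [DecidableEq m]
  (Aee : Matrix e e ℝ) (Aie : Matrix i e ℝ) (Aii : Matrix i i ℝ) (Be : Matrix m e ℝ)
  (Bi : Matrix m i ℝ)

/-- For a kernel vector, testing the first row with its first part kills that part by positivity,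
because the second row removes the multiplier term. Injectivity of `Biᵀ` then kills the multiplier.
-/
theorem isUnit_det_saddle (hpos : ∀ v, v ≠ 0 → 0 < v ⬝ᵥ Aii *ᵥ v)
    (hB : ∀ y, Biᵀ *ᵥ y = 0 → y = 0) : IsUnit (fromBlocks Aii Biᵀ Bi 0).det := by
  rw [isUnit_iff_ne_zero]
  intro h0
  obtain ⟨v, hv, hMv⟩ := exists_mulVec_eq_zero_iff.2 h0
  rw [fromBlocks_mulVec] at hMv
  set w := v ∘ Sum.inl
  set y := v ∘ Sum.inr
  have h1 : Aii *ᵥ w + Biᵀ *ᵥ y = 0 := by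
    ext k; exact congrFun hMv (Sum.inl k)
  have h2 : Bi *ᵥ w = 0 := by
    ext k; simpa using congrFun hMv (Sum.inr k)
  have hw : w = 0 := by
    by_contra hw
    have h3 := congrArg (w ⬝ᵥ ·) h1
    simp only [dotProduct_add, dotProduct_zero] at h3
    rw [dotProduct_mulVec w Biᵀ, vecMul_transpose, h2, zero_dotProduct, add_zero] at h3
    exact (hpos w hw).ne' h3
  rw [hw, mulVec_zero, zero_add] at h1
  have hy := hB y h1
  refine hv (funext fun k => ?_)
  rcases k with k | k
  · exact congrFun hw k
  · exact congrFun hy k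

/-- The solution of the local mixed finite element problem with the boundary fluxes `u`. -/
def saddleSol (u : e → ℝ) : i ⊕ m → ℝ :=
  -((fromBlocks Aii Biᵀ Bi 0)⁻¹ *ᵥ (fromRows Aie Be *ᵥ u))

variable {Aie Aii Be Bi}

theorem saddleSol_spec (hS : IsUnit (fromBlocks Aii Biᵀ Bi 0).det) (u : e → ℝ) :
    Aii *ᵥ (saddleSol Aie Aii Be Bi u ∘ Sum.inl) + Biᵀ *ᵥ (saddleSol Aie Aii Be Bi u ∘ Sum.inr) =
      -(Aie *ᵥ u) ∧ Bi *ᵥ (saddleSol Aie Aii Be Bi u ∘ Sum.inl) = -(Be *ᵥ u) := by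
  have h : fromBlocks Aii Biᵀ Bi 0 *ᵥ saddleSol Aie Aii Be Bi u = -(fromRows Aie Be *ᵥ u) := by
    rw [saddleSol, mulVec_neg, mulVec_mulVec, mul_nonsing_inv _ hS, one_mulVec]
  rw [fromBlocks_mulVec, fromRows_mulVec] at h
  constructor
  · ext k; exact congrFun h (Sum.inl k)
  · ext k; simpa using congrFun h (Sum.inr k)

/-- Testing the first row with the solution and using the constraint replaces the quadratic interior
term. What remains is `u ⬝ᵥ Aee *ᵥ u` plus the data tested with the solution, which is the Schur
complement form. -/
theorem saddle_energy (hS : IsUnit (fromBlocks Aii Biᵀ Bi 0).det) (u : e → ℝ) :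
    u ⬝ᵥ Aee *ᵥ u + 2 * ((saddleSol Aie Aii Be Bi u ∘ Sum.inl) ⬝ᵥ Aie *ᵥ u) +
      (saddleSol Aie Aii Be Bi u ∘ Sum.inl) ⬝ᵥ Aii *ᵥ (saddleSol Aie Aii Be Bi u ∘ Sum.inl) =
    u ⬝ᵥ (Aee - (fromRows Aie Be)ᵀ * (fromBlocks Aii Biᵀ Bi 0)⁻¹ * fromRows Aie Be) *ᵥ u := by
  obtain ⟨h1, h2⟩ := saddleSol_spec (Aie := Aie) (Be := Be) hS u
  have h3 : u ⬝ᵥ ((fromRows Aie Be)ᵀ * (fromBlocks Aii Biᵀ Bi 0)⁻¹ * fromRows Aie Be) *ᵥ u =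
      -((fromRows Aie Be *ᵥ u) ⬝ᵥ saddleSol Aie Aii Be Bi u) := by
    rw [saddleSol, dotProduct_neg, neg_neg, ← mulVec_mulVec, ← mulVec_mulVec,
      dotProduct_mulVec u, vecMul_transpose]
  set w := saddleSol Aie Aii Be Bi u ∘ Sum.inl with hw
  set y := saddleSol Aie Aii Be Bi u ∘ Sum.inr with hy
  have h4 : saddleSol Aie Aii Be Bi u = Sum.elim w y := by
    rw [hw, hy, Sum.elim_comp_inl_inr]
  rw [h4, fromRows_mulVec, sumElim_dotProduct_sumElim] at h3
  have h5 := congrArg (w ⬝ᵥ ·) h1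
  simp only [dotProduct_add, dotProduct_neg] at h5
  rw [dotProduct_mulVec w Biᵀ, vecMul_transpose, h2, neg_dotProduct] at h5
  rw [sub_mulVec, dotProduct_sub, h3, dotProduct_comm (Aie *ᵥ u) w]
  linarith

/-- Pythagoras: a competitor with the same constraint differs from the solution by a vector in the
kernel of `Bi`, and the first row makes the mixed term vanish. The solution is hence the minimizer
when `Aii` is positive. -/
theorem saddle_energy_add (hsymm : Aiiᵀ = Aii) (hS : IsUnit (fromBlocks Aii Biᵀ Bi 0).det)
    (u : e → ℝ) (v : i → ℝ) (hv : Bi *ᵥ v = -(Be *ᵥ u)) :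
    u ⬝ᵥ Aee *ᵥ u + 2 * (v ⬝ᵥ Aie *ᵥ u) + v ⬝ᵥ Aii *ᵥ v =
    u ⬝ᵥ Aee *ᵥ u + 2 * ((saddleSol Aie Aii Be Bi u ∘ Sum.inl) ⬝ᵥ Aie *ᵥ u) +
      (saddleSol Aie Aii Be Bi u ∘ Sum.inl) ⬝ᵥ Aii *ᵥ (saddleSol Aie Aii Be Bi u ∘ Sum.inl) +
      (v - saddleSol Aie Aii Be Bi u ∘ Sum.inl) ⬝ᵥ
        Aii *ᵥ (v - saddleSol Aie Aii Be Bi u ∘ Sum.inl) := by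
  obtain ⟨h1, h2⟩ := saddleSol_spec (Aie := Aie) (Be := Be) hS u
  set w := saddleSol Aie Aii Be Bi u ∘ Sum.inl with hw
  set y := saddleSol Aie Aii Be Bi u ∘ Sum.inr with hy
  obtain ⟨δ, rfl⟩ : ∃ δ, v = w + δ := ⟨v - w, by abel⟩
  have hδ : Bi *ᵥ δ = 0 := by
    rw [mulVec_add, h2] at hv
    simpa using hv
  have h5 := congrArg (δ ⬝ᵥ ·) h1
  simp only [dotProduct_add, dotProduct_neg] at h5
  rw [dotProduct_mulVec δ Biᵀ, vecMul_transpose, hδ, zero_dotProduct, add_zero] at h5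
  have h6 : w ⬝ᵥ Aii *ᵥ δ = δ ⬝ᵥ Aii *ᵥ w := by
    rw [dotProduct_mulVec, ← mulVec_transpose, hsymm, dotProduct_comm]
  rw [add_sub_cancel_left, mulVec_add, add_dotProduct, add_dotProduct, dotProduct_add,
    dotProduct_add, h6]
  linarith

end saddle

section quadratic

variable {d : ℕ} {A : Matrix (Fin d) (Fin d) ℝ}

theorem inner_act (A : Matrix (Fin d) (Fin d) ℝ) (x y : E d) :
    ⟪act A x, y⟫ = y.ofLp ⬝ᵥ A *ᵥ x.ofLp := by
  simp [act, PiLp.inner_apply, dotProduct, Matrix.ofLp_toEuclideanCLM]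

theorem inner_act_comm (hA : A.PosDef) (x y : E d) : ⟪act A x, y⟫ = ⟪x, act A y⟫ := by
  have hs : Aᵀ = A := by
    have := hA.isHermitian
    simpa [Matrix.IsHermitian, Matrix.conjTranspose_eq_transpose_of_trivial] using this
  rw [inner_act, real_inner_comm, inner_act, Matrix.dotProduct_mulVec, ← Matrix.mulVec_transpose,
    hs, dotProduct_comm]

theorem normSq_pos (hA : A.PosDef) {x : E d} (hx : x ≠ 0) : 0 < normSq A x := by
  rw [normSq, inner_act]
  have := hA.dotProduct_mulVec_pos (x := x.ofLp) (by simpa using hx)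
  simpa using this

theorem normSq_zero (A : Matrix (Fin d) (Fin d) ℝ) : normSq A 0 = 0 := by
  rw [normSq, inner_zero_right]

theorem normSq_nonneg (hA : A.PosDef) (x : E d) : 0 ≤ normSq A x := by
  rcases eq_or_ne x 0 with rfl | hx
  · rw [normSq_zero]
  · exact (normSq_pos hA hx).le

theorem continuous_normSq (A : Matrix (Fin d) (Fin d) ℝ) : Continuous (normSq A) := by
  unfold normSq
  exact (continuous_act A).inner continuous_id

theorem act_inv_act (hA : A.PosDef) (x : E d) : act A⁻¹ (act A x) = x := by
  have h : IsUnit A.det := (Matrix.isUnit_iff_isUnit_det A).1 hA.isUnit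
  change (Matrix.toEuclideanCLM (n := Fin d) (𝕜 := ℝ) A⁻¹ *
    Matrix.toEuclideanCLM (n := Fin d) (𝕜 := ℝ) A) x = x
  rw [← map_mul, Matrix.nonsing_inv_mul _ h, map_one]
  rfl

end quadratic

/-! ### Energies and liftings on a polytope -/

/-- A polytope represented by a conforming face-connected set of simplices. -/
structure IsCell {d : ℕ} (K : Finset (Finset (E d))) : Prop extends IsComplex K where
  nonempty : K.Nonempty
  connected : ∀ κ ∈ K, ∀ κ' ∈ K,
    Relation.ReflTransGen (fun a b => a ∈ K ∧ b ∈ K ∧ (a ∩ b).card = d) κ κ'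

section lift

open Matrix

variable {d : ℕ} {K : Finset (Finset (E d))} {A : Matrix (Fin d) (Fin d) ℝ}

theorem sum_subfaces_eq (g : Finset (E d) → ℝ) :
    ∑ s ∈ subfaces K, g s = ∑ s : extFaces K, g s.1 + ∑ s : intFaces K, g s.1 := by
  rw [← Finset.sum_filter_add_sum_filter_not (subfaces K) (fun s => (star K s).card = 1),
    Finset.sum_coe_sort (extFaces K), Finset.sum_coe_sort (intFaces K)]
  rfl

theorem continuous_rtBasis (K : Finset (Finset (E d))) (s κ : Finset (E d)) :
    Continuous (rtBasis K s κ) := by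
  unfold rtBasis
  split_ifs <;> fun_prop

theorem continuous_rtLocal (K : Finset (Finset (E d))) (w : Finset (E d) → ℝ) (κ : Finset (E d)) :
    Continuous (rtLocal K w κ) := by
  unfold rtLocal
  exact continuous_finsetSum _ fun s _ => (continuous_rtBasis K s κ).const_smul (w s)

theorem rtGram_comm (hA : A.PosDef) (s s' : Finset (E d)) : rtGram K A s s' = rtGram K A s' s := by
  unfold rtGram
  refine Finset.sum_congr rfl fun κ _ => ?_
  congr 1
  ext1 x
  rw [inner_act_comm hA.inv, real_inner_comm]

theorem rtLocal_ae_eq (h : IsComplex K) {κ : Finset (E d)} (hκ : κ ∈ K) (w : Finset (E d) → ℝ) :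
    rtField K w =ᵐ[volume.restrict (body κ)] rtLocal K w κ := by
  filter_upwards [rtField_ae_eq h hκ w] with x hx
  rw [hx, rtLocal_eq h hκ]

theorem rtEnergy_eq_sum (h : IsComplex K) (A : Matrix (Fin d) (Fin d) ℝ) (w : Finset (E d) → ℝ) :
    rtEnergy K A w = ∑ κ ∈ K, ∫ x in body κ, normSq A⁻¹ (rtLocal K w κ x) := by
  have hae : ∀ κ ∈ K, (fun x => normSq A⁻¹ (rtField K w x)) =ᵐ[volume.restrict (body κ)]
      fun x => normSq A⁻¹ (rtLocal K w κ x) := fun κ hκ =>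
    (rtLocal_ae_eq h hκ w).mono fun x hx => by simp only [hx]
  have hc : ∀ κ, Continuous fun x => normSq A⁻¹ (rtLocal K w κ x) := fun κ =>
    (continuous_normSq _).comp (continuous_rtLocal K w κ)
  rw [rtEnergy, h.setIntegral_cellSet fun κ hκ =>
    (integrableOn_body (hc κ)).congr (hae κ hκ).symm]
  exact Finset.sum_congr rfl fun κ hκ => integral_congr_ae (hae κ hκ)

theorem rtEnergy_eq_gram (h : IsComplex K) (A : Matrix (Fin d) (Fin d) ℝ) (w : Finset (E d) → ℝ) :
    rtEnergy K A w = ∑ s ∈ subfaces K, ∑ s' ∈ subfaces K, w s * w s' * rtGram K A s s' := by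
  have hi : ∀ s s' κ, IntegrableOn
      (fun x => ⟪act A⁻¹ (rtBasis K s' κ x), rtBasis K s κ x⟫) (body κ) := fun s s' κ =>
    integrableOn_body (((continuous_act _).comp (continuous_rtBasis K s' κ)).inner
      (continuous_rtBasis K s κ))
  have e : ∀ κ x, normSq A⁻¹ (rtLocal K w κ x) = ∑ s ∈ subfaces K, ∑ s' ∈ subfaces K,
      w s * w s' * ⟪act A⁻¹ (rtBasis K s' κ x), rtBasis K s κ x⟫ := fun κ x => by
    rw [normSq, rtLocal, ← actLin_apply, map_sum, inner_sum]
    refine Finset.sum_congr rfl fun s _ => ?_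
    rw [sum_inner]
    refine Finset.sum_congr rfl fun s' _ => ?_
    rw [map_smul, inner_smul_left, inner_smul_right, actLin_apply]
    simp only [conj_trivial]
    ring
  rw [rtEnergy_eq_sum h]
  simp only [e, rtGram, Finset.mul_sum]
  rw [Finset.sum_congr rfl fun κ _ => integral_finsetSum _ fun s _ =>
    integrable_finsetSum _ fun s' _ => (hi s s' κ).const_mul _, Finset.sum_comm]
  refine Finset.sum_congr rfl fun s _ => ?_
  rw [Finset.sum_congr rfl fun κ _ => integral_finsetSum _ fun s' _ => (hi s s' κ).const_mul _,
    Finset.sum_comm]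
  refine Finset.sum_congr rfl fun s' _ => Finset.sum_congr rfl fun κ _ => ?_
  rw [integral_const_mul]

/-- The blocks of the local mixed finite element matrix. -/
def gramEE (K : Finset (Finset (E d))) (A : Matrix (Fin d) (Fin d) ℝ) :
    Matrix (extFaces K) (extFaces K) ℝ := Matrix.of fun s s' => rtGram K A s.1 s'.1

def gramIE (K : Finset (Finset (E d))) (A : Matrix (Fin d) (Fin d) ℝ) :
    Matrix (intFaces K) (extFaces K) ℝ := Matrix.of fun s s' => rtGram K A s.1 s'.1

def gramII (K : Finset (Finset (E d))) (A : Matrix (Fin d) (Fin d) ℝ) :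
    Matrix (intFaces K) (intFaces K) ℝ := Matrix.of fun s s' => rtGram K A s.1 s'.1

def divE (K : Finset (Finset (E d))) :
    Matrix (Fin (Module.finrank ℝ (meanZero K))) (extFaces K) ℝ :=
  Matrix.of fun i s => rtDiv K (Module.finBasis ℝ (meanZero K) i).1 s.1

def divI (K : Finset (Finset (E d))) :
    Matrix (Fin (Module.finrank ℝ (meanZero K))) (intFaces K) ℝ :=
  Matrix.of fun i s => rtDiv K (Module.finBasis ℝ (meanZero K) i).1 s.1

theorem mfeMatrix_eq (K : Finset (Finset (E d))) (A : Matrix (Fin d) (Fin d) ℝ) :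
    mfeMatrix K A = gramEE K A - (fromRows (gramIE K A) (divE K))ᵀ *
      (fromBlocks (gramII K A) (divI K)ᵀ (divI K) 0)⁻¹ * fromRows (gramIE K A) (divE K) := rfl

theorem rtEnergy_eq_blocks (h : IsComplex K) (hA : A.PosDef) (w : Finset (E d) → ℝ) :
    rtEnergy K A w = (fun s : extFaces K => w s.1) ⬝ᵥ gramEE K A *ᵥ (fun s : extFaces K => w s.1) +
      2 * ((fun s : intFaces K => w s.1) ⬝ᵥ gramIE K A *ᵥ (fun s : extFaces K => w s.1)) +
      (fun s : intFaces K => w s.1) ⬝ᵥ gramII K A *ᵥ (fun s : intFaces K => w s.1) := by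
  have hd : ∀ {α β : Type _} [Fintype α] [Fintype β] (f : α → Finset (E d))
      (g : β → Finset (E d)), (fun s => w (f s)) ⬝ᵥ
        (Matrix.of fun s s' => rtGram K A (f s) (g s')) *ᵥ (fun s => w (g s)) =
      ∑ s, ∑ s', w (f s) * w (g s') * rtGram K A (f s) (g s') := fun f g => by
    simp only [dotProduct, mulVec, Matrix.of_apply, Finset.mul_sum]
    exact Finset.sum_congr rfl fun s _ => Finset.sum_congr rfl fun s' _ => by ring
  rw [rtEnergy_eq_gram h, gramEE, gramIE, gramII, hd, hd, hd, sum_subfaces_eq]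
  simp only [sum_subfaces_eq, Finset.sum_add_distrib]
  have hsw : ∑ s : extFaces K, ∑ s' : intFaces K, w s.1 * w s'.1 * rtGram K A s.1 s'.1 =
      ∑ s : intFaces K, ∑ s' : extFaces K, w s.1 * w s'.1 * rtGram K A s.1 s'.1 := by
    rw [Finset.sum_comm]
    exact Finset.sum_congr rfl fun s _ => Finset.sum_congr rfl fun s' _ => by
      rw [rtGram_comm hA s'.1]; ring
  rw [hsw]
  ring

/-- Extended by zero to the boundary faces, `v` gives the fluxes of a field whose energy is this
form. Zero energy makes the field vanish almost everywhere, by continuity throughout the interior of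
each simplex, and `eq_zero_of_fluxField` then returns zero fluxes. -/
theorem gramII_pos (h : IsComplex K) (hd : 1 ≤ d) (hA : A.PosDef) (v : intFaces K → ℝ)
    (hv : v ≠ 0) : 0 < v ⬝ᵥ gramII K A *ᵥ v := by
  set w : Finset (E d) → ℝ := fun s => if hs : s ∈ intFaces K then v ⟨s, hs⟩ else 0 with hw
  have hwi : (fun s : intFaces K => w s.1) = v := by
    ext s
    simp [hw]
  have hwe : (fun s : extFaces K => w s.1) = 0 := by
    ext s
    have : s.1 ∉ intFaces K := fun hs =>
      (IsComplex.mem_intFaces_iff.1 hs).2 (IsComplex.mem_extFaces_iff.1 s.2).2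
    simp [hw, this]
  have he := rtEnergy_eq_blocks h hA w
  rw [hwi, hwe] at he
  simp only [mulVec_zero, dotProduct_zero, mul_zero, add_zero, zero_add] at he
  rw [← he, rtEnergy_eq_sum h]
  have hnn : ∀ κ, 0 ≤ ∫ x in body κ, normSq A⁻¹ (rtLocal K w κ x) := fun κ =>
    integral_nonneg fun x => normSq_nonneg hA.inv _
  refine lt_of_le_of_ne (Finset.sum_nonneg fun κ _ => hnn κ) fun h0 => hv ?_
  have hz := (Finset.sum_eq_zero_iff_of_nonneg fun κ _ => hnn κ).1 h0.symm
  ext s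
  obtain ⟨κ, hκs⟩ := IsComplex.star_nonempty_of_mem_subfaces (IsComplex.mem_intFaces_iff.1 s.2).1
  have hcard := IsComplex.card_of_mem_subfaces (IsComplex.mem_intFaces_iff.1 s.2).1
  have hκ := Finset.mem_filter.1 hκs
  have hc : Continuous fun x => normSq A⁻¹ (rtLocal K w κ x) :=
    (continuous_normSq _).comp (continuous_rtLocal K w κ)
  have h1 := hz κ hκ.1
  rw [setIntegral_eq_zero_iff_of_nonneg_ae (Filter.Eventually.of_forall fun x =>
    normSq_nonneg hA.inv _) (integrableOn_body hc)] at h1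
  have h2 : ∀ x ∈ interior (body κ), fluxField κ (rtCoef K w κ) x = 0 := by
    intro x hx
    rw [← rtLocal_eq h hκ.1]
    by_contra hne
    have hpos := normSq_pos hA.inv hne
    have hopen : IsOpen (interior (body κ) ∩ {x | 0 < normSq A⁻¹ (rtLocal K w κ x)}) :=
      isOpen_interior.inter (isOpen_lt continuous_const hc)
    refine (hopen.measure_pos volume ⟨x, hx, hpos⟩).ne' ?_
    rw [Filter.EventuallyEq, ae_restrict_iff' (measurableSet_body κ)] at h1
    refine measure_mono_null (fun y hy => ?_) h1
    intro hcon
    exact hy.2.ne' (hcon (interior_subset hy.1))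
  have hopp := (h.simplex κ hκ.1).opp_mem hκ.2 hcard
  have h3 := (h.simplex κ hκ.1).eq_zero_of_fluxField hd h2 hopp
  rw [rtCoef, (h.simplex κ hκ.1).erase_opp hκ.2 hcard] at h3
  have h4 : rtSign K s.1 κ ≠ 0 := left_ne_zero_of_mul_eq_one (IsComplex.rtSign_mul_self hκs)
  have h5 := (mul_eq_zero.1 h3).resolve_left h4
  rw [← congrFun hwi s]
  exact h5

/-- On each adjacent simplex the divergence of a basis field is `±1 / |κ|`, so only the orientation
sign survives the integration. -/
theorem rtDiv_eq (h : IsComplex K) (hd : 1 ≤ d) (q : K → ℝ) (s : Finset (E d)) :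
    rtDiv K q s = -∑ κ : K, if s ⊆ κ.1 then rtSign K s κ.1 * q κ else 0 := by
  rw [rtDiv]
  congr 1
  refine Finset.sum_congr rfl fun κ _ => ?_
  have hv := (h.simplex κ.1 κ.2).vol_pos.ne'
  have hd' : (d : ℝ) ≠ 0 := by positivity
  split_ifs with hs
  · have : rtBasis K s κ.1 =
        fun x => (rtSign K s κ.1 * ((d : ℝ) * vol κ.1)⁻¹) • (x - opp κ.1 s) := by
      ext1 x
      rw [rtBasis, if_pos hs, opp]
    rw [this]
    simp only [divergence_smul_sub]
    rw [setIntegral_const_body]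
    field_simp
  · have : rtBasis K s κ.1 = fun x => (0 : ℝ) • (x - 0) := by
      ext1 x
      rw [rtBasis, if_neg hs, zero_smul]
    rw [this]
    simp only [divergence_smul_sub, zero_mul, integral_zero]

theorem sum_mul_rtDiv (h : IsComplex K) (hd : 1 ≤ d) (q : K → ℝ) (w : Finset (E d) → ℝ) :
    ∑ s ∈ subfaces K, w s * rtDiv K q s = -∑ κ : K, q κ * ∑ a ∈ κ.1, rtCoef K w κ.1 a := by
  simp only [rtDiv_eq h hd, mul_neg, Finset.sum_neg_distrib, Finset.mul_sum]
  rw [Finset.sum_comm]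
  congr 1
  refine Finset.sum_congr rfl fun κ _ => ?_
  have := h.sum_subfaces κ.2 fun s => q κ * (rtSign K s κ.1 * w s)
  simp only [rtCoef]
  rw [← this, Finset.sum_filter]
  refine Finset.sum_congr rfl fun s _ => ?_
  split_ifs <;> ring

theorem mem_meanZero_iff (q : K → ℝ) : q ∈ meanZero K ↔ ∑ κ : K, vol κ.1 * q κ = 0 := by
  simp [meanZero, LinearMap.mem_ker, LinearMap.sum_apply]

/-- The divergence of a field is constant if and only if it is orthogonal to the functions with
mean value zero. -/
theorem constDiv_iff (h : IsComplex K) (hd : 1 ≤ d) (hne : K.Nonempty) (w : Finset (E d) → ℝ) :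
    (∃ r : ℝ, ∀ κ ∈ K, ∑ a ∈ κ, rtCoef K w κ a = r * vol κ) ↔
      ∀ q ∈ meanZero K, ∑ s ∈ subfaces K, w s * rtDiv K q s = 0 := by
  simp only [sum_mul_rtDiv h hd, neg_eq_zero]
  constructor
  · rintro ⟨r, hr⟩ q hq
    rw [mem_meanZero_iff] at hq
    have : ∀ κ : K, q κ * ∑ a ∈ κ.1, rtCoef K w κ.1 a = r * (vol κ.1 * q κ) := fun κ => by
      rw [hr κ.1 κ.2]; ring
    simp only [this]
    rw [← Finset.mul_sum, hq, mul_zero]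
  · intro hq
    obtain ⟨κ₀, hκ₀⟩ := hne
    have hv : ∀ κ ∈ K, vol κ ≠ 0 := fun κ hκ => (h.simplex κ hκ).vol_pos.ne'
    refine ⟨(vol κ₀)⁻¹ * ∑ a ∈ κ₀, rtCoef K w κ₀ a, fun κ hκ => ?_⟩
    -- The difference of the indicators of two simplices, each divided by its volume, has mean zero;
    -- it compares the two divergences.
    have := hq (Pi.single ⟨κ, hκ⟩ (vol κ)⁻¹ - Pi.single ⟨κ₀, hκ₀⟩ (vol κ₀)⁻¹) (by
      rw [mem_meanZero_iff]
      simp [mul_sub, Finset.sum_sub_distrib, Pi.single_apply, hv κ hκ, hv κ₀ hκ₀])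
    simp only [Pi.sub_apply, sub_mul, Finset.sum_sub_distrib, Pi.single_apply, ite_mul, zero_mul,
      Finset.sum_ite_eq', Finset.mem_univ, if_true] at this
    rw [← sub_eq_zero.1 this]
    field_simp [hv κ hκ]

theorem isAdmissible_iff (h : IsComplex K) (hd : 1 ≤ d) (U w : Finset (E d) → ℝ) :
    IsAdmissible K U w ↔ (∀ s ∈ extFaces K, w s = U s) ∧
      ∃ r : ℝ, ∀ κ ∈ K, ∑ a ∈ κ, rtCoef K w κ a = r * vol κ := by
  refine and_congr_right fun _ => exists_congr fun r => ?_
  refine forall₂_congr fun κ hκ => ?_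
  have hv := (h.simplex κ hκ).vol_pos.ne'
  simp only [divergence_rtLocal h hd hκ]
  rw [inv_mul_eq_div, div_eq_iff hv]
  obtain ⟨x, hx⟩ := (h.simplex κ hκ).interior_nonempty
  exact ⟨fun H => H x (interior_subset hx), fun H _ _ => H⟩

/-- It suffices to test the divergence with a basis of the functions of mean zero, and this is the
constraint row of the saddle-point system. -/
theorem isAdmissible_iff_blocks (h : IsComplex K) (hd : 1 ≤ d) (hne : K.Nonempty)
    (U w : Finset (E d) → ℝ) :
    IsAdmissible K U w ↔ (∀ s ∈ extFaces K, w s = U s) ∧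
      divI K *ᵥ (fun s : intFaces K => w s.1) = -(divE K *ᵥ fun s : extFaces K => w s.1) := by
  rw [isAdmissible_iff h hd, constDiv_iff h hd hne]
  refine and_congr_right fun _ => ?_
  set b := Module.finBasis ℝ (meanZero K)
  have hb : ∀ i, ∑ s ∈ subfaces K, w s * rtDiv K (b i).1 s =
      (divE K *ᵥ fun s : extFaces K => w s.1) i + (divI K *ᵥ fun s : intFaces K => w s.1) i :=
    fun i => by
      rw [sum_subfaces_eq]
      simp only [mulVec, dotProduct, divE, divI, Matrix.of_apply]
      congr 1 <;> exact Finset.sum_congr rfl fun s _ => mul_comm _ _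
  constructor
  · intro hq
    ext i
    have := hq _ (b i).2
    rw [hb] at this
    rw [Pi.neg_apply]
    linarith
  · intro hi q hq
    have hlin : ∀ q : K → ℝ, ∑ s ∈ subfaces K, w s * rtDiv K q s =
        -∑ κ : K, q κ * ∑ a ∈ κ.1, rtCoef K w κ.1 a := fun q => sum_mul_rtDiv h hd q w
    let f : meanZero K →ₗ[ℝ] ℝ :=
      { toFun := fun q => ∑ κ : K, q.1 κ * ∑ a ∈ κ.1, rtCoef K w κ.1 a
        map_add' := fun q q' => by
          simp only [Submodule.coe_add, Pi.add_apply, add_mul, Finset.sum_add_distrib]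
        map_smul' := fun c q => by
          simp only [Submodule.coe_smul, Pi.smul_apply, smul_eq_mul, mul_assoc, Finset.mul_sum,
            RingHom.id_apply] }
    have hf : f = 0 := b.ext fun i => by
      have h1 := hb i
      rw [hlin, congrFun hi i, Pi.neg_apply, add_neg_cancel, neg_eq_zero] at h1
      exact h1
    rw [hlin, neg_eq_zero]
    exact LinearMap.congr_fun hf ⟨q, hq⟩

/-- A piecewise constant that is orthogonal to the divergences of all interior basis fields has no
jump across interior faces. Connectedness through faces makes it constant, and mean zero makes it
vanish. -/
theorem divI_transpose_injective (h : IsCell K) (hd : 1 ≤ d)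
    (y : Fin (Module.finrank ℝ (meanZero K)) → ℝ) (hy : (divI K)ᵀ *ᵥ y = 0) : y = 0 := by
  set b := Module.finBasis ℝ (meanZero K)
  set q : meanZero K := ∑ i, y i • b i with hq
  have hqv : ∀ κ, q.1 κ = ∑ i, y i * (b i).1 κ := fun κ => by
    rw [hq]
    simp [Finset.sum_apply]
  have hdiv : ∀ s ∈ intFaces K, rtDiv K q.1 s = 0 := fun s hs => by
    have := congrFun hy ⟨s, hs⟩
    simp only [mulVec, dotProduct, transpose_apply, divI, Matrix.of_apply, Pi.zero_apply] at this
    rw [← this, rtDiv_eq h.toIsComplex hd]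
    simp only [rtDiv_eq h.toIsComplex hd, hqv, neg_mul, Finset.sum_neg_distrib, Finset.sum_mul]
    rw [Finset.sum_comm]
    congr 1
    refine Finset.sum_congr rfl fun κ _ => ?_
    split_ifs
    · rw [Finset.mul_sum]
      exact Finset.sum_congr rfl fun i _ => by ring
    · simp
  have hstep : ∀ κ (hκ : κ ∈ K) κ' (hκ' : κ' ∈ K), (κ ∩ κ').card = d →
      q.1 ⟨κ, hκ⟩ = q.1 ⟨κ', hκ'⟩ := by
    intro κ hκ κ' hκ' hcard
    by_cases hne : κ = κ'
    · subst hne; rfl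
    have hs : κ ∩ κ' ∈ subfaces K := Finset.mem_biUnion.2
      ⟨κ, hκ, Finset.mem_powersetCard.2 ⟨Finset.inter_subset_left, hcard⟩⟩
    have h1 : κ ∈ star K (κ ∩ κ') := Finset.mem_filter.2 ⟨hκ, Finset.inter_subset_left⟩
    have h2 : κ' ∈ star K (κ ∩ κ') := Finset.mem_filter.2 ⟨hκ', Finset.inter_subset_right⟩
    have hint : κ ∩ κ' ∈ intFaces K := IsComplex.mem_intFaces_iff.2 ⟨hs, fun h1' =>
      hne (Finset.card_le_one.1 h1'.le _ h1 _ h2)⟩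
    have h3 := hdiv _ hint
    have hpair := h.toIsComplex.star_eq_pair hd hcard h1 h2 hne
    have hsum : ∑ κ'' : K, (if κ ∩ κ' ⊆ κ''.1 then rtSign K (κ ∩ κ') κ''.1 * q.1 κ'' else 0) =
        rtSign K (κ ∩ κ') κ * q.1 ⟨κ, hκ⟩ + rtSign K (κ ∩ κ') κ' * q.1 ⟨κ', hκ'⟩ := by
      set g : Finset (E d) → ℝ := fun κ'' =>
        rtSign K (κ ∩ κ') κ'' * (if hk : κ'' ∈ K then q.1 ⟨κ'', hk⟩ else 0)
      have hpair' : K.filter (fun κ'' => κ ∩ κ' ⊆ κ'') = {κ, κ'} := hpair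
      have e := (Finset.sum_coe_sort K fun κ'' => if κ ∩ κ' ⊆ κ'' then g κ'' else 0).trans
        (Finset.sum_filter (fun κ'' => κ ∩ κ' ⊆ κ'') g).symm
      rw [hpair', Finset.sum_pair hne] at e
      simpa [g, hκ, hκ'] using e
    rw [rtDiv_eq h.toIsComplex hd, neg_eq_zero, hsum] at h3
    have h4 := h.toIsComplex.rtSign_add hd hcard h1 h2 hne
    have h5 := IsComplex.rtSign_mul_self h1
    have h6 : rtSign K (κ ∩ κ') κ' = -rtSign K (κ ∩ κ') κ := by linarith
    rw [h6, neg_mul, ← sub_eq_add_neg, ← mul_sub] at h3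
    have h7 : rtSign K (κ ∩ κ') κ ≠ 0 := left_ne_zero_of_mul_eq_one h5
    exact sub_eq_zero.1 ((mul_eq_zero.1 h3).resolve_left h7)
  obtain ⟨κ₀, hκ₀⟩ := h.nonempty
  have hconst : ∀ κ (hκ : κ ∈ K), q.1 ⟨κ, hκ⟩ = q.1 ⟨κ₀, hκ₀⟩ := by
    intro κ hκ
    have hr := h.connected κ₀ hκ₀ κ hκ
    have : ∀ κ', Relation.ReflTransGen (fun a b => a ∈ K ∧ b ∈ K ∧ (a ∩ b).card = d) κ₀ κ' →
        ∀ hκ' : κ' ∈ K, q.1 ⟨κ', hκ'⟩ = q.1 ⟨κ₀, hκ₀⟩ := by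
      intro κ' hr
      induction hr with
      | refl => exact fun _ => rfl
      | tail _ hbc ih =>
        exact fun hκ' => (hstep _ hbc.1 _ hκ' hbc.2.2).symm.trans (ih hbc.1)
    exact this κ hr hκ
  have hzero : q.1 ⟨κ₀, hκ₀⟩ = 0 := by
    have := (mem_meanZero_iff q.1).1 q.2
    have hsum : ∑ κ : K, vol κ.1 * q.1 κ = ∑ κ : K, vol κ.1 * q.1 ⟨κ₀, hκ₀⟩ :=
      Finset.sum_congr rfl fun κ _ => by rw [← hconst κ.1 κ.2]
    rw [hsum, ← Finset.sum_mul] at this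
    refine (mul_eq_zero.1 this).resolve_left (ne_of_gt ?_)
    exact Finset.sum_pos (fun κ _ => (h.simplex κ.1 κ.2).vol_pos) ⟨⟨κ₀, hκ₀⟩, Finset.mem_univ _⟩
  have hq0 : q = 0 := by
    ext κ
    rw [hconst κ.1 κ.2, hzero]
    rfl
  have := Fintype.linearIndependent_iff.1 b.linearIndependent y (by rw [← hq, hq0])
  exact funext this

/-- The interior face fluxes of the lifting, a linear function of the boundary face fluxes. -/
def liftInt (K : Finset (Finset (E d))) (A : Matrix (Fin d) (Fin d) ℝ)
    (U : Finset (E d) → ℝ) : intFaces K → ℝ :=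
  saddleSol (gramIE K A) (gramII K A) (divE K) (divI K) (fun s : extFaces K => U s.1) ∘ Sum.inl

/-- The solution operator of the local mixed finite element problem. -/
def liftSol (K : Finset (Finset (E d))) (A : Matrix (Fin d) (Fin d) ℝ)
    (U : Finset (E d) → ℝ) (s : Finset (E d)) : ℝ :=
  if hs : s ∈ intFaces K then liftInt K A U ⟨s, hs⟩ else U s

theorem liftSol_combination (K : Finset (Finset (E d))) (A : Matrix (Fin d) (Fin d) ℝ) (c c' : ℝ)
    (U U' : Finset (E d) → ℝ) :
    liftSol K A (fun s => c * U s + c' * U' s) =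
      fun s => c * liftSol K A U s + c' * liftSol K A U' s := by
  ext s
  rw [liftSol, liftSol, liftSol]
  split_ifs with hs
  · have : (fun s : extFaces K => c * U s.1 + c' * U' s.1) =
        c • (fun s : extFaces K => U s.1) + c' • (fun s : extFaces K => U' s.1) := rfl
    simp only [liftInt, Function.comp_apply, saddleSol, this, mulVec_add, mulVec_smul, Pi.neg_apply,
      Pi.add_apply, Pi.smul_apply, smul_eq_mul]
    ring
  · rfl

theorem liftSol_ext (K : Finset (Finset (E d))) (A : Matrix (Fin d) (Fin d) ℝ)
    (U : Finset (E d) → ℝ) {s : Finset (E d)} (hs : s ∈ extFaces K) : liftSol K A U s = U s := by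
  rw [liftSol, dif_neg fun hs' =>
    (IsComplex.mem_intFaces_iff.1 hs').2 (IsComplex.mem_extFaces_iff.1 hs).2]

section

variable (h : IsCell K) (hd : 1 ≤ d) (hA : A.PosDef) (U : Finset (E d) → ℝ)
include h hd hA

theorem isUnit_det_blocks :
    IsUnit (fromBlocks (gramII K A) (divI K)ᵀ (divI K) 0).det :=
  isUnit_det_saddle _ _ (gramII_pos h.toIsComplex hd hA) (divI_transpose_injective h hd)

theorem liftSol_admissible : IsAdmissible K U (liftSol K A U) := by
  rw [isAdmissible_iff_blocks h.toIsComplex hd h.nonempty]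
  refine ⟨fun s hs => liftSol_ext K A U hs, ?_⟩
  have e1 : (fun s : intFaces K => liftSol K A U s.1) = liftInt K A U := by
    ext s
    rw [liftSol, dif_pos s.2]
  have e2 : (fun s : extFaces K => liftSol K A U s.1) = fun s : extFaces K => U s.1 := by
    ext s
    rw [liftSol_ext K A U s.2]
  rw [e1, e2]
  exact (saddleSol_spec (isUnit_det_blocks h hd hA) _).2

theorem rtEnergy_liftSol :
    rtEnergy K A (liftSol K A U) = (fun s : extFaces K => U s.1) ⬝ᵥ
      mfeMatrix K A *ᵥ fun s : extFaces K => U s.1 := by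
  have e1 : (fun s : intFaces K => liftSol K A U s.1) = liftInt K A U := by
    ext s
    rw [liftSol, dif_pos s.2]
  have e2 : (fun s : extFaces K => liftSol K A U s.1) = fun s : extFaces K => U s.1 := by
    ext s
    rw [liftSol_ext K A U s.2]
  rw [rtEnergy_eq_blocks h.toIsComplex hA, e1, e2, mfeMatrix_eq]
  exact saddle_energy _ (isUnit_det_blocks h hd hA) _

theorem rtEnergy_of_admissible {w : Finset (E d) → ℝ} (hw : IsAdmissible K U w) :
    rtEnergy K A w = rtEnergy K A (liftSol K A U) +
      ((fun s : intFaces K => w s.1) - liftInt K A U) ⬝ᵥ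
        gramII K A *ᵥ ((fun s : intFaces K => w s.1) - liftInt K A U) := by
  rw [isAdmissible_iff_blocks h.toIsComplex hd h.nonempty] at hw
  have e1 : (fun s : intFaces K => liftSol K A U s.1) = liftInt K A U := by
    ext s
    rw [liftSol, dif_pos s.2]
  have e2 : (fun s : extFaces K => liftSol K A U s.1) = fun s : extFaces K => U s.1 := by
    ext s
    rw [liftSol_ext K A U s.2]
  have e3 : (fun s : extFaces K => w s.1) = fun s : extFaces K => U s.1 := by
    ext s
    rw [hw.1 s.1 s.2]
  rw [rtEnergy_eq_blocks h.toIsComplex hA, rtEnergy_eq_blocks h.toIsComplex hA, e1, e2, e3]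
  refine saddle_energy_add _ ?_ (isUnit_det_blocks h hd hA) _ _ (e3 ▸ hw.2)
  ext s s'
  exact rtGram_comm hA _ _

/-- The lifting of boundary fluxes is the solution of the local mixed finite element problem. -/
theorem lift_eq {s : Finset (E d)} (hs : s ∈ subfaces K) : lift K A U s = liftSol K A U s := by
  -- A minimizer has to be exhibited before anything is known about the value of `epsilon`.
  -- Uniqueness is then claimed only on the faces of the submesh, since other values do not enter
  -- the energy.
  have hex : ∃ w, IsAdmissible K U w ∧ ∀ w', IsAdmissible K U w' →
      rtEnergy K A w ≤ rtEnergy K A w' := by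
    refine ⟨liftSol K A U, liftSol_admissible h hd hA U, fun w' hw' => ?_⟩
    rw [rtEnergy_of_admissible h hd hA U hw', le_add_iff_nonneg_right]
    by_cases h0 : (fun s : intFaces K => w' s.1) - liftInt K A U = 0
    · rw [h0, zero_dotProduct]
    · exact (gramII_pos h.toIsComplex hd hA _ h0).le
  obtain ⟨h1, h2⟩ := Classical.epsilon_spec hex
  change IsAdmissible K U (lift K A U) at h1
  change ∀ w', IsAdmissible K U w' → rtEnergy K A (lift K A U) ≤ rtEnergy K A w' at h2
  have h3 := h2 _ (liftSol_admissible h hd hA U)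
  rw [rtEnergy_of_admissible h hd hA U h1] at h3
  by_cases hs' : s ∈ intFaces K
  · rw [liftSol, dif_pos hs']
    by_contra hne
    have h0 : (fun s : intFaces K => lift K A U s.1) - liftInt K A U ≠ 0 := fun h0 =>
      hne (sub_eq_zero.1 (congrFun h0 ⟨s, hs'⟩))
    have := gramII_pos h.toIsComplex hd hA _ h0
    linarith
  · have hse : s ∈ extFaces K := IsComplex.mem_extFaces_iff.2 ⟨hs, by
      by_contra hc
      exact hs' (IsComplex.mem_intFaces_iff.2 ⟨hs, hc⟩)⟩
    rw [h1.1 s hse, liftSol_ext K A U hse]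

end

end lift

/-! ### Measures of faces and global balance of the fluxes -/

section area

variable {d : ℕ}

/-- Positivity makes the division by `faceArea` in `spread` harmless. The affine hull of the face is
parametrized isometrically by its direction space, where the Hausdorff measure is Lebesgue measure
and the simplex has nonempty interior. -/
theorem area_pos (hd : 1 ≤ d) {s : Finset (E d)} (hcard : s.card = d)
    (hs : AffineIndependent ℝ (Subtype.val : s → E d)) : 0 < area s := by
  obtain ⟨p, hp⟩ : s.Nonempty := Finset.card_pos.1 (by omega)
  set V : Submodule ℝ (E d) := vectorSpan ℝ (Set.range (Subtype.val : s → E d)) with hV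
  have hfin : Module.finrank ℝ V = d - 1 :=
    hs.finrank_vectorSpan (by rw [Fintype.card_coe, hcard]; omega)
  set f : V →ᵃ[ℝ] E d := V.subtype.toAffineMap + AffineMap.const ℝ V p with hf
  have hfv : ∀ v : V, f v = v.1 + p := fun v => rfl
  have hiso : Isometry f := Isometry.of_dist_eq fun v w => by
    rw [hfv, hfv, dist_add_right]; rfl
  set q : s → V := fun b => ⟨b.1 - p, vsub_mem_vectorSpan ℝ ⟨b, rfl⟩ ⟨⟨p, hp⟩, rfl⟩⟩ with hq
  have hfq : f ∘ q = Subtype.val := by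
    ext1 b
    simp [hq, hfv]
  have hqi : AffineIndependent ℝ q := AffineIndependent.of_comp f (by rw [hfq]; exact hs)
  have hspan : affineSpan ℝ (Set.range q) = ⊤ :=
    hqi.affineSpan_eq_top_iff_card_eq_finrank_add_one.2 (by
      rw [hfin, Fintype.card_coe, hcard]; omega)
  have himg : f '' convexHull ℝ (Set.range q) = body s := by
    rw [f.image_convexHull (Set.range q), ← Set.range_comp, hfq, Subtype.range_coe_subtype, body]
    rfl
  have hmeas : Measure.euclideanHausdorffMeasure (d - 1) (body s) =
      volume (convexHull ℝ (Set.range q)) := by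
    rw [← himg, hiso.euclideanHausdorffMeasure_image, ← hfin,
      InnerProductSpace.euclideanHausdorffMeasure_eq_volume]
  have hne : (interior (convexHull ℝ (Set.range q))).Nonempty :=
    interior_convexHull_nonempty_iff_affineSpan_eq_top.2 hspan
  rw [area, Measure.real, hmeas]
  refine ENNReal.toReal_pos (fun h0 => ?_) ?_
  · exact (isOpen_interior.measure_pos volume hne).ne' (measure_mono_null interior_subset h0)
  · exact ((Set.finite_range q).isCompact_convexHull (𝕜 := ℝ)).measure_lt_top.ne

end area

namespace PolytopalMesh

variable {d : ℕ} {Ω : Set (E d)} (M : PolytopalMesh d Ω)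

theorem isComplex : IsComplex M.simplices :=
  ⟨fun κ hκ => ⟨M.card_eq κ hκ, M.affineIndependent κ hκ⟩,
    fun κ hκ κ' hκ' => (M.inter_eq κ hκ κ' hκ').subset⟩

theorem elem_subset (K : M.Elem) : K.1 ⊆ M.simplices := M.elems.le K.2

theorem isCell (K : M.Elem) : IsCell K.1 where
  toIsComplex := M.isComplex.mono (M.elem_subset K)
  nonempty := M.elems.nonempty_of_mem_parts K.2
  connected := M.connected K.1 K.2

theorem body_subset {κ : Finset (E d)} (hκ : κ ∈ M.simplices) : body κ ⊆ closure Ω := by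
  rw [← M.cover]
  exact Set.subset_biUnion_of_mem (u := fun κ => body κ) hκ

theorem elem_eq {K L : M.Elem} {κ : Finset (E d)} (hK : κ ∈ K.1) (hL : κ ∈ L.1) : K = L :=
  Subtype.ext (M.elems.disjoint.elim_finset K.2 L.2 κ hK hL)

theorem star_subset (K : M.Elem) (s : Finset (E d)) : star K.1 s ⊆ star M.simplices s :=
  Finset.filter_subset_filter _ (M.elem_subset K)

theorem isCompact_closure (M : PolytopalMesh d Ω) : IsCompact (closure Ω) := by
  rw [← M.cover]
  exact IsComplex.isCompact_cellSet M.simplices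

theorem volume_ne_top (M : PolytopalMesh d Ω) : volume Ω ≠ ⊤ :=
  ((measure_mono subset_closure).trans_lt M.isCompact_closure.measure_lt_top).ne

/-- Three different elements do not share a face. -/
theorem eq_of_mem_extFaces (hd : 1 ≤ d) {s : Finset (E d)} {K L L' : M.Elem} (hK : s ∈ extFaces K.1)
    (hL : s ∈ extFaces L.1) (hL' : s ∈ extFaces L'.1) (hne : K ≠ L) (hne' : K ≠ L') : L = L' := by
  have hsub := (IsComplex.mem_extFaces_iff.1 hK).1
  obtain ⟨κ, hκ⟩ := IsComplex.star_nonempty_of_mem_subfaces hsub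
  obtain ⟨κ₁, hκ₁⟩ :=
    IsComplex.star_nonempty_of_mem_subfaces (IsComplex.mem_extFaces_iff.1 hL).1
  obtain ⟨κ₂, hκ₂⟩ :=
    IsComplex.star_nonempty_of_mem_subfaces (IsComplex.mem_extFaces_iff.1 hL').1
  have h1 := (Finset.mem_filter.1 hκ).1
  have h2 := (Finset.mem_filter.1 hκ₁).1
  have h3 := (Finset.mem_filter.1 hκ₂).1
  have heq : κ₁ = κ₂ := M.isComplex.eq_of_mem_star hd (IsComplex.card_of_mem_subfaces hsub)
    (M.star_subset K s hκ) (M.star_subset L s hκ₁) (M.star_subset L' s hκ₂)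
    (fun h => hne (M.elem_eq h1 (h ▸ h2))) (fun h => hne' (M.elem_eq h1 (h ▸ h3)))
  exact M.elem_eq h2 (heq ▸ h3)

/-- The fluxes between neighboring simplices of one element cancel in a sum of face values. -/
theorem sum_rtCoef_faceMean (hd : 1 ≤ d) {K : Finset (Finset (E d))} (h : IsComplex K)
    (μ : Finset (E d) → E d → ℝ)
    (hμ : ∀ κ κ' a a', Adjacent κ κ' a a' → κ ∈ K → κ' ∈ K → μ κ a = μ κ' a')
    (w : Finset (E d) → ℝ) :
    ∑ κ ∈ K, ∑ a ∈ κ, rtCoef K w κ a * μ κ a =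
      ∑ s ∈ extFaces K, w s * ∑ κ ∈ star K s, μ κ (opp κ s) := by
  have h1 : ∑ κ ∈ K, ∑ a ∈ κ, rtCoef K w κ a * μ κ a =
      ∑ κ ∈ K, ∑ a ∈ κ, (fun s κ => rtSign K s κ * w s * μ κ (opp κ s)) (κ.erase a) κ :=
    Finset.sum_congr rfl fun κ _ => Finset.sum_congr rfl fun a ha => by
      simp only [opp_erase ha, rtCoef]
  rw [h1, h.sum_sum_subfaces (fun s κ => rtSign K s κ * w s * μ κ (opp κ s)), ← Finset.sum_filter_add_sum_filter_not (subfaces K)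
    (fun s => (star K s).card = 1)]
  change ∑ s ∈ extFaces K, _ + ∑ s ∈ intFaces K, _ = _
  -- Interior faces drop out: the orientation signs of the two simplices are opposite, while `μ`
  -- takes the same value from both sides.
  rw [Finset.sum_eq_zero (s := intFaces K), add_zero]
  · refine Finset.sum_congr rfl fun s hs => ?_
    rw [Finset.mul_sum]
    refine Finset.sum_congr rfl fun κ hκ => ?_
    rw [IsComplex.rtSign_of_mem_extFaces hs hκ, one_mul]
  · intro s hs
    obtain ⟨hsub, hc⟩ := IsComplex.mem_intFaces_iff.1 hs
    have hcard := IsComplex.card_of_mem_subfaces hsub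
    have hn := IsComplex.star_nonempty_of_mem_subfaces hsub
    obtain ⟨κ, hκ, κ', hκ', hne⟩ := Finset.one_lt_card.1
      (lt_of_le_of_ne (Finset.card_pos.2 hn) (Ne.symm hc))
    rw [h.star_eq_pair hd hcard hκ hκ' hne, Finset.sum_pair hne,
      hμ κ κ' _ _ (h.adjacent hcard hκ hκ' hne) (Finset.mem_filter.1 hκ).1
        (Finset.mem_filter.1 hκ').1, ← add_mul, ← add_mul, h.rtSign_add hd hcard hκ hκ' hne,
      zero_mul, zero_mul]

/-- Fluxes that are opposite from the two sides of the faces are in balance. -/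
theorem sum_balance (hd : 1 ≤ d) (μ : Finset (E d) → E d → ℝ)
    (hμ : ∀ κ κ' a a', Adjacent κ κ' a a' → κ ∈ M.simplices → κ' ∈ M.simplices → μ κ a = μ κ' a')
    (W : M.Elem → Finset (E d) → ℝ)
    (hW : ∀ K L : M.Elem, K ≠ L → ∀ s ∈ extFaces K.1, s ∈ extFaces L.1 → W K s = -W L s)
    (hW0 : ∀ K : M.Elem, ∀ s ∈ extFaces K.1, (∀ L : M.Elem, s ∈ extFaces L.1 → L = K) →
      W K s = 0) :
    ∑ K : M.Elem, ∑ κ ∈ K.1, ∑ a ∈ κ, rtCoef K.1 (W K) κ a * μ κ a = 0 := by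
  have h1 : ∀ K : M.Elem, ∑ κ ∈ K.1, ∑ a ∈ κ, rtCoef K.1 (W K) κ a * μ κ a =
      ∑ s ∈ M.elems.parts.biUnion extFaces, if s ∈ extFaces K.1 then
        W K s * ∑ κ ∈ star K.1 s, μ κ (opp κ s) else 0 := fun K => by
    rw [sum_rtCoef_faceMean hd (M.isCell K).toIsComplex μ (fun κ κ' a a' h hκ hκ' =>
      hμ κ κ' a a' h (M.elem_subset K hκ) (M.elem_subset K hκ')), ← Finset.sum_filter]
    refine Finset.sum_congr ?_ fun _ _ => rfl
    ext s
    rw [Finset.mem_filter, Finset.mem_biUnion]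
    exact ⟨fun hs => ⟨⟨K.1, K.2, hs⟩, hs⟩, fun hs => hs.2⟩
  simp only [h1]
  rw [Finset.sum_comm]
  refine Finset.sum_eq_zero fun s hs => ?_
  obtain ⟨K₀, hK₀, hsK⟩ := Finset.mem_biUnion.1 hs
  set K : M.Elem := ⟨K₀, hK₀⟩
  have hsK : s ∈ extFaces K.1 := hsK
  -- Either exactly one other element contains the face and the two contributions cancel, or only
  -- one element sees it and the flux is zero.
  by_cases hL : ∃ L : M.Elem, s ∈ extFaces L.1 ∧ L ≠ K
  · obtain ⟨L, hsL, hne⟩ := hL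
    have hfil : (Finset.univ.filter fun J : M.Elem => s ∈ extFaces J.1) = {K, L} := by
      ext J
      simp only [Finset.mem_filter, Finset.mem_univ, true_and, Finset.mem_insert,
        Finset.mem_singleton]
      constructor
      · intro hJ
        by_contra! hcon
        exact hcon.2 (M.eq_of_mem_extFaces hd hsK hsL hJ hne.symm hcon.1.symm).symm
      · rintro (rfl | rfl) <;> assumption
    rw [← Finset.sum_filter, hfil, Finset.sum_pair hne.symm, hW K L hne.symm s hsK hsL]
    obtain ⟨hsub, hc⟩ := IsComplex.mem_extFaces_iff.1 hsK
    obtain ⟨κ, hκ⟩ := Finset.card_eq_one.1 hc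
    obtain ⟨κ', hκ'⟩ := Finset.card_eq_one.1 (IsComplex.mem_extFaces_iff.1 hsL).2
    have m1 : κ ∈ star K.1 s := hκ ▸ Finset.mem_singleton_self κ
    have m2 : κ' ∈ star L.1 s := hκ' ▸ Finset.mem_singleton_self κ'
    have k1 := (Finset.mem_filter.1 m1).1
    have k2 := (Finset.mem_filter.1 m2).1
    have hadj := M.isComplex.adjacent (IsComplex.card_of_mem_subfaces hsub)
      (M.star_subset K s m1) (M.star_subset L s m2)
      (fun h => hne.symm (M.elem_eq k1 (h ▸ k2)))
    rw [hκ, hκ', Finset.sum_singleton, Finset.sum_singleton,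
      hμ _ _ _ _ hadj (M.elem_subset K k1) (M.elem_subset L k2)]
    ring
  · push Not at hL
    rw [Finset.sum_eq_single K, if_pos hsK, hW0 K s hsK hL, zero_mul]
    · exact fun L _ hne => if_neg fun hsL => hne (hL L hsL)
    · exact fun hn => absurd (Finset.mem_univ _) hn

/-! Polytopal faces -/

theorem face_eq {σ σ' : M.Face} {s : Finset (E d)} (hσ : s ∈ σ.1) (hσ' : s ∈ σ'.1) : σ = σ' :=
  Subtype.ext (M.faces.disjoint.elim_finset σ.2 σ'.2 s hσ hσ')

theorem exists_face {K : M.Elem} {s : Finset (E d)} (hs : s ∈ extFaces K.1) :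
    ∃ σ : M.Face, s ∈ σ.1 := by
  obtain ⟨σ, hσ, hsσ⟩ := M.faces.exists_mem (Finset.mem_biUnion.2 ⟨K.1, K.2, hs⟩)
  exact ⟨⟨σ, hσ⟩, hsσ⟩

/-- By `faces_adjacent`, a single simplicial subface decides to which elements the whole polytopal
face belongs. -/
theorem mem_facesOf_iff {K : M.Elem} {σ : M.Face} {s : Finset (E d)} (hs : s ∈ σ.1) :
    σ ∈ M.facesOf K ↔ s ∈ extFaces K.1 := by
  rw [facesOf, Finset.mem_filter]
  exact ⟨fun h => h.2 hs, fun h => ⟨Finset.mem_univ _, fun s' hs' =>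
    M.faces_adjacent σ.1 σ.2 s hs s' hs' K.1 K.2 h⟩⟩

theorem isInterior_iff {σ : M.Face} {s : Finset (E d)} (hs : s ∈ σ.1) :
    M.IsInterior σ ↔ ∃ K L : M.Elem, K ≠ L ∧ s ∈ extFaces K.1 ∧ s ∈ extFaces L.1 := by
  simp only [IsInterior, M.mem_facesOf_iff hs]

theorem faceArea_pos (hd : 1 ≤ d) (σ : M.Face) : 0 < M.faceArea σ := by
  have hne : σ.1.Nonempty := M.faces.nonempty_of_mem_parts σ.2
  refine Finset.sum_pos (fun s hs => ?_) hne
  have hsub := M.faces.le σ.2 hs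
  obtain ⟨K, hK, hsK⟩ := Finset.mem_biUnion.1 hsub
  have h1 := (IsComplex.mem_extFaces_iff.1 hsK).1
  obtain ⟨κ, hκ⟩ := IsComplex.star_nonempty_of_mem_subfaces h1
  have h2 := Finset.mem_filter.1 hκ
  have h3 := M.isComplex.simplex κ (M.elem_subset ⟨K, hK⟩ h2.1)
  exact area_pos hd (IsComplex.card_of_mem_subfaces h1) (h3.indep.mono (Finset.coe_subset.2 h2.2))

end PolytopalMesh

/-! ### Lifted fluxes on the cells -/

section liftedField

variable {d : ℕ} {K : Finset (Finset (E d))} {A : Matrix (Fin d) (Fin d) ℝ}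

theorem rtField_congr {w w' : Finset (E d) → ℝ} (h : ∀ s ∈ subfaces K, w s = w' s) :
    rtField K w = rtField K w' := by
  have : rtLocal K w = rtLocal K w' := by
    funext κ x
    exact Finset.sum_congr rfl fun s hs => by rw [h s hs]
  funext x
  simp only [rtField, this]

theorem rtField_combination (K : Finset (Finset (E d))) (c c' : ℝ) (w w' : Finset (E d) → ℝ)
    (x : E d) :
    rtField K (fun s => c * w s + c' * w' s) x = c • rtField K w x + c' • rtField K w' x := by
  have hloc : ∀ κ, rtLocal K (fun s => c * w s + c' * w' s) κ =
      c • rtLocal K w κ + c' • rtLocal K w' κ := fun κ => by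
    funext y
    simp only [rtLocal, Pi.add_apply, Pi.smul_apply, Finset.smul_sum, ← Finset.sum_add_distrib,
      add_smul, mul_smul]
  simp only [rtField, hloc, Finset.smul_sum, ← Finset.sum_add_distrib]
  refine Finset.sum_congr rfl fun κ _ => ?_
  by_cases hx : x ∈ interior (body κ)
  · simp only [Set.indicator_of_mem hx, Pi.add_apply, Pi.smul_apply]
  · simp only [Set.indicator_of_notMem hx, smul_zero, add_zero]

theorem memLp_rtField (K : Finset (Finset (E d))) (w : Finset (E d) → ℝ) :
    MemLp (rtField K w) 2 volume := by
  refine memLp_finsetSum K fun κ _ => ?_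
  rw [memLp_indicator_iff_restrict isOpen_interior.measurableSet]
  exact (memLp_body κ (continuous_rtLocal K w κ)).mono_measure
    (Measure.restrict_mono interior_subset le_rfl)

/-- The divergence is constant and interior fluxes cancel in the sum over the simplices, so the
constant is the total boundary flux divided by the volume. -/
theorem IsCell.sum_rtCoef_liftSol (h : IsCell K) (hd : 1 ≤ d) (hA : A.PosDef)
    (U : Finset (E d) → ℝ) {κ : Finset (E d)} (hκ : κ ∈ K) :
    ∑ a ∈ κ, rtCoef K (liftSol K A U) κ a =
      (cellVol K)⁻¹ * (∑ s ∈ extFaces K, U s) * vol κ := by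
  obtain ⟨r, hr⟩ := ((isAdmissible_iff h.toIsComplex hd U _).1 (liftSol_admissible h hd hA U)).2
  have hsum := PolytopalMesh.sum_rtCoef_faceMean hd h.toIsComplex (fun _ _ => 1)
    (fun _ _ _ _ _ _ _ => rfl) (liftSol K A U)
  simp only [mul_one] at hsum
  rw [Finset.sum_congr rfl hr, ← Finset.mul_sum, ← h.cellVol_eq] at hsum
  have hs' : ∑ s ∈ extFaces K, liftSol K A U s * ∑ _κ ∈ star K s, (1 : ℝ) =
      ∑ s ∈ extFaces K, U s := Finset.sum_congr rfl fun s hs => by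
    rw [liftSol_ext K A U hs, Finset.sum_const, (IsComplex.mem_extFaces_iff.1 hs).2]
    simp
  rw [hr κ hκ, ← hs', ← hsum]
  have := (h.toIsComplex.cellVol_pos h.nonempty).ne'
  field_simp

theorem body_subset_cellSet {κ : Finset (E d)} (hκ : κ ∈ K) : body κ ⊆ cellSet K :=
  Set.subset_biUnion_of_mem (u := fun κ => body κ) hκ

instance (K : Finset (Finset (E d))) : IsFiniteMeasure (volume.restrict (cellSet K)) :=
  ⟨by rw [Measure.restrict_apply_univ]; exact (IsComplex.isCompact_cellSet K).measure_lt_top⟩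

/-- Green's formula is applied on each simplex, and the constant divergence lets the volume terms
combine. No relation between `φ` and `g` is needed while the face terms are kept as `faceMean`. -/
theorem IsCell.setIntegral_inner_liftSol (h : IsCell K) (hd : 1 ≤ d) (hA : A.PosDef)
    (U : Finset (E d) → ℝ) {φ : E d → ℝ} {g : E d → E d} (hφ : IntegrableOn φ (cellSet K))
    (hg : MemLp g 2 (volume.restrict (cellSet K))) :
    ∫ x in cellSet K, ⟪g x, rtField K (liftSol K A U) x⟫ =
      ∑ κ ∈ K, ∑ a ∈ κ, rtCoef K (liftSol K A U) κ a * faceMean κ a φ g -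
        (cellVol K)⁻¹ * (∑ s ∈ extFaces K, U s) * ∫ x in cellSet K, φ x := by
  have hgκ : ∀ κ ∈ K, MemLp g 2 (volume.restrict (body κ)) := fun κ hκ =>
    hg.mono_measure (Measure.restrict_mono (body_subset_cellSet hκ) le_rfl)
  have hφκ : ∀ κ ∈ K, IntegrableOn φ (body κ) := fun κ hκ =>
    hφ.mono_set (body_subset_cellSet hκ)
  rw [h.setIntegral_cellSet hφκ, h.setIntegral_cellSet fun κ hκ =>
    integrableOn_inner_body (hgκ κ hκ) ((memLp_rtField K _).restrict _), Finset.mul_sum,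
    ← Finset.sum_sub_distrib]
  refine Finset.sum_congr rfl fun κ hκ => ?_
  have hv := ((h.simplex κ hκ).vol_pos).ne'
  rw [integral_congr_ae (g := fun x => ⟪g x, fluxField κ (rtCoef K (liftSol K A U) κ) x⟫)
    ((rtField_ae_eq h.toIsComplex hκ (liftSol K A U)).mono fun x hx => by simp only [hx]),
    setIntegral_inner_fluxField hd _ (hφκ κ hκ) (hgκ κ hκ), h.sum_rtCoef_liftSol hd hA U hκ]
  congr 2
  field_simp

end liftedField

namespace PolytopalMesh

variable {d : ℕ} {Ω : Set (E d)} (M : PolytopalMesh d Ω)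

theorem restrict_cellSet_le (hreg : interior (closure Ω) = Ω) (K : M.Elem) :
    volume.restrict (cellSet K.1) ≤ volume.restrict Ω := by
  rw [← Measure.restrict_congr_set (IsComplex.cellSet_ae_eq K.1)]
  exact Measure.restrict_mono (Set.iUnion₂_subset fun κ hκ =>
    interior_body_subset hreg (M.body_subset (M.elem_subset K hκ))) le_rfl

/-- Green's theorem for elementwise liftings of fluxes that are opposite from the two sides of the
faces and vanish on the boundary. -/
theorem sum_setIntegral_inner_liftSol (hd : 1 ≤ d) (hΩ : IsOpen Ω)
    (hreg : interior (closure Ω) = Ω) {A : M.Elem → Matrix (Fin d) (Fin d) ℝ}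
    (hA : ∀ K, (A K).PosDef) (W : M.Elem → Finset (E d) → ℝ)
    (hW : ∀ K L : M.Elem, K ≠ L → ∀ s ∈ extFaces K.1, s ∈ extFaces L.1 → W K s = -W L s)
    (hW0 : ∀ K : M.Elem, ∀ s ∈ extFaces K.1, (∀ L : M.Elem, s ∈ extFaces L.1 → L = K) →
      W K s = 0)
    {φ : E d → ℝ} {g : E d → E d} (hφ : IsWeakGradient Ω φ g) :
    ∑ K : M.Elem, ∫ x in cellSet K.1, ⟪g x, rtField K.1 (liftSol K.1 (A K) (W K)) x⟫ =
      -∑ K : M.Elem,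
        (cellVol K.1)⁻¹ * (∑ s ∈ extFaces K.1, W K s) * ∫ x in cellSet K.1, φ x := by
  have hle := M.restrict_cellSet_le hreg
  have hfin := M.volume_ne_top
  have : IsFiniteMeasure (volume.restrict Ω) :=
    ⟨by rw [Measure.restrict_apply_univ]; exact hfin.lt_top⟩
  have hb := M.sum_balance hd (fun κ a => faceMean κ a φ g)
    (fun κ κ' a a' h hκ hκ' => h.faceMean_eq hd hΩ hreg hfin (M.body_subset hκ)
      (M.body_subset hκ') hφ) (fun K => liftSol K.1 (A K) (W K))
    (fun K L hne s hs hs' => by rw [liftSol_ext _ _ _ hs, liftSol_ext _ _ _ hs', hW K L hne s hs hs'])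
    (fun K s hs h => by rw [liftSol_ext _ _ _ hs, hW0 K s hs h])
  rw [Finset.sum_congr rfl fun K _ => (M.isCell K).setIntegral_inner_liftSol hd (hA K) (W K)
    ((hφ.1.integrable one_le_two).mono_measure (hle K)) (hφ.2.1.mono_measure (hle K)),
    Finset.sum_sub_distrib, hb, zero_sub]

end PolytopalMesh

/-! ### Distribution of the face fluxes -/

namespace Step

variable {Ph Co : Type*} [Fintype Ph] [Fintype Co] {d n : ℕ} {P : Problem d Ph Co} (S : Step P n)

theorem spread_apply (F : (P.mesh n).Face → ℝ) {σ : (P.mesh n).Face} {s : Finset (E d)}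
    (hs : s ∈ σ.1) : S.spread F s =
      if (P.mesh n).IsInterior σ then F σ / (P.mesh n).faceArea σ * area s else 0 := by
  rw [spread, Finset.sum_eq_single σ]
  · simp only [hs, true_and]
  · exact fun σ' _ hne => if_neg fun h => hne ((P.mesh n).face_eq h.1 hs)
  · exact fun h => absurd (Finset.mem_univ _) h

theorem spread_combination (c c' : ℝ) (F G : (P.mesh n).Face → ℝ) (s : Finset (E d)) :
    S.spread (fun σ => c * F σ + c' * G σ) s = c * S.spread F s + c' * S.spread G s := by
  simp only [spread, Finset.mul_sum, ← Finset.sum_add_distrib]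
  refine Finset.sum_congr rfl fun σ _ => ?_
  split_ifs <;> ring

/-- The area fractions of the subfaces of a polytopal face add up to one, so the lifted field has
the same net outflow as the finite volume scheme. -/
theorem sum_spread (hd : 1 ≤ d) (F : (P.mesh n).Face → ℝ) (K : (P.mesh n).Elem) :
    ∑ s ∈ extFaces K.1, S.spread F s =
      ∑ σ ∈ ((P.mesh n).facesOf K).filter (P.mesh n).IsInterior, F σ := by
  simp only [spread]
  rw [Finset.sum_comm, PolytopalMesh.facesOf, Finset.filter_filter, Finset.sum_filter]
  refine Finset.sum_congr rfl fun σ _ => ?_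
  by_cases hI : (P.mesh n).IsInterior σ
  · simp only [hI, and_true]
    rw [← Finset.sum_filter]
    by_cases hK : σ.1 ⊆ extFaces K.1
    · have hA := ((P.mesh n).faceArea_pos hd σ).ne'
      rw [if_pos hK, Finset.filter_mem_eq_inter, Finset.inter_eq_right.2 hK, ← Finset.mul_sum,
        ← PolytopalMesh.faceArea, div_mul_cancel₀ _ hA]
    · rw [if_neg hK, Finset.filter_false_of_mem, Finset.sum_empty]
      exact fun s hs hsσ => hK (Finset.mem_filter.1 (((P.mesh n).mem_facesOf_iff hsσ).2 hs)).2
  · simp only [hI, and_false, if_false, Finset.sum_const_zero]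

theorem sign_eq_neg (hd : 1 ≤ d) {K L : (P.mesh n).Elem} (hne : K ≠ L) {σ : (P.mesh n).Face}
    (hK : σ ∈ (P.mesh n).facesOf K) (hL : σ ∈ (P.mesh n).facesOf L) :
    S.sign K σ = -S.sign L σ := by
  obtain ⟨s, hs⟩ := (P.mesh n).faces.nonempty_of_mem_parts σ.2
  have hp := S.disc.plus_mem σ
  rw [(P.mesh n).mem_facesOf_iff hs] at hK hL hp
  by_cases h : K = S.disc.plus σ
  · rw [sign, sign, if_pos h, if_neg fun h' => hne (h.trans h'.symm), neg_neg]
  · have h' : L = S.disc.plus σ := (P.mesh n).eq_of_mem_extFaces hd hK hL hp hne h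
    rw [sign, sign, if_neg h, if_pos h']

/-- Spread fluxes with a fixed direction are opposite from the two sides of the faces. -/
theorem spread_sign_eq_neg (hd : 1 ≤ d) (f : (P.mesh n).Face → ℝ) {K L : (P.mesh n).Elem}
    (hne : K ≠ L) {s : Finset (E d)} (hK : s ∈ extFaces K.1) (hL : s ∈ extFaces L.1) :
    S.spread (fun σ => S.sign K σ * f σ) s = -S.spread (fun σ => S.sign L σ * f σ) s := by
  obtain ⟨σ, hσ⟩ := (P.mesh n).exists_face hK
  rw [S.spread_apply _ hσ, S.spread_apply _ hσ, S.sign_eq_neg hd hne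
    (((P.mesh n).mem_facesOf_iff hσ).2 hK) (((P.mesh n).mem_facesOf_iff hσ).2 hL)]
  split_ifs <;> ring

theorem spread_eq_zero (F : (P.mesh n).Face → ℝ) {K : (P.mesh n).Elem} {s : Finset (E d)}
    (hK : s ∈ extFaces K.1) (h : ∀ L : (P.mesh n).Elem, s ∈ extFaces L.1 → L = K) :
    S.spread F s = 0 := by
  obtain ⟨σ, hσ⟩ := (P.mesh n).exists_face hK
  rw [S.spread_apply _ hσ, if_neg]
  rw [(P.mesh n).isInterior_iff hσ]
  rintro ⟨J, L, hne, hJ, hL⟩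
  exact hne ((h J hJ).trans (h L hL).symm)

end Step

/-! ### Piecewise affine functions -/

section interpolant

variable {d : ℕ}

/-- The affine function with the values `Z` at the vertices of `κ`. -/
def interpolant (κ : Finset (E d)) (Z : E d → ℝ) : E d →ᵃ[ℝ] ℝ := ∑ a ∈ κ, Z a • bary κ a

theorem IsSimplex.interpolant_vertex {κ : Finset (E d)} (h : IsSimplex κ) (Z : E d → ℝ) {b : E d}
    (hb : b ∈ κ) : interpolant κ Z b = Z b := by
  rw [interpolant, sum_affineMap_apply, Finset.sum_eq_single b]
  · rw [AffineMap.coe_smul, Pi.smul_apply, h.bary_self hb, smul_eq_mul, mul_one]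
  · intro a _ hne
    rw [AffineMap.coe_smul, Pi.smul_apply, h.bary_of_ne hb hne.symm, smul_zero]
  · exact fun hn => absurd hb hn

theorem interpolant_combination (κ : Finset (E d)) (c c' : ℝ) (Z Z' : E d → ℝ) :
    interpolant κ (fun a => c * Z a + c' * Z' a) = c • interpolant κ Z + c' • interpolant κ Z' := by
  simp only [interpolant, Finset.smul_sum, ← Finset.sum_add_distrib, add_smul, mul_smul]

/-- An affine function on a face is determined by its values at the vertices. -/
theorem affineMap_congr_face {s : Finset (E d)} {f g : E d →ᵃ[ℝ] ℝ} (hfg : ∀ b ∈ s, f b = g b)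
    {x : E d} (hx : x ∈ body s) : f x = g x := by
  have hsub : body s ⊆ {y | (f - g) y = 0} := by
    refine convexHull_min (fun b hb => ?_) ?_
    · rw [Set.mem_ofPred_eq, AffineMap.coe_sub, Pi.sub_apply, hfg b hb, sub_self]
    · exact (convex_singleton (0 : ℝ)).affine_preimage (f - g)
  have := hsub hx
  rw [Set.mem_ofPred_eq, AffineMap.coe_sub, Pi.sub_apply] at this
  exact sub_eq_zero.1 this

/-- The piecewise affine function with the values `Z` at the vertices. -/
def interpVal (T : Finset (Finset (E d))) (Z : E d → ℝ) (x : E d) : ℝ :=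
  ∑ κ ∈ T, (interior (body κ)).indicator (interpolant κ Z) x

/-- The elementwise gradient of the piecewise affine function with the values `Z`. -/
def interpGrad (T : Finset (Finset (E d))) (Z : E d → ℝ) (x : E d) : E d :=
  ∑ κ ∈ T, (interior (body κ)).indicator (fun _ => affGrad (interpolant κ Z)) x

theorem interpVal_combination (T : Finset (Finset (E d))) (c c' : ℝ) (Z Z' : E d → ℝ) (x : E d) :
    interpVal T (fun a => c * Z a + c' * Z' a) x = c * interpVal T Z x + c' * interpVal T Z' x := by
  simp only [interpVal, interpolant_combination, Finset.mul_sum, ← Finset.sum_add_distrib]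
  refine Finset.sum_congr rfl fun κ _ => ?_
  by_cases hx : x ∈ interior (body κ)
  · simp only [Set.indicator_of_mem hx]
    rfl
  · simp only [Set.indicator_of_notMem hx, mul_zero, add_zero]

theorem interpGrad_combination (T : Finset (Finset (E d))) (c c' : ℝ) (Z Z' : E d → ℝ) (x : E d) :
    interpGrad T (fun a => c * Z a + c' * Z' a) x =
      c • interpGrad T Z x + c' • interpGrad T Z' x := by
  simp only [interpGrad, interpolant_combination, Finset.smul_sum, ← Finset.sum_add_distrib]
  refine Finset.sum_congr rfl fun κ _ => ?_
  by_cases hx : x ∈ interior (body κ)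
  · simp only [Set.indicator_of_mem hx, affGrad_add, affGrad_smul]
  · simp only [Set.indicator_of_notMem hx, smul_zero, add_zero]

theorem memLp_interpVal (T : Finset (Finset (E d))) (Z : E d → ℝ) :
    MemLp (interpVal T Z) 2 volume := by
  refine memLp_finsetSum T fun κ _ => ?_
  rw [memLp_indicator_iff_restrict isOpen_interior.measurableSet]
  exact (memLp_body κ (continuous_affineMap _)).mono_measure
    (Measure.restrict_mono interior_subset le_rfl)

theorem memLp_interpGrad (T : Finset (Finset (E d))) (Z : E d → ℝ) :
    MemLp (interpGrad T Z) 2 volume := by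
  refine memLp_finsetSum T fun κ _ => ?_
  rw [memLp_indicator_iff_restrict isOpen_interior.measurableSet]
  exact (memLp_body κ continuous_const).mono_measure
    (Measure.restrict_mono interior_subset le_rfl)

end interpolant

namespace IsComplex

variable {d : ℕ} {T : Finset (Finset (E d))}

theorem sum_indicator (h : IsComplex T) {F : Type*} [AddCommMonoid F]
    (f : Finset (E d) → E d → F) {κ : Finset (E d)} (hκ : κ ∈ T) {x : E d}
    (hx : x ∈ interior (body κ)) :
    ∑ κ' ∈ T, (interior (body κ')).indicator (f κ') x = f κ x := by
  rw [Finset.sum_eq_single κ, Set.indicator_of_mem hx]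
  · exact fun κ' hκ' hne => Set.indicator_of_notMem (fun hx' =>
      (Set.disjoint_left.1 (h.aedisjoint hκ' hκ hne) hx') (interior_subset hx)) _
  · exact fun hn => absurd hκ hn

theorem interpVal_ae_eq (h : IsComplex T) (Z : E d → ℝ) {κ : Finset (E d)} (hκ : κ ∈ T) :
    interpVal T Z =ᵐ[volume.restrict (body κ)] interpolant κ Z := by
  rw [← Measure.restrict_congr_set (interior_body_ae_eq κ)]
  exact (ae_restrict_mem isOpen_interior.measurableSet).mono fun x hx =>
    h.sum_indicator (fun κ => interpolant κ Z) hκ hx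

theorem interpGrad_ae_eq (h : IsComplex T) (Z : E d → ℝ) {κ : Finset (E d)} (hκ : κ ∈ T) :
    interpGrad T Z =ᵐ[volume.restrict (body κ)] fun _ => affGrad (interpolant κ Z) := by
  rw [← Measure.restrict_congr_set (interior_body_ae_eq κ)]
  exact (ae_restrict_mem isOpen_interior.measurableSet).mono fun x hx =>
    h.sum_indicator (fun κ _ => affGrad (interpolant κ Z)) hκ hx

/-- A face that belongs to only one simplex does not meet the domain. -/
theorem disjoint_of_card_star (h : IsComplex T) (hd : 1 ≤ d) {Ω : Set (E d)} (hΩ : IsOpen Ω)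
    (hcov : Ω ⊆ cellSet T) {s : Finset (E d)} (hs : s ∈ extFaces T) : Disjoint (body s) Ω := by
  obtain ⟨hsub, hc⟩ := mem_extFaces_iff.1 hs
  have hcard := card_of_mem_subfaces hsub
  obtain ⟨κ, hκ⟩ := Finset.card_eq_one.1 hc
  have hκs : κ ∈ star T s := hκ ▸ Finset.mem_singleton_self κ
  obtain ⟨hκT, hsκ⟩ := Finset.mem_filter.1 hκs
  have hsimp := h.simplex κ hκT
  have hopp := hsimp.opp_mem hsκ hcard
  have herase := hsimp.erase_opp hsκ hcard
  have hd0 : (0 : ℝ) < (d : ℝ)⁻¹ := by positivity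
  -- A point in the relative interior of such a face lies in no other simplex. If it were in `Ω`, a
  -- neighborhood of it would be covered by `κ` alone and it would be interior to `κ`, although its
  -- coordinate at the opposite vertex is zero.
  have key : ∀ y ∈ body s, (∀ b ∈ s, 0 < bary κ b y) → y ∉ Ω := by
    intro y hy hpos hyΩ
    have h0 : bary κ (opp κ s) y = 0 := bary_eq_zero_of_mem_face hsimp (herase.symm ▸ hy)
    have hother : ∀ κ' ∈ T, y ∈ body κ' → κ' = κ := by
      intro κ' hκ' hyκ'
      have hy2 := h.inter κ hκT κ' hκ' ⟨body_mono hsκ hy, hyκ'⟩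
      have hsub' : s ⊆ κ' := by
        intro b hb
        by_contra hbκ'
        refine (hpos b hb).ne' (bary_eq_zero_of_mem_face hsimp (body_mono ?_ hy2))
        intro c hc
        exact Finset.mem_erase.2 ⟨fun hcb => hbκ' (hcb ▸ (Finset.mem_inter.1 hc).2),
          (Finset.mem_inter.1 hc).1⟩
      have hm : κ' ∈ star T s := Finset.mem_filter.2 ⟨hκ', hsub'⟩
      rwa [hκ, Finset.mem_singleton] at hm
    have hclosed : IsClosed (⋃ κ' ∈ T.erase κ, body κ') :=
      (T.erase κ).finite_toSet.isClosed_biUnion fun κ' _ => isClosed_body κ'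
    have hmem : y ∈ interior (body κ) := by
      refine mem_interior.2 ⟨Ω ∩ (⋃ κ' ∈ T.erase κ, body κ')ᶜ, ?_,
        hΩ.inter hclosed.isOpen_compl, hyΩ, ?_⟩
      · rintro x ⟨hxΩ, hx⟩
        obtain ⟨κ', hκ', hxκ'⟩ := Set.mem_iUnion₂.1 (hcov hxΩ)
        by_cases hne : κ' = κ
        · exact hne ▸ hxκ'
        · exact absurd (Set.mem_iUnion₂.2 ⟨κ', Finset.mem_erase.2 ⟨hne, hκ'⟩, hxκ'⟩) hx
      · intro hy'
        obtain ⟨κ', hκ', hyκ'⟩ := Set.mem_iUnion₂.1 hy'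
        exact (Finset.mem_erase.1 hκ').1 (hother κ' (Finset.mem_erase.1 hκ').2 hyκ')
    rw [hsimp.interior_body_eq] at hmem
    exact (hmem _ hopp).ne' h0
  refine Set.disjoint_left.2 fun y hy hyΩ => ?_
  -- A general point of the face is moved slightly towards the barycenter: it stays in the open set
  -- `Ω`, and its coordinates at the face vertices become positive.
  set m : E d := (d : ℝ)⁻¹ • ∑ b ∈ s, b with hm
  have hbm : ∀ b ∈ s, bary κ b m = (d : ℝ)⁻¹ := fun b hb => by
    rw [hm, affineMap_centroid hd hcard, Finset.sum_eq_single b, hsimp.bary_self (hsκ hb), mul_one]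
    · exact fun c hc hcb => hsimp.bary_of_ne (hsκ hc) hcb
    · exact fun hn => absurd hb hn
  have hmem : m ∈ body s := by
    rw [hm, Finset.smul_sum]
    refine (convex_body s).sum_mem (fun _ _ => hd0.le) ?_ fun b hb => subset_body s hb
    rw [Finset.sum_const, hcard, nsmul_eq_mul]
    have : (d : ℝ) ≠ 0 := by positivity
    field_simp
  have hcont : ContinuousAt (fun t : ℝ => AffineMap.lineMap y m t) 0 := by
    fun_prop
  have hev : ∀ᶠ t in nhds (0 : ℝ), AffineMap.lineMap y m t ∈ Ω :=
    hcont.eventually_mem (hΩ.mem_nhds (by simpa using hyΩ))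
  obtain ⟨ε, hε, hball⟩ := Metric.eventually_nhds_iff.1 hev
  set t : ℝ := min (ε / 2) 1 with ht
  have ht0 : 0 < t := by positivity
  have ht1 : t ≤ 1 := min_le_right _ _
  have htε : dist t 0 < ε := by
    rw [Real.dist_0_eq_abs, abs_of_pos ht0]
    exact (min_le_left _ _).trans_lt (by linarith)
  refine key (AffineMap.lineMap y m t) ?_ ?_ (hball htε)
  · exact (convex_body s).lineMap_mem hy hmem ⟨ht0.le, ht1⟩
  · intro b hb
    have hy0 : 0 ≤ bary κ b y := by
      have := body_mono hsκ hy
      rw [hsimp.body_eq] at this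
      exact this b (hsκ hb)
    rw [AffineMap.apply_lineMap, AffineMap.lineMap_apply_module, hbm b hb]
    have : 0 ≤ (1 - t) * bary κ b y := mul_nonneg (by linarith) hy0
    have h2 : 0 < t * (d : ℝ)⁻¹ := mul_pos ht0 hd0
    simp only [smul_eq_mul]
    linarith

end IsComplex

/-! ### Weak differentiability of continuous piecewise affine functions. -/

section conformity

variable {d : ℕ}

theorem IsSimplex.sum_linear_bary {κ : Finset (E d)} (h : IsSimplex κ) (e : E d) :
    ∑ a ∈ κ, (bary κ a).linear e = 0 := by
  have : ∀ a, (bary κ a).linear e = bary κ a e - bary κ a 0 := fun a => by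
    rw [affineMap_sub_eq, sub_zero]
  simp only [this, Finset.sum_sub_distrib, h.sum_bary, sub_self]

theorem IsSimplex.sum_linear_bary_smul {κ : Finset (E d)} (h : IsSimplex κ) (e : E d) :
    ∑ a ∈ κ, (bary κ a).linear e • a = e := by
  have : ∀ a, (bary κ a).linear e = bary κ a e - bary κ a 0 := fun a => by
    rw [affineMap_sub_eq, sub_zero]
  simp only [this, sub_smul, Finset.sum_sub_distrib, h.sum_bary_smul, sub_zero]

/-- The face fluxes of a constant field. -/
def constCoef (κ : Finset (E d)) (e a : E d) : ℝ :=
  -(d * ⟪vol κ • affGrad (bary κ a), e⟫)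

theorem constCoef_eq (κ : Finset (E d)) (e a : E d) :
    constCoef κ e a = -(d * vol κ) * (bary κ a).linear e := by
  rw [constCoef, real_inner_smul_left, inner_affGrad]
  ring

theorem IsSimplex.sum_constCoef {κ : Finset (E d)} (h : IsSimplex κ) (e : E d) :
    ∑ a ∈ κ, constCoef κ e a = 0 := by
  simp only [constCoef_eq, ← Finset.mul_sum, h.sum_linear_bary, mul_zero]

theorem IsSimplex.fluxField_constCoef {κ : Finset (E d)} (h : IsSimplex κ) (hd : 1 ≤ d)
    (e x : E d) : fluxField κ (constCoef κ e) x = e := by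
  have hv := h.vol_pos.ne'
  have hd0 : (d : ℝ) ≠ 0 := by positivity
  have h1 : ∀ a, (constCoef κ e a * ((d : ℝ) * vol κ)⁻¹) = -(bary κ a).linear e := fun a => by
    rw [constCoef_eq]
    field_simp
  simp only [fluxField, h1, smul_sub, Finset.sum_sub_distrib, ← Finset.sum_smul,
    Finset.sum_neg_distrib, neg_smul, h.sum_linear_bary, h.sum_linear_bary_smul]
  simp

/-- A constant field has matching normal fluxes from the two sides of a face; `smul_affGrad`
expresses this without normals or face areas. -/
theorem Adjacent.constCoef_add {κ κ' : Finset (E d)} {a a' : E d} (h : Adjacent κ κ' a a')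
    (hd : 1 ≤ d) (e : E d) : constCoef κ e a + constCoef κ' e a' = 0 := by
  rw [constCoef, constCoef, h.smul_affGrad hd, inner_neg_left]
  ring

theorem inner_gradient_eq {f : E d → ℝ} {x : E d} (v : E d) :
    ⟪gradient f x, v⟫ = fderiv ℝ f x v := by
  rw [gradient, InnerProductSpace.toDual_symm_apply]

theorem continuous_gradient {f : E d → ℝ} (hf : ContDiff ℝ 1 f) : Continuous (gradient f) :=
  (InnerProductSpace.toDual ℝ (E d)).symm.continuous.comp (hf.continuous_fderiv one_ne_zero)

theorem contDiff_affineMap (f : E d →ᵃ[ℝ] ℝ) : ContDiff ℝ 1 f := by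
  have hf : (f : E d → ℝ) = fun x => LinearMap.toContinuousLinearMap f.linear x + f 0 := by
    funext x
    exact congrFun (AffineMap.decomp f) x
  rw [hf]
  exact (ContinuousLinearMap.contDiff _).add contDiff_const

namespace IsComplex

variable {T : Finset (Finset (E d))}

/-- On a face with two simplices the fluxes of the constant field cancel, since the two affine
pieces agree there. A face with only one simplex does not meet `Ω`, so `ψ` vanishes on it. -/
theorem sum_constCoef_faceMean (h : IsComplex T) (hd : 1 ≤ d) {Ω : Set (E d)} (hΩ : IsOpen Ω)
    (hcov : Ω ⊆ cellSet T) (Z : E d → ℝ) (e : E d) {ψ : E d → ℝ} (hψ : ContDiff ℝ 1 ψ)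
    (hsupp : ∀ x ∉ Ω, ψ x = 0) :
    ∑ κ ∈ T, ∑ a ∈ κ, constCoef κ e a * faceMean κ a (fun x => interpolant κ Z x * ψ x)
      (gradient fun x => interpolant κ Z x * ψ x) = 0 := by
  have hC : ∀ κ, ContDiff ℝ 1 fun x => interpolant κ Z x * ψ x := fun κ =>
    (contDiff_affineMap _).mul hψ
  set f : Finset (E d) → Finset (E d) → ℝ := fun s κ => constCoef κ e (opp κ s) *
    faceMean κ (opp κ s) (fun x => interpolant κ Z x * ψ x)
      (gradient fun x => interpolant κ Z x * ψ x) with hf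
  have h1 : ∀ κ ∈ T, ∀ a ∈ κ, constCoef κ e a * faceMean κ a (fun x => interpolant κ Z x * ψ x)
      (gradient fun x => interpolant κ Z x * ψ x) = f (κ.erase a) κ := fun κ _ a ha => by
    simp only [hf, opp_erase ha]
  rw [Finset.sum_congr rfl fun κ hκ => Finset.sum_congr rfl (h1 κ hκ), h.sum_sum_subfaces f]
  refine Finset.sum_eq_zero fun s hs => ?_
  have hcard := card_of_mem_subfaces hs
  by_cases hc : (star T s).card = 1
  · refine Finset.sum_eq_zero fun κ hκ => ?_
    obtain ⟨hκT, hsκ⟩ := Finset.mem_filter.1 hκ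
    have hsimp := h.simplex κ hκT
    have hopp := hsimp.opp_mem hsκ hcard
    have hdisj := h.disjoint_of_card_star hd hΩ hcov (mem_extFaces_iff.2 ⟨hs, hc⟩)
    rw [hf]
    dsimp only
    rw [hsimp.faceMean_congr hsimp hopp hopp rfl (hC κ) (contDiff_const (c := (0 : ℝ)))]
    · simp [faceMean]
    · intro y hy
      rw [hsimp.erase_opp hsκ hcard] at hy
      rw [hsupp y (Set.disjoint_left.1 hdisj hy), mul_zero]
  · obtain ⟨κ, hκ, κ', hκ', hne⟩ := Finset.one_lt_card.1
      (lt_of_le_of_ne (Finset.card_pos.2 (star_nonempty_of_mem_subfaces hs)) (Ne.symm hc))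
    have hadj := h.adjacent hcard hκ hκ' hne
    rw [h.star_eq_pair hd hcard hκ hκ' hne, Finset.sum_pair hne, hf]
    dsimp only
    rw [hadj.left.faceMean_congr hadj.right hadj.mem_left hadj.mem_right hadj.erase_eq (hC κ)
      (hC κ'), ← add_mul, hadj.constCoef_add hd, zero_mul]
    intro y hy
    rw [affineMap_congr_face (f := interpolant κ Z) (g := interpolant κ' Z) (fun b hb => ?_) hy]
    rw [hadj.left.interpolant_vertex Z (hadj.mem_left_of_mem hb),
      hadj.right.interpolant_vertex Z (hadj.mem_right_of_mem hb)]

theorem domain_ae_eq {Ω : Set (E d)} (hreg : interior (closure Ω) = Ω)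
    (hcov : cellSet T = closure Ω) : Ω =ᵐ[volume] cellSet T := by
  refine Filter.EventuallyLE.antisymm ?_ ?_
  · exact (hcov.symm ▸ subset_closure : Ω ⊆ cellSet T).eventuallyLE
  · refine (cellSet_ae_eq T).symm.le.trans (Set.iUnion₂_subset fun κ hκ => ?_ : _ ⊆ Ω).eventuallyLE
    exact interior_body_subset hreg (hcov ▸ body_subset_cellSet hκ)

/-- A continuous piecewise affine function is weakly differentiable. -/
theorem isWeakGradient_interp (h : IsComplex T) (hd : 1 ≤ d) {Ω : Set (E d)} (hΩ : IsOpen Ω)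
    (hreg : interior (closure Ω) = Ω) (hcov : cellSet T = closure Ω) (Z : E d → ℝ) :
    IsWeakGradient Ω (interpVal T Z) (interpGrad T Z) := by
  refine ⟨(memLp_interpVal T Z).restrict _, (memLp_interpGrad T Z).restrict _, ?_⟩
  rintro ψ ⟨hψ, -, hsupp⟩ i
  set e : E d := EuclideanSpace.single i 1 with he
  have hψ1 : ContDiff ℝ 1 ψ := hψ.of_le (by simp)
  have hcd : Continuous fun x => fderiv ℝ ψ x e :=
    (hψ1.continuous_fderiv one_ne_zero).clm_apply continuous_const
  have hzero : ∀ x ∉ Ω, ψ x = 0 := fun x hx =>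
    image_eq_zero_of_notMem_tsupport fun hx' => hx (hsupp hx')
  have hg : ∀ v : E d, v i = ⟪v, e⟫ := fun v => by
    rw [he, EuclideanSpace.inner_single_right]
    simp
  have e1 : ∀ κ ∈ T, (fun x => interpVal T Z x * fderiv ℝ ψ x e) =ᵐ[volume.restrict (body κ)]
      fun x => interpolant κ Z x * fderiv ℝ ψ x e := fun κ hκ =>
    (h.interpVal_ae_eq Z hκ).mono fun x hx => by simp only [hx]
  have e2 : ∀ κ ∈ T, (fun x => interpGrad T Z x i * ψ x) =ᵐ[volume.restrict (body κ)]
      fun x => ⟪affGrad (interpolant κ Z), e⟫ * ψ x := fun κ hκ =>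
    (h.interpGrad_ae_eq Z hκ).mono fun x hx => by simp only [hx, hg]
  have i1 : ∀ κ, IntegrableOn (fun x => interpolant κ Z x * fderiv ℝ ψ x e) (body κ) := fun κ =>
    integrableOn_body ((continuous_affineMap _).mul hcd)
  have i2 : ∀ κ, IntegrableOn (fun x => ⟪affGrad (interpolant κ Z), e⟫ * ψ x) (body κ) := fun κ =>
    integrableOn_body (continuous_const.mul hψ1.continuous)
  rw [setIntegral_congr_set (domain_ae_eq hreg hcov), setIntegral_congr_set
    (domain_ae_eq hreg hcov), h.setIntegral_cellSet fun κ hκ => (i1 κ).congr (e1 κ hκ).symm,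
    h.setIntegral_cellSet fun κ hκ => (i2 κ).congr (e2 κ hκ).symm, eq_neg_iff_add_eq_zero,
    ← Finset.sum_add_distrib,
    ← h.sum_constCoef_faceMean hd hΩ (hcov ▸ subset_closure) Z e hψ1 hzero]
  refine Finset.sum_congr rfl fun κ hκ => ?_
  have hsimp := h.simplex κ hκ
  have hC : ContDiff ℝ 1 fun x => interpolant κ Z x * ψ x := (contDiff_affineMap _).mul hψ1
  -- Green's formula for the divergence-free field `e` and the product of the affine piece with `ψ`.
  -- The product rule yields the two integrands of the weak gradient identity, and the face terms
  -- are those that cancel in the sum.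
  have hgreen := setIntegral_inner_fluxField hd (constCoef κ e)
    (φ := fun x => interpolant κ Z x * ψ x) (g := gradient fun x => interpolant κ Z x * ψ x)
    (integrableOn_body (κ := κ) hC.continuous) (memLp_body κ (continuous_gradient hC))
  rw [hsimp.sum_constCoef, mul_zero, zero_mul, sub_zero] at hgreen
  rw [integral_congr_ae (e1 κ hκ), integral_congr_ae (e2 κ hκ), ← integral_add (i1 κ) (i2 κ),
    ← hgreen]
  refine integral_congr_ae (Filter.Eventually.of_forall fun x => ?_)
  dsimp only
  rw [hsimp.fluxField_constCoef hd, inner_gradient_eq, inner_affGrad]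
  have hd1 : HasFDerivAt (fun x => interpolant κ Z x * ψ x) _ x :=
    (hasFDerivAt_affineMap (interpolant κ Z) x).mul
      (hψ1.differentiable one_ne_zero x).hasFDerivAt
  rw [HasFDerivAt.fderiv hd1]
  simp [mul_comm]

end IsComplex

end conformity

/-! ### The nonconformity of a lifted flux -/

section nonconformity

variable {d : ℕ} {A : Matrix (Fin d) (Fin d) ℝ}

/-- In the cross term `A⁻¹` cancels `A`, so this term carries no weight and is accessible to Green's
formula. -/
theorem normSq_add_act (hA : A.PosDef) (u g : E d) :
    normSq A⁻¹ (u + act A g) = normSq A⁻¹ u + normSq A g + 2 * ⟪g, u⟫ := by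
  have hadd : ∀ v w, act A⁻¹ (v + w) = act A⁻¹ v + act A⁻¹ w := fun v w =>
    map_add (actLin A⁻¹) v w
  have h1 : ⟪act A⁻¹ u, act A g⟫ = ⟪g, u⟫ := by
    rw [inner_act_comm hA.inv, act_inv_act hA, real_inner_comm]
  rw [normSq, hadd, act_inv_act hA, inner_add_left, inner_add_right, inner_add_right, h1, normSq,
    normSq, real_inner_comm g (act A g)]
  ring

variable {K T : Finset (Finset (E d))}

theorem IsComplex.interpolant_eq_sum_verts (h : IsComplex K) {κ : Finset (E d)} (hκ : κ ∈ K)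
    (Z : E d → ℝ) : interpolant κ Z = ∑ a : verts K, Z a.1 • bary κ a.1 := by
  rw [interpolant, Finset.sum_coe_sort (verts K) fun a => Z a • bary κ a]
  refine Finset.sum_subset (Finset.subset_biUnion_of_mem id hκ) fun a _ ha => ?_
  rw [(h.simplex κ hκ).bary_eq_zero ha, smul_zero]

theorem dotProduct_sum_mulVec {V : Type*} [Fintype V] (m : Finset (E d) → V → V → ℝ)
    (y z : V → ℝ) :
    y ⬝ᵥ (Matrix.of fun a a' => ∑ κ ∈ K, m κ a a') *ᵥ z =
      ∑ κ ∈ K, ∑ a, ∑ a', y a * z a' * m κ a a' := by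
  simp only [dotProduct, Matrix.mulVec, Matrix.of_apply, Finset.sum_mul, Finset.mul_sum]
  rw [Finset.sum_congr rfl fun a _ => Finset.sum_comm, Finset.sum_comm]
  refine Finset.sum_congr rfl fun κ _ => Finset.sum_congr rfl fun a _ =>
    Finset.sum_congr rfl fun a' _ => ?_
  ring

theorem IsComplex.stiffMatrix_form (h : IsComplex K) (A : Matrix (Fin d) (Fin d) ℝ)
    (Z : E d → ℝ) :
    (fun a : verts K => Z a.1) ⬝ᵥ stiffMatrix K A *ᵥ (fun a : verts K => Z a.1) =
      ∑ κ ∈ K, ∫ _ in body κ, normSq A (affGrad (interpolant κ Z)) := by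
  rw [stiffMatrix, dotProduct_sum_mulVec (fun κ (a a' : verts K) => ∫ x in body κ,
    ⟪act A (gradient (hat κ a'.1) x), gradient (hat κ a.1) x⟫)]
  refine Finset.sum_congr rfl fun κ hκ => ?_
  simp only [hat_eq_bary, gradient_affineMap, setIntegral_const_body]
  rw [h.interpolant_eq_sum_verts hκ, affGrad_sum, normSq, ← actLin_apply, map_sum, inner_sum,
    Finset.mul_sum]
  refine Finset.sum_congr rfl fun a _ => ?_
  rw [sum_inner, Finset.mul_sum]
  refine Finset.sum_congr rfl fun a' _ => ?_
  rw [affGrad_smul, affGrad_smul, map_smul, real_inner_smul_left, real_inner_smul_right,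
    actLin_apply]
  ring

/-- The hat functions add up to one on each simplex, so testing with the constant vector integrates
the interpolant. -/
theorem IsComplex.massMatrix_form (h : IsComplex K) (Z : E d → ℝ) :
    (fun _ : verts K => (1 : ℝ)) ⬝ᵥ massMatrix K *ᵥ (fun a : verts K => Z a.1) =
      ∑ κ ∈ K, ∫ x in body κ, interpolant κ Z x := by
  rw [massMatrix, dotProduct_sum_mulVec (fun κ (a a' : verts K) => ∫ x in body κ,
    hat κ a'.1 x * hat κ a.1 x)]
  refine Finset.sum_congr rfl fun κ hκ => ?_
  have hone : ∀ x, ∑ a : verts K, bary κ a.1 x = 1 := fun x => by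
    rw [← (h.simplex κ hκ).sum_bary x, Finset.sum_coe_sort (verts K) fun a => bary κ a x]
    refine (Finset.sum_subset (Finset.subset_biUnion_of_mem id hκ) fun a _ ha => ?_).symm
    rw [(h.simplex κ hκ).bary_eq_zero ha]
    rfl
  have hint : ∀ a a' : verts K, IntegrableOn
      (fun x => 1 * Z a'.1 * (bary κ a'.1 x * bary κ a.1 x)) (body κ) := fun a a' =>
    integrableOn_body (continuous_const.mul
      ((continuous_affineMap _).mul (continuous_affineMap _)))
  simp only [hat_eq_bary, ← integral_const_mul]
  rw [Finset.sum_congr rfl fun a _ => (integral_finsetSum _ fun a' _ => hint a a').symm,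
    ← integral_finsetSum _ fun a _ => integrable_finsetSum _ fun a' _ => hint a a']
  refine integral_congr_ae (Filter.Eventually.of_forall fun x => ?_)
  dsimp only
  rw [h.interpolant_eq_sum_verts hκ, sum_affineMap_apply, Finset.sum_comm]
  refine Finset.sum_congr rfl fun a' _ => ?_
  rw [AffineMap.coe_smul, Pi.smul_apply, smul_eq_mul]
  simp only [one_mul]
  rw [← Finset.mul_sum, ← Finset.mul_sum, hone, mul_one]

/-- The distance of a lifted flux to the gradient of a piecewise affine function in terms of the
element matrices. -/
theorem IsCell.setIntegral_normSq_liftSol_add (h : IsCell K) (hT : IsComplex T) (hKT : K ⊆ T)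
    (hd : 1 ≤ d) (hA : A.PosDef) (U : Finset (E d) → ℝ) (Z : E d → ℝ) :
    ∫ x in cellSet K, normSq A⁻¹ (rtField K (liftSol K A U) x + act A (interpGrad T Z x)) =
      (fun s : extFaces K => U s.1) ⬝ᵥ mfeMatrix K A *ᵥ (fun s : extFaces K => U s.1) +
      (fun a : verts K => Z a.1) ⬝ᵥ stiffMatrix K A *ᵥ (fun a : verts K => Z a.1) +
      2 * ∑ s ∈ extFaces K, U s * (1 / (d : ℝ) * ∑ a ∈ s, Z a) -
      2 * (∑ s ∈ extFaces K, U s) * (cellVol K)⁻¹ *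
        ((fun _ : verts K => (1 : ℝ)) ⬝ᵥ massMatrix K *ᵥ fun a : verts K => Z a.1) := by
  have hc := h.toIsComplex
  have hu : ∀ κ, MemLp (rtField K (liftSol K A U)) 2 (volume.restrict (body κ)) := fun κ =>
    (memLp_rtField K _).restrict _
  have hg : ∀ κ, MemLp (interpGrad T Z) 2 (volume.restrict (body κ)) := fun κ =>
    (memLp_interpGrad T Z).restrict _
  have hact : ∀ (B : Matrix (Fin d) (Fin d) ℝ) {f : E d → E d} {κ : Finset (E d)},
      MemLp f 2 (volume.restrict (body κ)) →
        IntegrableOn (fun x => normSq B (f x)) (body κ) := fun B f κ hf =>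
    integrableOn_inner_body ((Matrix.toEuclideanCLM (n := Fin d) (𝕜 := ℝ) B).comp_memLp' hf) hf
  -- The mean of the interpolant is the average of the vertex values on the face. It is the same
  -- from both sides, so the interior faces of the element drop out of the cross term.
  have hmean : ∀ κ ∈ K, ∀ a ∈ κ, faceMean κ a (interpVal T Z) (interpGrad T Z) =
      (d : ℝ)⁻¹ * ∑ b ∈ κ.erase a, Z b := fun κ hκ a ha => by
    have hs := hc.simplex κ hκ
    rw [← Finset.sum_congr rfl fun b hb => hs.interpolant_vertex Z (Finset.mem_of_mem_erase hb),
      ← hs.faceMean_affineMap hd ha, faceMean, faceMean]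
    congr 1
    refine integral_congr_ae ?_
    filter_upwards [hT.interpVal_ae_eq Z (hKT hκ), hT.interpGrad_ae_eq Z (hKT hκ)] with x h1 h2
    rw [h1, h2]
  have hcross := h.setIntegral_inner_liftSol hd hA U (φ := interpVal T Z) (g := interpGrad T Z)
    (((memLp_interpVal T Z).restrict _).integrable one_le_two) ((memLp_interpGrad T Z).restrict _)
  rw [Finset.sum_congr rfl fun κ hκ => Finset.sum_congr rfl fun a ha => by rw [hmean κ hκ a ha],
    PolytopalMesh.sum_rtCoef_faceMean hd hc (fun κ a => (d : ℝ)⁻¹ * ∑ b ∈ κ.erase a, Z b)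
      (fun κ κ' a a' hadj _ _ => by rw [hadj.erase_eq])] at hcross
  have hext : ∑ s ∈ extFaces K, liftSol K A U s *
      ∑ κ ∈ star K s, ((d : ℝ)⁻¹ * ∑ b ∈ κ.erase (opp κ s), Z b) =
      ∑ s ∈ extFaces K, U s * (1 / (d : ℝ) * ∑ a ∈ s, Z a) := by
    refine Finset.sum_congr rfl fun s hs => ?_
    obtain ⟨hsub, hcard⟩ := IsComplex.mem_extFaces_iff.1 hs
    rw [liftSol_ext K A U hs, Finset.sum_congr rfl fun κ hκ => by
      rw [(hc.simplex κ (Finset.mem_filter.1 hκ).1).erase_opp (Finset.mem_filter.1 hκ).2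
        (IsComplex.card_of_mem_subfaces hsub)], Finset.sum_const, hcard, one_smul, one_div]
  have hval : ∫ x in cellSet K, interpVal T Z x =
      ∑ κ ∈ K, ∫ x in body κ, interpolant κ Z x := by
    rw [hc.setIntegral_cellSet fun κ _ => ((memLp_interpVal T Z).restrict _).integrable one_le_two]
    exact Finset.sum_congr rfl fun κ hκ => integral_congr_ae (hT.interpVal_ae_eq Z (hKT hκ))
  rw [hext, hval, hc.setIntegral_cellSet fun κ _ => integrableOn_inner_body (hg κ) (hu κ)] at hcross
  have hsum : ∀ κ ∈ K, IntegrableOn (fun x => normSq A⁻¹ (rtField K (liftSol K A U) x +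
      act A (interpGrad T Z x))) (body κ) := fun κ _ => hact A⁻¹ ((hu κ).add
    ((Matrix.toEuclideanCLM (n := Fin d) (𝕜 := ℝ) A).comp_memLp' (hg κ)))
  rw [← rtEnergy_liftSol h hd hA, hc.stiffMatrix_form, hc.massMatrix_form,
    hc.setIntegral_cellSet hsum,
    rtEnergy, hc.setIntegral_cellSet fun κ _ => hact A⁻¹ (hu κ)]
  have hsplit : ∀ κ ∈ K, ∫ x in body κ, normSq A⁻¹ (rtField K (liftSol K A U) x +
      act A (interpGrad T Z x)) = (∫ x in body κ, normSq A⁻¹ (rtField K (liftSol K A U) x)) +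
      (∫ _ in body κ, normSq A (affGrad (interpolant κ Z))) +
      2 * ∫ x in body κ, ⟪interpGrad T Z x, rtField K (liftSol K A U) x⟫ := fun κ hκ => by
    have he : ∫ _ in body κ, normSq A (affGrad (interpolant κ Z)) =
        ∫ x in body κ, normSq A (interpGrad T Z x) :=
      integral_congr_ae ((hT.interpGrad_ae_eq Z (hKT hκ)).mono fun x hx => by simp only [hx])
    have h12 : IntegrableOn (fun x => normSq A⁻¹ (rtField K (liftSol K A U) x) +
        normSq A (interpGrad T Z x)) (body κ) := (hact A⁻¹ (hu κ)).add (hact A (hg κ))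
    rw [he, ← integral_const_mul, ← integral_add (hact A⁻¹ (hu κ)) (hact A (hg κ)),
      ← integral_add h12 ((integrableOn_inner_body (hg κ) (hu κ)).const_mul 2)]
    exact integral_congr_ae (Filter.Eventually.of_forall fun x => normSq_add_act hA _ _)
  rw [Finset.sum_congr rfl hsplit, Finset.sum_add_distrib, Finset.sum_add_distrib,
    ← Finset.mul_sum, hcross]
  ring

end nonconformity

/-! ### The nonconformity estimator -/

namespace Step

variable {Ph Co : Type*} [Fintype Ph] [Fintype Co] {d n : ℕ} {P : Problem d Ph Co} (S : Step P n)

/-- The weight of the current time in the affine interpolation in time. -/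
def cw (t : ℝ) : ℝ := (t - P.time (n - 1)) / S.tau

/-- The weight of the previous time in the affine interpolation in time. -/
def pw (t : ℝ) : ℝ := (P.time n - t) / S.tau

theorem tau_pos (hn : 1 ≤ n) (hnN : n ≤ P.N) : 0 < S.tau := by
  have := P.time_lt (n - 1) (by omega)
  rw [Nat.sub_add_cancel hn] at this
  exact sub_pos.2 this

section

variable (hτ : 0 < S.tau)
include hτ

theorem cw_add_pw (t : ℝ) : S.cw t + S.pw t = 1 := by
  rw [cw, pw, ← add_div, div_eq_one_iff_eq hτ.ne', tau]
  ring

theorem interp_cur (a b : ℝ) : S.interp a b (P.time n) = a := by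
  rw [interp, sub_self, zero_div, zero_mul, add_zero]
  change S.tau / S.tau * a = a
  rw [div_self hτ.ne', one_mul]

theorem interp_prev (a b : ℝ) : S.interp a b (P.time (n - 1)) = b := by
  rw [interp, sub_self, zero_div, zero_mul, zero_add]
  change S.tau / S.tau * b = b
  rw [div_self hτ.ne', one_mul]

theorem pressureAt_eq (p : Ph) (t : ℝ) (K : (P.mesh n).Elem) :
    S.pressureAt p t K =
      S.cw t * S.pressureAt p (P.time n) K + S.pw t * S.pressureAt p (P.time (n - 1)) K := by
  rw [pressureAt, pressureAt, pressureAt, S.interp_cur hτ, S.interp_prev hτ]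
  rfl

/-- The pressure part is interpolated in time by construction; the gravity part does not depend on
time and needs that the two weights add up to one. -/
theorem vecU_eq (p : Ph) (K : (P.mesh n).Elem) (t : ℝ) :
    S.vecU p K t = fun s =>
      S.cw t * S.vecU p K (P.time n) s + S.pw t * S.vecU p K (P.time (n - 1)) s := by
  funext s
  simp only [vecU, S.interp_cur hτ, S.interp_prev hτ]
  have h1 := S.spread_combination (S.cw t) (S.pw t)
    (fun σ => S.sign K σ * ∑ L, S.disc.trans σ L * P.phasePressure p (S.cur L))
    (fun σ => S.sign K σ * ∑ L, S.disc.trans σ L * P.phasePressure p (S.old L)) s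
  have h2 : ∀ σ a b, S.cw t * (S.sign K σ * a) + S.pw t * (S.sign K σ * b) =
      S.sign K σ * S.interp a b t := fun σ a b => by
    rw [interp, cw, pw]
    ring
  simp only [h2] at h1
  linear_combination h1 - S.gravityFlux K p s * S.cw_add_pw hτ t

theorem vecZ_eq (p : Ph) (t : ℝ) :
    S.vecZ p t = fun a =>
      S.cw t * S.vecZ p (P.time n) a + S.pw t * S.vecZ p (P.time (n - 1)) a := by
  funext a
  unfold vecZ
  cases S.points with
  | average =>
    dsimp only
    split_ifs with h
    · rw [mul_zero, mul_zero, add_zero]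
    · rw [Finset.sum_congr rfl fun K _ => S.pressureAt_eq hτ p t K, Finset.sum_add_distrib,
        ← Finset.mul_sum, ← Finset.mul_sum, add_div, mul_div_assoc, mul_div_assoc]
  | hybrid cur prev =>
    dsimp only
    split_ifs with h h'
    · rw [mul_zero, mul_zero, add_zero]
    · exact S.pressureAt_eq hτ p t _
    · simp only [S.interp_cur hτ, S.interp_prev hτ]
      rw [← mul_div_assoc, ← mul_div_assoc, ← add_div, Finset.mul_sum, Finset.mul_sum,
        ← Finset.sum_add_distrib]
      rfl
  | prescribed cur prev =>
    dsimp only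
    rw [S.interp_cur hτ, S.interp_prev hτ]
    rfl

theorem uApprox_eq (hd : 1 ≤ d) (p : Ph) (K : (P.mesh n).Elem) (t : ℝ) (x : E d) :
    S.uApprox p K t x = rtField K.1 (liftSol K.1 (P.perm n K) (S.vecU p K t)) x := by
  have hl : ∀ U, rtField K.1 (lift K.1 (P.perm n K) U) =
      rtField K.1 (liftSol K.1 (P.perm n K) U) := fun U =>
    rtField_congr fun s hs => lift_eq ((P.mesh n).isCell K) hd (P.perm_posDef n K) U hs
  rw [S.vecU_eq hτ, liftSol_combination, rtField_combination, uApprox, hl, hl]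
  rfl

end

theorem continuous_cw : Continuous S.cw := by unfold cw; fun_prop

theorem continuous_pw : Continuous S.pw := by unfold pw; fun_prop

theorem memLp_interpolation {F : Type*} [NormedAddCommGroup F] [NormedSpace ℝ F] {f g : E d → F}
    (hf : MemLp f 2 (volume.restrict P.Ω)) (hg : MemLp g 2 (volume.restrict P.Ω)) :
    MemLp (fun z : ℝ × E d => S.cw z.1 • f z.2 + S.pw z.1 • g z.2) 2
      (spaceTime (P.time (n - 1)) (P.time n) P.Ω) := by
  have hfin : IsFiniteMeasure (volume.restrict P.Ω) :=
    ⟨by rw [Measure.restrict_apply_univ]; exact (P.mesh n).volume_ne_top.lt_top⟩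
  have hb : ∀ {c : ℝ → ℝ}, Continuous c →
      MemLp c ⊤ (volume.restrict (Set.Icc (P.time (n - 1)) (P.time n))) := fun {c} hc => by
    obtain ⟨C, hC⟩ := isCompact_Icc.exists_bound_of_continuousOn
      (hc.continuousOn (s := Set.Icc (P.time (n - 1)) (P.time n)))
    exact memLp_top_of_bound hc.aestronglyMeasurable C
      ((ae_restrict_mem measurableSet_Icc).mono hC)
  exact ((hf.comp_snd _).smul ((hb S.continuous_cw).comp_fst _)).add
    ((hg.comp_snd _).smul ((hb S.continuous_pw).comp_fst _))

/-- The piecewise affine reconstruction of the potential. -/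
def reconstruction (hd : 1 ≤ d) (hτ : 0 < S.tau) (p : Ph) : S.TestSpace where
  val t := interpVal (P.mesh n).simplices (S.vecZ p t)
  grad t := interpGrad (P.mesh n).simplices (S.vecZ p t)
  memLp_val := by
    have he : (fun z : ℝ × E d => interpVal (P.mesh n).simplices (S.vecZ p z.1) z.2) =
        fun z => S.cw z.1 • interpVal (P.mesh n).simplices (S.vecZ p (P.time n)) z.2 +
          S.pw z.1 • interpVal (P.mesh n).simplices (S.vecZ p (P.time (n - 1))) z.2 :=
      funext fun z => by
        rw [S.vecZ_eq hτ p z.1, interpVal_combination]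
        rfl
    rw [he]
    exact S.memLp_interpolation ((memLp_interpVal _ _).restrict _)
      ((memLp_interpVal _ _).restrict _)
  memLp_grad := by
    have he : (fun z : ℝ × E d => interpGrad (P.mesh n).simplices (S.vecZ p z.1) z.2) =
        fun z => S.cw z.1 • interpGrad (P.mesh n).simplices (S.vecZ p (P.time n)) z.2 +
          S.pw z.1 • interpGrad (P.mesh n).simplices (S.vecZ p (P.time (n - 1))) z.2 :=
      funext fun z => by
        rw [S.vecZ_eq hτ p z.1, interpGrad_combination]
    rw [he]
    exact S.memLp_interpolation ((memLp_interpGrad _ _).restrict _)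
      ((memLp_interpGrad _ _).restrict _)
  weak := Filter.Eventually.of_forall fun t => (P.mesh n).isComplex.isWeakGradient_interp hd
    P.isOpen P.interior_closure (P.mesh n).cover _

theorem setIntegral_reconstruction (hd : 1 ≤ d) (hτ : 0 < S.tau) {c : Co} (p : PhasesOf P.comp c)
    (K : (P.mesh n).Elem) (t : ℝ) :
    weight p K (S.cur K) ^ 2 * ∫ x in cellSet K.1, normSq (P.perm n K)⁻¹ (S.uApprox p.1 K t x +
      act (P.perm n K) ((S.reconstruction hd hτ p.1).grad t x)) = S.estNCSq p K t := by
  simp only [S.uApprox_eq hτ hd]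
  rw [estNCSq]
  congr 1
  exact ((P.mesh n).isCell K).setIntegral_normSq_liftSol_add (P.mesh n).isComplex
    ((P.mesh n).elem_subset K) hd (P.perm_posDef n K) (S.vecU p.1 K t) (S.vecZ p.1 t)

theorem estNCSq_nonneg (hd : 1 ≤ d) (hτ : 0 < S.tau) {c : Co} (p : PhasesOf P.comp c)
    (K : (P.mesh n).Elem) (t : ℝ) : 0 ≤ S.estNCSq p K t := by
  rw [← S.setIntegral_reconstruction hd hτ]
  exact mul_nonneg (sq_nonneg _) (integral_nonneg fun x => normSq_nonneg (P.perm_posDef n K).inv _)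

theorem continuous_form {ι : Type*} [Fintype ι] (m : Matrix ι ι ℝ) {u v : ℝ → ι → ℝ}
    (hu : ∀ i, Continuous fun t => u t i) (hv : ∀ i, Continuous fun t => v t i) :
    Continuous fun t => u t ⬝ᵥ m *ᵥ v t := by
  simp only [dotProduct, Matrix.mulVec]
  fun_prop

/-- Fluxes and point values are affine in time. Continuity provides the integrability in time used
when integrals are added and compared. -/
theorem continuous_estNCSq (hτ : 0 < S.tau) {c : Co} (p : PhasesOf P.comp c)
    (K : (P.mesh n).Elem) : Continuous (S.estNCSq p K) := by
  have hc := S.continuous_cw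
  have hp := S.continuous_pw
  have hU : ∀ s, Continuous fun t => S.vecU p.1 K t s := fun s => by
    have he : (fun t => S.vecU p.1 K t s) = _ := funext fun t => congrFun (S.vecU_eq hτ p.1 K t) s
    rw [he]
    fun_prop
  have hZ : ∀ a, Continuous fun t => S.vecZ p.1 t a := fun a => by
    have he : (fun t => S.vecZ p.1 t a) = _ := funext fun t => congrFun (S.vecZ_eq hτ p.1 t) a
    rw [he]
    fun_prop
  have h1 := continuous_form (mfeMatrix K.1 (P.perm n K))
    (fun s : extFaces K.1 => hU s.1) fun s : extFaces K.1 => hU s.1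
  have h2 := continuous_form (stiffMatrix K.1 (P.perm n K))
    (fun a : verts K.1 => hZ a.1) fun a : verts K.1 => hZ a.1
  have h3 : Continuous fun t => 2 * ∑ s ∈ extFaces K.1, S.vecU p.1 K t s * S.vecZext p.1 t s := by
    simp only [vecZext]
    fun_prop
  have h4 : Continuous fun t => 2 * (∑ s ∈ extFaces K.1, S.vecU p.1 K t s) * (cellVol K.1)⁻¹ := by
    fun_prop
  have h5 := continuous_form (massMatrix K.1) (fun _ : verts K.1 => continuous_const (y := (1 : ℝ)))
    fun a : verts K.1 => hZ a.1
  exact continuous_const.mul (((h1.add h2).add h3).sub (h4.mul h5))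

theorem nonconformity_nonneg (p : Ph) : 0 ≤ S.nonconformity p :=
  Real.sInf_nonneg fun r hr => by
    obtain ⟨φ, rfl⟩ := hr
    exact Real.sqrt_nonneg _

/-- The piecewise affine reconstruction is a competitor in the infimum, and its distance to the flux
is the estimator exactly. The set of values is bounded below by zero, so the real infimum is
meaningful. -/
theorem nonconformity_sq_le (hd : 1 ≤ d) (hτ : 0 < S.tau) (p : Ph) :
    S.nonconformity p ^ 2 ≤ ∑ c : P.comp p, ∫ t in S.I, ∑ K : (P.mesh n).Elem,
      S.estNCSq (⟨p, c.2⟩ : PhasesOf P.comp c.1) K t := by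
  have hle : S.nonconformity p ≤ Real.sqrt (∑ c : P.comp p, ∫ t in S.I, ∑ K : (P.mesh n).Elem,
      S.estNCSq (⟨p, c.2⟩ : PhasesOf P.comp c.1) K t) := by
    refine csInf_le ⟨0, fun r hr => ?_⟩ ⟨S.reconstruction hd hτ p, ?_⟩
    · obtain ⟨φ, rfl⟩ := hr
      exact Real.sqrt_nonneg _
    · simp only [← fun (c : P.comp p) => S.setIntegral_reconstruction hd hτ
        (⟨p, c.2⟩ : PhasesOf P.comp c.1)]
  refine (pow_le_pow_left₀ (S.nonconformity_nonneg p) hle 2).trans_eq (Real.sq_sqrt ?_)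
  exact Finset.sum_nonneg fun c _ => integral_nonneg fun t => Finset.sum_nonneg fun K _ =>
    S.estNCSq_nonneg hd hτ _ K t

end Step

/-! ### The dual norm of the residual -/

/-- A nonnegative quadratic polynomial has nonpositive discriminant; the Cauchy-Schwarz inequalities
below are instances. -/
theorem abs_le_sqrt_mul_sqrt {a b c : ℝ} (ha : 0 ≤ a) (h : ∀ x : ℝ, 0 ≤ a + 2 * (x * b) + x ^ 2 * c) :
    |b| ≤ Real.sqrt a * Real.sqrt c := by
  have hdisc : discrim c (2 * b) a ≤ 0 := discrim_le_zero fun x => by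
    have := h x
    nlinarith
  rw [← Real.sqrt_mul ha]
  refine Real.abs_le_sqrt ?_
  rw [discrim] at hdisc
  nlinarith

theorem abs_integral_mul_le {α : Type*} [MeasurableSpace α] {μ : Measure α} {f g : α → ℝ}
    (hf : MemLp f 2 μ) (hg : MemLp g 2 μ) :
    |∫ x, f x * g x ∂μ| ≤ Real.sqrt (∫ x, f x ^ 2 ∂μ) * Real.sqrt (∫ x, g x ^ 2 ∂μ) := by
  refine abs_le_sqrt_mul_sqrt (integral_nonneg fun x => sq_nonneg (f x)) fun y => ?_
  have h1 : Integrable (fun x => 2 * (y * (f x * g x))) μ :=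
    ((hf.integrable_mul hg).const_mul y).const_mul 2
  have h2 : Integrable (fun x => f x ^ 2 + 2 * (y * (f x * g x))) μ := hf.integrable_sq.add h1
  rw [← integral_const_mul, ← integral_const_mul, ← integral_const_mul,
    ← integral_add hf.integrable_sq h1, ← integral_add h2 (hg.integrable_sq.const_mul (y ^ 2))]
  refine integral_nonneg fun x => ?_
  have := sq_nonneg (f x + y * g x)
  simp only [Pi.zero_apply]
  nlinarith

/-! ### Cauchy-Schwarz estimates on one element. -/

section cell

variable {d : ℕ} {K : Finset (Finset (E d))} {A : Matrix (Fin d) (Fin d) ℝ}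

theorem integrableOn_inner {s : Set (E d)} {f g : E d → E d} (hf : MemLp f 2 (volume.restrict s))
    (hg : MemLp g 2 (volume.restrict s)) : IntegrableOn (fun x => ⟪f x, g x⟫) s := by
  refine (hf.norm.integrable_mul hg.norm).mono (hf.1.inner hg.1)
    (Filter.Eventually.of_forall fun x => ?_)
  simp only [Pi.mul_apply, norm_mul, norm_norm]
  exact norm_inner_le_norm _ _

/-- The quadratic polynomial is the integral of the squared norm, with weight `A⁻¹`, of `u` plus `A`
applied to a multiple of `w`. -/
theorem abs_setIntegral_inner_le (hA : A.PosDef) {u w : E d → E d} {s : Set (E d)}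
    (hu : MemLp u 2 (volume.restrict s)) (hw : MemLp w 2 (volume.restrict s)) :
    |∫ x in s, ⟪w x, u x⟫| ≤ Real.sqrt (∫ x in s, normSq A⁻¹ (u x)) *
      Real.sqrt (∫ x in s, normSq A (w x)) := by
  have hact : ∀ (B : Matrix (Fin d) (Fin d) ℝ) {f : E d → E d},
      MemLp f 2 (volume.restrict s) → IntegrableOn (fun x => normSq B (f x)) s := fun B f hf =>
    integrableOn_inner ((Matrix.toEuclideanCLM (n := Fin d) (𝕜 := ℝ) B).comp_memLp' hf) hf
  refine abs_le_sqrt_mul_sqrt (integral_nonneg fun _ => normSq_nonneg hA.inv _) fun y => ?_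
  have h1 : IntegrableOn (fun x => 2 * (y * ⟪w x, u x⟫)) s := ((integrableOn_inner hw hu).const_mul y).const_mul 2
  have h2 : IntegrableOn (fun x => normSq A⁻¹ (u x) + 2 * (y * ⟪w x, u x⟫)) s :=
    (hact A⁻¹ hu).add h1
  rw [← integral_const_mul, ← integral_const_mul, ← integral_const_mul,
    ← integral_add (hact A⁻¹ hu) h1, ← integral_add h2 ((hact A hw).const_mul (y ^ 2))]
  refine integral_nonneg fun x => ?_
  have h3 := normSq_nonneg hA.inv (u x + act A (y • w x))
  have h4 : normSq A (y • w x) = y ^ 2 * normSq A (w x) := by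
    rw [normSq, ← actLin_apply, map_smul, real_inner_smul_left, real_inner_smul_right, actLin_apply,
      normSq]
    ring
  rw [normSq_add_act hA, h4, real_inner_smul_left] at h3
  simp only [Pi.zero_apply]
  linarith

theorem abs_setIntegral_cellSet_le {φ : E d → ℝ} (hφ : MemLp φ 2 (volume.restrict (cellSet K))) :
    |∫ x in cellSet K, φ x| ≤ Real.sqrt (cellVol K) * Real.sqrt (∫ x in cellSet K, φ x ^ 2) := by
  have := abs_integral_mul_le (memLp_const (1 : ℝ)) hφ
  simpa [cellVol, Measure.real] using this

/-- The elementwise contribution to the squared norm of the test functions. -/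
def cellNormSq (K : Finset (Finset (E d))) (A : Matrix (Fin d) (Fin d) ℝ) (φ : E d → ℝ)
    (w : E d → E d) : ℝ :=
  (cellDiam K)⁻¹ ^ 2 * (∫ x in cellSet K, φ x ^ 2) + ∫ x in cellSet K, normSq A (w x)

theorem cellNormSq_nonneg (hA : A.PosDef) (φ : E d → ℝ) (w : E d → E d) :
    0 ≤ cellNormSq K A φ w :=
  add_nonneg (mul_nonneg (sq_nonneg _) (integral_nonneg fun x => sq_nonneg (φ x)))
    (integral_nonneg fun _ => normSq_nonneg hA _)

/-- The Cauchy-Schwarz inequality in the plane, which joins the flux term with the zeroth-order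
term. -/
theorem mul_add_mul_le_sqrt {a b x y : ℝ} (ha : 0 ≤ a) (hx : 0 ≤ x) :
    Real.sqrt a * Real.sqrt x + b * y ≤ Real.sqrt (a + b ^ 2) * Real.sqrt (y ^ 2 + x) := by
  rw [← Real.sqrt_mul (add_nonneg ha (sq_nonneg b))]
  refine Real.le_sqrt_of_sq_le ?_
  have h1 := Real.sq_sqrt ha
  have h2 := Real.sq_sqrt hx
  nlinarith [sq_nonneg (Real.sqrt a * y - b * Real.sqrt x)]

/-- Bound of a lifted flux and a constant source on one cell. -/
theorem IsCell.abs_flux_add_source_le (h : IsCell K) (hd : 1 ≤ d) (hA : A.PosDef)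
    (U : Finset (E d) → ℝ) (r : ℝ) {φ : E d → ℝ} {w : E d → E d}
    (hφ : MemLp φ 2 (volume.restrict (cellSet K))) (hw : MemLp w 2 (volume.restrict (cellSet K))) :
    |r * (∫ x in cellSet K, φ x) - ∫ x in cellSet K, ⟪w x, rtField K (liftSol K A U) x⟫| ≤
      Real.sqrt (((fun s : extFaces K => U s.1) ⬝ᵥ mfeMatrix K A *ᵥ fun s : extFaces K => U s.1) +
        (cellDiam K * (|r| * Real.sqrt (cellVol K))) ^ 2) * Real.sqrt (cellNormSq K A φ w) := by
  have hdiam := (h.toIsComplex.cellDiam_pos hd h.nonempty)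
  rw [← rtEnergy_liftSol h hd hA, rtEnergy, cellNormSq]
  set q := ∫ x in cellSet K, φ x ^ 2
  have hq : 0 ≤ q := integral_nonneg fun x => sq_nonneg (φ x)
  have h1 := abs_setIntegral_inner_le hA ((memLp_rtField K (liftSol K A U)).restrict _) hw
  -- The factors `h_K` and `h_K⁻¹` match the weight in the test norm. The zeroth-order part of that
  -- norm takes the place of a Poincaré inequality.
  have h2 : |r * ∫ x in cellSet K, φ x| ≤
      cellDiam K * (|r| * Real.sqrt (cellVol K)) * ((cellDiam K)⁻¹ * Real.sqrt q) := by
    rw [abs_mul]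
    refine (mul_le_mul_of_nonneg_left (abs_setIntegral_cellSet_le hφ) (abs_nonneg r)).trans_eq ?_
    field_simp
    rfl
  have h3 := mul_add_mul_le_sqrt (b := cellDiam K * (|r| * Real.sqrt (cellVol K)))
    (y := (cellDiam K)⁻¹ * Real.sqrt q)
    (integral_nonneg (μ := volume.restrict (cellSet K))
      fun x => normSq_nonneg hA.inv (rtField K (liftSol K A U) x))
    (integral_nonneg (μ := volume.restrict (cellSet K)) fun x => normSq_nonneg hA (w x))
  rw [mul_pow (cellDiam K)⁻¹, Real.sq_sqrt hq] at h3
  exact (abs_sub _ _).trans ((add_le_add h2 h1).trans ((add_comm _ _).trans_le h3))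

end cell

theorem abs_sum_le_sqrt {ι : Type*} [Fintype ι] {x η N : ι → ℝ} (hη : ∀ i, 0 ≤ η i)
    (hN : ∀ i, 0 ≤ N i) (hx : ∀ i, |x i| ≤ η i * Real.sqrt (N i)) :
    |∑ i, x i| ≤ Real.sqrt (∑ i, η i ^ 2) * Real.sqrt (∑ i, N i) := by
  refine (Finset.abs_sum_le_sum_abs _ _).trans ((Finset.sum_le_sum fun i _ => hx i).trans ?_)
  have := Real.sum_sqrt_mul_sqrt_le Finset.univ (fun i => sq_nonneg (η i)) hN
  simpa only [Real.sqrt_sq (hη _)] using this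

/-! ### Decomposition of the residual into error components. -/

namespace Step

variable {Ph Co : Type*} [Fintype Ph] [Fintype Co] {d n : ℕ} {P : Problem d Ph Co} (S : Step P n)

theorem spread_sub (F G : (P.mesh n).Face → ℝ) (s : Finset (E d)) :
    S.spread (fun σ => F σ - G σ) s = S.spread F s - S.spread G s := by
  have := S.spread_combination 1 (-1) F G s
  simpa only [one_mul, neg_mul, ← sub_eq_add_neg] using this

/-- The pairing of a lifted flux with the gradient `w` on the element `K`. -/
def liftPairing (_ : Step P n) (w : E d → E d) (K : (P.mesh n).Elem) (U : Finset (E d) → ℝ) : ℝ :=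
  ∫ x in cellSet K.1, ⟪w x, rtField K.1 (liftSol K.1 (P.perm n K) U) x⟫

theorem liftPairing_combination {K : (P.mesh n).Elem} {w : E d → E d}
    (hw : MemLp w 2 (volume.restrict (cellSet K.1))) (c c' : ℝ) (U U' : Finset (E d) → ℝ) :
    S.liftPairing w K (fun s => c * U s + c' * U' s) =
      c * S.liftPairing w K U + c' * S.liftPairing w K U' := by
  have h : ∀ u, IntegrableOn (fun x => ⟪w x, rtField K.1 u x⟫) (cellSet K.1) := fun u =>
    integrableOn_inner hw ((memLp_rtField K.1 u).restrict _)
  rw [liftPairing, liftPairing, liftPairing, ← integral_const_mul, ← integral_const_mul,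
    ← integral_add ((h _).const_mul c) ((h _).const_mul c'), liftSol_combination]
  refine integral_congr_ae (Filter.Eventually.of_forall fun x => ?_)
  simp only [rtField_combination, inner_add_right, real_inner_smul_right]

theorem liftPairing_sub {K : (P.mesh n).Elem} {w : E d → E d}
    (hw : MemLp w 2 (volume.restrict (cellSet K.1))) {V U U' : Finset (E d) → ℝ}
    (hV : ∀ s, V s = U s - U' s) :
    S.liftPairing w K V = S.liftPairing w K U - S.liftPairing w K U' := by
  have := S.liftPairing_combination hw 1 (-1) U U'
  simp only [one_mul, neg_mul, ← sub_eq_add_neg] at this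
  rw [← this, ← funext hV]

theorem liftPairing_zero {K : (P.mesh n).Elem} {w : E d → E d}
    (hw : MemLp w 2 (volume.restrict (cellSet K.1))) : S.liftPairing w K (fun _ => 0) = 0 := by
  rw [S.liftPairing_sub hw (U := fun _ => 0) (U' := fun _ => 0) fun s => (sub_zero 0).symm, sub_self]

theorem thetaApprox_eq (hd : 1 ≤ d) (c : Co) (K : (P.mesh n).Elem) (t : ℝ) (x : E d) :
    S.thetaApprox c K t x = rtField K.1 (liftSol K.1 (P.perm n K)
      (fun s => S.cw t * S.vecFlux c K s + S.pw t * S.vecFluxPrev c K s)) x := by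
  have hl : ∀ U, rtField K.1 (lift K.1 (P.perm n K) U) =
      rtField K.1 (liftSol K.1 (P.perm n K) U) := fun U =>
    rtField_congr fun s hs => lift_eq ((P.mesh n).isCell K) hd (P.perm_posDef n K) U hs
  rw [liftSol_combination, rtField_combination, thetaApprox, hl, hl]
  rfl

theorem vecTm_eq (c : Co) (K : (P.mesh n).Elem) (t : ℝ) (s : Finset (E d)) :
    S.vecTm c K t s = S.pw t * S.vecFlux c K s + -S.pw t * S.vecFluxPrev c K s := by
  rw [vecFlux, vecFluxPrev, ← S.spread_combination, vecTm]
  congr 1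
  funext σ
  rw [pw]
  ring

/-- Telescoping: the time-interpolated flux is the current flux minus the temporal part, and the
current flux is the linearized flux at the last iterate minus the algebraic, linearization and
upwinding increments. Pairing with a lifting is linear in the face fluxes. -/
theorem setIntegral_thetaApprox (hd : 1 ≤ d) (hτ : 0 < S.tau) (c : Co) (K : (P.mesh n).Elem)
    (t : ℝ) {w : E d → E d} (hw : MemLp w 2 (volume.restrict (cellSet K.1))) :
    ∫ x in cellSet K.1, ⟪S.thetaApprox c K t x, w x⟫ =
      S.liftPairing w K (S.spread fun σ => S.sign K σ * S.linFlux c σ S.add) -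
        S.liftPairing w K (S.vecUpw c K) - S.liftPairing w K (S.vecTm c K t) -
        S.liftPairing w K (S.vecLin c K) - S.liftPairing w K (S.vecAlg c K) := by
  have h1 := S.liftPairing_sub (K := K) hw (V := S.vecUpw c K) (S.spread_sub _ _)
  have h2 := S.liftPairing_sub (K := K) hw (V := S.vecLin c K) (S.spread_sub _ _)
  have h3 := S.liftPairing_sub (K := K) hw (V := S.vecAlg c K) (S.spread_sub _ _)
  have h4 := S.liftPairing_combination hw (S.pw t) (-S.pw t) (S.vecFlux c K) (S.vecFluxPrev c K)
  rw [← funext (S.vecTm_eq c K t)] at h4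
  have h5 := S.liftPairing_combination hw (S.cw t) (S.pw t) (S.vecFlux c K) (S.vecFluxPrev c K)
  have h6 : ∫ x in cellSet K.1, ⟪S.thetaApprox c K t x, w x⟫ = S.liftPairing w K
      (fun s => S.cw t * S.vecFlux c K s + S.pw t * S.vecFluxPrev c K s) := by
    rw [liftPairing]
    refine integral_congr_ae (Filter.Eventually.of_forall fun x => ?_)
    dsimp only
    rw [S.thetaApprox_eq hd, real_inner_comm]
  rw [h6, h5, h1, h2, h3, h4]
  have h7 := S.cw_add_pw hτ t
  change _ = _ - (_ - S.liftPairing w K (S.vecFlux c K)) - _ - _ - _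
  linear_combination S.liftPairing w K (S.vecFlux c K) * h7

theorem deriv_amountApprox (c : Co) (K : (P.mesh n).Elem) (t : ℝ) :
    deriv (S.amountApprox c K) t =
      S.tau⁻¹ * (S.amountAt c K (S.cur K) - S.amountPrev c K) := by
  have h : HasDerivAt (S.amountApprox c K) (1 / S.tau * S.amountAt c K (S.cur K) +
      -1 / S.tau * S.amountPrev c K) t :=
    ((((hasDerivAt_id t).sub_const _).div_const _).mul_const _).add
      ((((hasDerivAt_id t).const_sub _).div_const _).mul_const _)
  rw [h.deriv]
  ring

/-- The residual of the approximate solution, decomposed into the error components. -/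
theorem residual_eq (hd : 1 ≤ d) (hτ : 0 < S.tau) (c : Co) (t : ℝ) {φ : E d → ℝ}
    {w : E d → E d} (hφ : IsWeakGradient P.Ω φ w) :
    ∑ K : (P.mesh n).Elem, ((∫ x in cellSet K.1, P.source n K c * φ x)
        - (∫ x in cellSet K.1, deriv (S.amountApprox c K) t * φ x)
        + ∫ x in cellSet K.1, ⟪S.thetaApprox c K t x, w x⟫) =
      ∑ K : (P.mesh n).Elem, (0 * (∫ x in cellSet K.1, φ x) - S.liftPairing w K (S.vecUpw c K)) +
      ∑ K : (P.mesh n).Elem, (0 * (∫ x in cellSet K.1, φ x) - S.liftPairing w K (S.vecTm c K t)) +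
      ∑ K : (P.mesh n).Elem, (S.tau⁻¹ * (S.linAmount c K S.cur - S.amountAt c K (S.cur K)) *
        (∫ x in cellSet K.1, φ x) - S.liftPairing w K (S.vecLin c K)) +
      ∑ K : (P.mesh n).Elem, (S.tau⁻¹ * (S.linAmount c K S.add - S.linAmount c K S.cur) *
        (∫ x in cellSet K.1, φ x) - S.liftPairing w K (S.vecAlg c K)) +
      ∑ K : (P.mesh n).Elem, (-((cellVol K.1)⁻¹ * S.residual c K S.add) *
        (∫ x in cellSet K.1, φ x) - S.liftPairing w K fun _ => 0) := by
  have hle := (P.mesh n).restrict_cellSet_le P.interior_closure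
  have hw : ∀ K : (P.mesh n).Elem, MemLp w 2 (volume.restrict (cellSet K.1)) := fun K =>
    hφ.2.1.mono_measure (hle K)
  -- Only the linearized fluxes at the last iterate are used here: they have one value per face up
  -- to the orientation sign, whereas the fluxes without upwinding take their mobilities from the
  -- element and need not balance.
  have hgreen := (P.mesh n).sum_setIntegral_inner_liftSol hd P.isOpen P.interior_closure
    (P.perm_posDef n) (fun K => S.spread fun σ => S.sign K σ * S.linFlux c σ S.add)
    (fun K L hne s hK hL => S.spread_sign_eq_neg hd _ hne hK hL)
    (fun K s hK h => S.spread_eq_zero _ hK h) hφ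
  simp only [S.sum_spread hd] at hgreen
  rw [← add_eq_zero_iff_eq_neg, ← Finset.sum_add_distrib] at hgreen
  simp only [← Finset.sum_add_distrib]
  -- The difference of the two sides is, element by element, the summand of Green's identity, after
  -- the algebraic residual has been replaced by its definition.
  refine sub_eq_zero.1 ((Finset.sum_sub_distrib _ _).symm.trans
    ((Finset.sum_congr rfl fun K _ => ?_).trans hgreen))
  have hV := ((P.mesh n).isCell K).cellVol_pos ((P.mesh n).isCell K).nonempty
  rw [S.setIntegral_thetaApprox hd hτ c K t (hw K), S.deriv_amountApprox, integral_const_mul,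
    integral_const_mul, S.liftPairing_zero (hw K), residual]
  change _ = S.liftPairing w K _ + _
  have := hV.ne'
  have := hτ.ne'
  field_simp
  ring

end Step

theorem integral_add_le {α : Type*} [MeasurableSpace α] {μ : Measure α} {f g : α → ℝ} {a b : ℝ}
    (hf : Integrable f μ ∧ ∫ x, f x ∂μ ≤ a) (hg : Integrable g μ ∧ ∫ x, g x ∂μ ≤ b) :
    Integrable (fun x => f x + g x) μ ∧ ∫ x, (f x + g x) ∂μ ≤ a + b :=
  ⟨hf.1.add hg.1, (integral_add hf.1 hg.1).trans_le (add_le_add hf.2 hg.2)⟩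

namespace Step

variable {Ph Co : Type*} [Fintype Ph] [Fintype Co] {d n : ℕ} {P : Problem d Ph Co} (S : Step P n)

/-- Square root of the sum over the elements of the squares of `η`. -/
def elemNorm (_ : Step P n) (η : (P.mesh n).Elem → ℝ) : ℝ := Real.sqrt (∑ K, η K ^ 2)

/-- Elementwise contributions to the squared norm of a test function at a fixed time. -/
def testNormSq (_ : Step P n) (φ : E d → ℝ) (w : E d → E d) : ℝ :=
  ∑ K : (P.mesh n).Elem, cellNormSq K.1 (P.perm n K) φ w

theorem abs_component_le (hd : 1 ≤ d) {φ : E d → ℝ} {w : E d → E d} (hφ : IsWeakGradient P.Ω φ w)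
    (U : (P.mesh n).Elem → Finset (E d) → ℝ) (r : (P.mesh n).Elem → ℝ)
    (η : (P.mesh n).Elem → ℝ)
    (hη : ∀ K, Real.sqrt (S.mfeForm K (U K) +
      (cellDiam K.1 * (|r K| * Real.sqrt (cellVol K.1))) ^ 2) = η K) :
    |∑ K : (P.mesh n).Elem, (r K * (∫ x in cellSet K.1, φ x) - S.liftPairing w K (U K))| ≤
      S.elemNorm η * Real.sqrt (S.testNormSq φ w) := by
  have hle := (P.mesh n).restrict_cellSet_le P.interior_closure
  refine abs_sum_le_sqrt (fun K => (hη K) ▸ Real.sqrt_nonneg _)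
    (fun K => cellNormSq_nonneg (P.perm_posDef n K) φ w) fun K => ?_
  rw [← hη K]
  exact ((P.mesh n).isCell K).abs_flux_add_source_le hd (P.perm_posDef n K) (U K) (r K)
    (hφ.1.mono_measure (hle K)) (hφ.2.1.mono_measure (hle K))

theorem sqrt_mfeForm_scaledNorm (hτ : 0 < S.tau) (K : (P.mesh n).Elem) (U : Finset (E d) → ℝ)
    (r : ℝ) : Real.sqrt (S.mfeForm K U +
      (cellDiam K.1 * (|S.tau⁻¹ * r| * Real.sqrt (cellVol K.1))) ^ 2) =
      Real.sqrt (S.mfeForm K U + S.scaledNorm K r ^ 2) := by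
  rw [scaledNorm, abs_mul, abs_of_pos (inv_pos.2 hτ)]
  congr 3
  ring

theorem sqrt_mfeForm_zero (K : (P.mesh n).Elem) (U : Finset (E d) → ℝ) :
    Real.sqrt (S.mfeForm K U + (cellDiam K.1 * (|(0 : ℝ)| * Real.sqrt (cellVol K.1))) ^ 2) =
      Real.sqrt (S.mfeForm K U) := by
  rw [abs_zero, zero_mul, mul_zero, zero_pow two_ne_zero, add_zero]

/-- The remainder acts as the constant source `R / |K|`, whose `L²` norm on the element is
`|K|^{-1/2} |R|`. -/
theorem sqrt_estRem (c : Co) (K : (P.mesh n).Elem) :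
    Real.sqrt (S.mfeForm K (fun _ => 0) + (cellDiam K.1 *
      (|-((cellVol K.1)⁻¹ * S.residual c K S.add)| * Real.sqrt (cellVol K.1))) ^ 2) =
      S.estRem c K := by
  have hV := ((P.mesh n).isCell K).cellVol_pos ((P.mesh n).isCell K).nonempty
  have hs := Real.sqrt_pos.2 hV
  have hD : 0 ≤ cellDiam K.1 := Metric.diam_nonneg
  have h0 : S.mfeForm K (fun _ => 0) = 0 := by simp [mfeForm, dotProduct]
  have h1 : (cellVol K.1)⁻¹ = (Real.sqrt (cellVol K.1))⁻¹ * (Real.sqrt (cellVol K.1))⁻¹ := by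
    rw [← mul_inv, Real.mul_self_sqrt hV.le]
  rw [h0, zero_add, Real.sqrt_sq (mul_nonneg hD (by positivity)), estRem, abs_neg,
    abs_mul, abs_of_pos (inv_pos.2 hV), h1]
  field_simp

/-- Bound of the residual at a fixed time. -/
theorem abs_residual_le (hd : 1 ≤ d) (hτ : 0 < S.tau) (c : Co) (t : ℝ) {φ : E d → ℝ}
    {w : E d → E d} (hφ : IsWeakGradient P.Ω φ w) :
    |∑ K : (P.mesh n).Elem, ((∫ x in cellSet K.1, P.source n K c * φ x)
        - (∫ x in cellSet K.1, deriv (S.amountApprox c K) t * φ x)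
        + ∫ x in cellSet K.1, ⟪S.thetaApprox c K t x, w x⟫)| ≤
      S.elemNorm (S.estUpw c) * Real.sqrt (S.testNormSq φ w) +
      S.elemNorm (fun K => S.estTm c K t) * Real.sqrt (S.testNormSq φ w) +
      S.elemNorm (S.estLin c) * Real.sqrt (S.testNormSq φ w) +
      S.elemNorm (S.estAlg c) * Real.sqrt (S.testNormSq φ w) +
      S.elemNorm (S.estRem c) * Real.sqrt (S.testNormSq φ w) := by
  rw [S.residual_eq hd hτ c t hφ]
  refine (abs_add_le _ _).trans (add_le_add ((abs_add_le _ _).trans (add_le_add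
    ((abs_add_le _ _).trans (add_le_add ((abs_add_le _ _).trans (add_le_add ?_ ?_)) ?_)) ?_)) ?_)
  · exact S.abs_component_le hd hφ _ (fun _ => 0) _ fun K => S.sqrt_mfeForm_zero K _
  · exact S.abs_component_le hd hφ _ (fun _ => 0) _ fun K => S.sqrt_mfeForm_zero K _
  · exact S.abs_component_le hd hφ _ _ _ fun K => S.sqrt_mfeForm_scaledNorm hτ K _ _
  · exact S.abs_component_le hd hφ _ _ _ fun K => S.sqrt_mfeForm_scaledNorm hτ K _ _
  · exact S.abs_component_le hd hφ _ _ _ fun K => S.sqrt_estRem c K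

theorem continuous_estTm (c : Co) (K : (P.mesh n).Elem) : Continuous (S.estTm c K) := by
  have hp := S.continuous_pw
  have hV : ∀ s, Continuous fun t => S.vecTm c K t s := fun s => by
    simp only [S.vecTm_eq]
    fun_prop
  exact Real.continuous_sqrt.comp (continuous_form (mfeMatrix K.1 (P.perm n K))
    (fun s : extFaces K.1 => hV s.1) fun s : extFaces K.1 => hV s.1)

/-- The product of an elementwise estimator with a square integrable function of time. -/
theorem integral_elemNorm_mul_le {η : (P.mesh n).Elem → ℝ → ℝ} (hη : ∀ K, Continuous (η K))
    {N : ℝ → ℝ} (hN : MemLp N 2 (volume.restrict S.I)) (hN1 : ∫ t in S.I, N t ^ 2 = 1) :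
    IntegrableOn (fun t => S.elemNorm (fun K => η K t) * N t) S.I ∧
      ∫ t in S.I, S.elemNorm (fun K => η K t) * N t ≤ S.total 1 η := by
  have hc : Continuous fun t => S.elemNorm fun K => η K t := by
    unfold elemNorm
    fun_prop
  have hsq : ∀ t, S.elemNorm (fun K => η K t) ^ 2 = ∑ K, η K t ^ 2 := fun t =>
    Real.sq_sqrt (Finset.sum_nonneg fun K _ => sq_nonneg _)
  have hm : MemLp (fun t => S.elemNorm fun K => η K t) 2 (volume.restrict S.I) :=
    (memLp_two_iff_integrable_sq hc.aestronglyMeasurable).2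
      ((hc.pow 2).continuousOn.integrableOn_compact isCompact_Icc)
  refine ⟨hm.integrable_mul hN, (le_abs_self _).trans ((abs_integral_mul_le hm hN).trans_eq ?_)⟩
  simp only [hsq]
  rw [hN1, Real.sqrt_one, mul_one, total, one_mul]

/-- Bound of the residual of the component `c`, without the factors `δ`. -/
def residualBound (c : Co) : ℝ :=
  S.total 1 (fun K _ => S.estUpw c K) + S.total 1 (S.estTm c) +
    S.total 1 (fun K _ => S.estLin c K) + S.total 1 (fun K _ => S.estAlg c K) +
    S.total 1 (fun K _ => S.estRem c K)

/-- The pointwise bound in time is integrated, and the Cauchy-Schwarz inequality in time is applied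
to each component separately against the test norm, which is one. -/
theorem abs_le_residualBound (hd : 1 ≤ d) (hτ : 0 < S.tau) (c : Co) {r : ℝ}
    (hr : r ∈ S.residualValues c) : |r| ≤ S.residualBound c := by
  obtain ⟨φ, hφ, rfl⟩ := hr
  set N : ℝ → ℝ := fun t => Real.sqrt (S.testNormSq (φ.val t) (φ.grad t)) with hN
  have hNsq : ∀ t, N t ^ 2 = S.testNormSq (φ.val t) (φ.grad t) := fun t =>
    Real.sq_sqrt (Finset.sum_nonneg fun K _ => cellNormSq_nonneg (P.perm_posDef n K) _ _)
  have hone : ∫ t in S.I, S.testNormSq (φ.val t) (φ.grad t) = 1 := by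
    simp only [testNormSq, cellNormSq, Finset.sum_add_distrib]
    exact Real.sqrt_eq_one.1 hφ
  -- Integrability follows from the normalization itself, because the integral of a nonintegrable
  -- function is zero by convention.
  have hint : Integrable (fun t => S.testNormSq (φ.val t) (φ.grad t)) (volume.restrict S.I) := by
    by_contra hcon
    rw [integral_undef hcon] at hone
    exact zero_ne_one hone
  have hN2 : MemLp N 2 (volume.restrict S.I) := by
    refine (memLp_two_iff_integrable_sq
      (Real.continuous_sqrt.comp_aestronglyMeasurable hint.1)).2 ?_
    exact hint.congr (Filter.Eventually.of_forall fun t => (hNsq t).symm)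
  have hN1 : ∫ t in S.I, N t ^ 2 = 1 := by
    simp only [hNsq]
    exact hone
  have h := integral_add_le (integral_add_le (integral_add_le (integral_add_le
    (S.integral_elemNorm_mul_le (η := fun K _ => S.estUpw c K) (fun K => continuous_const) hN2 hN1)
    (S.integral_elemNorm_mul_le (S.continuous_estTm c) hN2 hN1))
    (S.integral_elemNorm_mul_le (η := fun K _ => S.estLin c K) (fun K => continuous_const) hN2 hN1))
    (S.integral_elemNorm_mul_le (η := fun K _ => S.estAlg c K) (fun K => continuous_const) hN2 hN1))
    (S.integral_elemNorm_mul_le (η := fun K _ => S.estRem c K) (fun K => continuous_const) hN2 hN1)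
  rw [← Real.norm_eq_abs]
  refine (norm_integral_le_of_norm_le h.1 ?_).trans h.2
  exact φ.weak.mono fun t ht => S.abs_residual_le hd hτ c t ht

end Step

/-! ### The total error -/

/-- The squared sum of the two roots is at most twice the sum of their squares. That sum is at most
the sum of `(A i + B i)²`, since the omitted products are nonnegative. -/
theorem sqrt_add_sqrt_le {ι : Type*} (s : Finset ι) {A B E : ι → ℝ} (hA : ∀ i, 0 ≤ A i)
    (hB : ∀ i, 0 ≤ B i) (hE : ∀ i, Real.sqrt 2 * (A i + B i) ≤ E i) :
    Real.sqrt (∑ i ∈ s, A i ^ 2) + Real.sqrt (∑ i ∈ s, B i ^ 2) ≤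
      Real.sqrt (∑ i ∈ s, E i ^ 2) := by
  refine Real.le_sqrt_of_sq_le ?_
  have hle : ∑ i ∈ s, A i ^ 2 + ∑ i ∈ s, B i ^ 2 ≤ ∑ i ∈ s, E i ^ 2 / 2 := by
    rw [← Finset.sum_add_distrib]
    refine Finset.sum_le_sum fun i _ => ?_
    have h1 := pow_le_pow_left₀ (mul_nonneg (Real.sqrt_nonneg 2) (add_nonneg (hA i) (hB i)))
      (hE i) 2
    rw [mul_pow, Real.sq_sqrt zero_le_two] at h1
    nlinarith [mul_nonneg (hA i) (hB i)]
  rw [← Finset.sum_div] at hle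
  have h1 := Real.sq_sqrt (Finset.sum_nonneg fun i (_ : i ∈ s) => sq_nonneg (A i))
  have h2 := Real.sq_sqrt (Finset.sum_nonneg fun i (_ : i ∈ s) => sq_nonneg (B i))
  nlinarith [sq_nonneg (Real.sqrt (∑ i ∈ s, A i ^ 2) - Real.sqrt (∑ i ∈ s, B i ^ 2))]

/-- Sums over the phases of a component and over the components of a phase become full sums, whose
order can be exchanged. -/
theorem sum_coe_eq_sum_dite {ι : Type*} [Fintype ι] (p : ι → Prop) [DecidablePred p]
    [Fintype {i // p i}] (f : ∀ i, p i → ℝ) :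
    ∑ i : {i // p i}, f i.1 i.2 = ∑ i, if h : p i then f i h else 0 := by
  rw [← Finset.sum_subset (Finset.filter_subset p Finset.univ) fun i _ hi => dif_neg fun h =>
    hi (Finset.mem_filter.2 ⟨Finset.mem_univ i, h⟩),
    Finset.sum_subtype (p := p) _ fun i => by simp]
  exact Finset.sum_congr rfl fun i _ => (dif_pos i.2).symm

namespace Step

variable {Ph Co : Type*} [Fintype Ph] [Fintype Co] {d n : ℕ} {P : Problem d Ph Co} (S : Step P n)

theorem total_eq {δ : ℝ} (hδ : 0 ≤ δ) (η : (P.mesh n).Elem → ℝ → ℝ) :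
    S.total δ η = Real.sqrt δ * S.total 1 η := by
  rw [total, total, one_mul, Real.sqrt_mul hδ]

theorem residualBound_nonneg (c : Co) : 0 ≤ S.residualBound c :=
  add_nonneg (add_nonneg (add_nonneg (add_nonneg (Real.sqrt_nonneg _) (Real.sqrt_nonneg _))
    (Real.sqrt_nonneg _)) (Real.sqrt_nonneg _)) (Real.sqrt_nonneg _)

theorem bddAbove_residualValues (hd : 1 ≤ d) (hτ : 0 < S.tau) (c : Co) :
    BddAbove (S.residualValues c) :=
  ⟨S.residualBound c, fun _ hr => (le_abs_self _).trans (S.abs_le_residualBound hd hτ c hr)⟩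

theorem dualNorm_sq_le (hd : 1 ≤ d) (hτ : 0 < S.tau) (c : Co) :
    S.dualNorm c ^ 2 ≤ S.residualBound c ^ 2 := by
  have h0 := S.residualBound_nonneg c
  refine sq_le_sq' ?_ (Real.sSup_le (fun r hr =>
    (le_abs_self _).trans (S.abs_le_residualBound hd hτ c hr)) h0)
  -- A lower bound is needed as well, because the dual norm is squared. Without test functions of
  -- unit norm the supremum is zero by convention.
  rcases (S.residualValues c).eq_empty_or_nonempty with he | ⟨r, hr⟩
  · rw [dualNorm, he, Real.sSup_empty]
    linarith
  · exact (neg_le_of_abs_le (S.abs_le_residualBound hd hτ c hr)).trans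
      (le_csSup (S.bddAbove_residualValues hd hτ c) hr)

/-- The part of the spatial estimator that comes from the nonconformity. -/
def estNC (c : Co) (K : (P.mesh n).Elem) (t : ℝ) : ℝ :=
  Real.sqrt (∑ p : PhasesOf P.comp c, S.estNCSq p K t)

theorem continuous_estNC (hτ : 0 < S.tau) (c : Co) (K : (P.mesh n).Elem) :
    Continuous (S.estNC c K) :=
  Real.continuous_sqrt.comp
    (continuous_finsetSum _ fun p _ => S.continuous_estNCSq hτ p K)

theorem total_estNC_sq (hd : 1 ≤ d) (hτ : 0 < S.tau) (c : Co) :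
    S.total 1 (S.estNC c) ^ 2 =
      ∑ p : PhasesOf P.comp c, ∫ t in S.I, ∑ K : (P.mesh n).Elem, S.estNCSq p K t := by
  have hsq : ∀ K t, S.estNC c K t ^ 2 = ∑ p : PhasesOf P.comp c, S.estNCSq p K t := fun K t =>
    Real.sq_sqrt (Finset.sum_nonneg fun p _ => S.estNCSq_nonneg hd hτ p K t)
  rw [total, one_mul, Real.sq_sqrt (integral_nonneg fun t => Finset.sum_nonneg fun K _ =>
    sq_nonneg _)]
  simp only [hsq]
  rw [← integral_finsetSum]
  · refine integral_congr_ae (Filter.Eventually.of_forall fun t => Finset.sum_comm)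
  · exact fun p _ => ((continuous_finsetSum _ fun K _ =>
      S.continuous_estNCSq hτ p K).continuousOn.integrableOn_compact isCompact_Icc)

/-- Both sides collect the same contributions of the pairs of a phase and one of its components,
once arranged by phases and once by components. -/
theorem sum_nonconformity_sq_le (hd : 1 ≤ d) (hτ : 0 < S.tau) :
    ∑ p, S.nonconformity p ^ 2 ≤ ∑ c, S.total 1 (S.estNC c) ^ 2 := by
  refine (Finset.sum_le_sum fun p _ => S.nonconformity_sq_le hd hτ p).trans_eq ?_
  simp only [S.total_estNC_sq hd hτ]
  have h1 : ∀ p, ∑ c : P.comp p, ∫ t in S.I, ∑ K : (P.mesh n).Elem,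
      S.estNCSq (⟨p, c.2⟩ : PhasesOf P.comp c.1) K t = ∑ c : Co,
        if h : c ∈ P.comp p then ∫ t in S.I, ∑ K : (P.mesh n).Elem,
          S.estNCSq (⟨p, h⟩ : PhasesOf P.comp c) K t else 0 := fun p =>
    sum_coe_eq_sum_dite (fun c => c ∈ P.comp p) fun c h => ∫ t in S.I, ∑ K : (P.mesh n).Elem,
      S.estNCSq (⟨p, h⟩ : PhasesOf P.comp c) K t
  have h2 : ∀ c, ∑ p : PhasesOf P.comp c, ∫ t in S.I, ∑ K : (P.mesh n).Elem,
      S.estNCSq p K t = ∑ p : Ph,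
        if h : c ∈ P.comp p then ∫ t in S.I, ∑ K : (P.mesh n).Elem,
          S.estNCSq (⟨p, h⟩ : PhasesOf P.comp c) K t else 0 := fun c =>
    sum_coe_eq_sum_dite (fun p => c ∈ P.comp p) fun p h => ∫ t in S.I, ∑ K : (P.mesh n).Elem,
      S.estNCSq (⟨p, h⟩ : PhasesOf P.comp c) K t
  simp only [h1, h2]
  exact Finset.sum_comm

/-- Twice the square of the sum of the two totals is at most four times the sum of their squares.
Elementwise, `x² + y² ≤ (x + y)²` for the nonnegative upwinding and nonconformity parts. -/
theorem sqrt_two_mul_le_total_estSp (hτ : 0 < S.tau) (c : Co) :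
    Real.sqrt 2 * (S.total 1 (fun K _ => S.estUpw c K) + S.total 1 (S.estNC c)) ≤
      S.total 4 (S.estSp c) := by
  have hint : ∀ {η : (P.mesh n).Elem → ℝ → ℝ}, (∀ K, Continuous (η K)) →
      IntegrableOn (fun t => ∑ K, η K t ^ 2) S.I := fun {η} hη =>
    (continuous_finsetSum _ fun K _ => (hη K).pow 2).continuousOn.integrableOn_compact
      isCompact_Icc
  have hnn : ∀ η : (P.mesh n).Elem → ℝ → ℝ, 0 ≤ ∫ t in S.I, ∑ K, η K t ^ 2 := fun η =>
    integral_nonneg fun t => Finset.sum_nonneg fun K _ => sq_nonneg _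
  have hu := hint (η := fun K _ => S.estUpw c K) fun K => continuous_const
  have hv := hint (S.continuous_estNC hτ c)
  have hs := hint (η := S.estSp c) fun K => continuous_const.add (S.continuous_estNC hτ c K)
  have hle : (∫ t in S.I, ∑ K, S.estUpw c K ^ 2) + (∫ t in S.I, ∑ K, S.estNC c K t ^ 2) ≤
      ∫ t in S.I, ∑ K, S.estSp c K t ^ 2 := by
    rw [← integral_add hu hv]
    refine integral_mono (hu.add hv) hs fun t => ?_
    dsimp only [Pi.add_apply]
    rw [← Finset.sum_add_distrib]
    refine Finset.sum_le_sum fun K _ => ?_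
    have h1 : 0 ≤ S.estUpw c K := Real.sqrt_nonneg _
    have h2 : 0 ≤ S.estNC c K t := Real.sqrt_nonneg _
    change _ ≤ (S.estUpw c K + S.estNC c K t) ^ 2
    nlinarith [mul_nonneg h1 h2]
  refine Real.le_sqrt_of_sq_le ?_
  rw [mul_pow, Real.sq_sqrt zero_le_two]
  have h1 : S.total 1 (fun K _ => S.estUpw c K) ^ 2 = ∫ t in S.I, ∑ K, S.estUpw c K ^ 2 := by
    rw [total, one_mul, Real.sq_sqrt (hnn fun K _ => S.estUpw c K)]
  have h2 : S.total 1 (S.estNC c) ^ 2 = ∫ t in S.I, ∑ K, S.estNC c K t ^ 2 := by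
    rw [total, one_mul, Real.sq_sqrt (hnn (S.estNC c))]
  nlinarith [sq_nonneg (S.total 1 (fun K _ => S.estUpw c K) - S.total 1 (S.estNC c))]

theorem sqrt_two_mul_le_estimator (hτ : 0 < S.tau) (c : Co) :
    Real.sqrt 2 * (S.residualBound c + S.total 1 (S.estNC c)) ≤ S.estimator c := by
  have h := S.sqrt_two_mul_le_total_estSp hτ c
  rw [estimator, S.total_eq zero_le_two, S.total_eq zero_le_two, S.total_eq zero_le_two,
    S.total_eq zero_le_two, residualBound]
  linarith

theorem errorMeasure_le (hd : 1 ≤ d) (hτ : 0 < S.tau) :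
    S.errorMeasure ≤ Real.sqrt (∑ c, S.estimator c ^ 2) :=
  (add_le_add
    (Real.sqrt_le_sqrt (Finset.sum_le_sum fun c _ => S.dualNorm_sq_le hd hτ c))
    (Real.sqrt_le_sqrt (S.sum_nonconformity_sq_le hd hτ))).trans
    (sqrt_add_sqrt_le _ S.residualBound_nonneg (fun _ => Real.sqrt_nonneg _)
      (S.sqrt_two_mul_le_estimator hτ))

end Step

end

end MultiphaseDarcy

theorem mainTheorem7 {d : ℕ} (hd : 1 ≤ d) {Ph Co : Type*} [Fintype Ph] [Fintype Co]
    (P : Problem d Ph Co)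
    (X : ℝ → E d → Unknowns P.comp) (hX : P.IsWeakSolution X)
    (n : ℕ) (hn : 1 ≤ n) (hnN : n ≤ P.N)
    (hmesh : (P.mesh n).Refines (P.mesh (n - 1)))
    (D : Discretization P n) (L : Linearization P n) (Z : PointValues P n)
    (Xprev : P.State (n - 1)) (Xlin : ℕ → P.State n) (Xalg : ℕ → ℕ → P.State n)
    (k i j : ℕ) (hk : 1 ≤ k) (hi : 1 ≤ i) (hj : 1 ≤ j)
    (S : Step P n)
    (hS : S = { disc := D, linz := L, points := Z, prev := Xprev, lin := Xlin (k - 1),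
                cur := Xalg k i, add := Xalg k (i + j) }) :
    (∀ c, BddAbove (S.residualValues c)) ∧
      S.errorMeasure ≤ Real.sqrt (∑ c, S.estimator c ^ 2) := by
  have hτ := S.tau_pos hn hnN
  exact ⟨S.bddAbove_residualValues hd hτ, S.errorMeasure_le hd hτ⟩
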